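/- **Setting.** A linear partial monitoring game consists of a compact action set $\mathcal A$, reward features $\phi_a\in\mathbb R^d$ and observation matrices $M_a\in\mathbb R^{m\times d}$ depending continuously on $a\in\mathcal A$, and a convex set $\Theta\subset\mathbb R^d$. For an unknown $\theta^*\in\Theta$, the learner chooses in each round $t=1,\dots,n$ an action $a_t$ and observes $y_t=M_{a_t}\theta^*+\epsilon_t$. Let $\mathcal F_t=\sigma(a_1,y_1,\dots,a_t,y_t)$; the noise satisfies $\mathbb E[e^{u^\top\epsilon_t}\mid\mathcal F_{t-1},a_t]\le e^{\rho^2\|u\|^2/2}$ for all $u\in\mathbb R^m$. The regret is $\mathfrak R_n=\max_{a}\mathbb E[\sum_{t=1}^n\langle\phi_a-\phi_{a_t},\theta^*\rangle]$, and $\Delta_{\max}=\max_{a,b}\langle\phi_a-\phi_b,\theta^*\rangle$. Convexity and boundedness: $\|\phi_a\|\le1$, $\|M_a\|\le L$ (spectral norm) and $\|\theta-\theta_0\|\le B$ for all $a\in\mathcal A$, $\theta\in\Theta$, where $\theta_0\in\Theta$ is given. The learner is also given $W\in\mathbb R^{d\times r}$ with $W^\top W=I_r$ and $M_a(\theta-\nu)=M_aWW^\top(\theta-\nu)$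 for all $a\in\mathcal A$, $\theta,\nu\in\Theta$. Throughout, $x/0=\infty$ for $x>0$ and $0/0=0$. **IDS** with regularizer $\lambda>0$. In round $t$ let $\hat\theta_t$ minimize $\sum_{s<t}\|M_{a_s}\theta-y_s\|^2+\lambda\|\theta-\theta_0\|^2$ over $\theta\in\Theta$, and put $$V_t=\sum_{s<t}M_{a_s}^\top M_{a_s}+\lambda I_d,\qquad W_t=W^\top V_tW,$$ $$\beta_t^{1/2}=\rho\sqrt{2\log(t^2)+\log\det W_t-\log\det(\lambda I_r)}+\sqrt\lambda B,\qquad \mathcal E_t=\{\theta\in\Theta:\|\theta-\hat\theta_t\|_{V_t}^2\le\beta_t\},$$ $$\hat\Delta_t(a)=\max_{\theta\in\mathcal E_t,\,b\in\mathcal A}\langle\phi_b-\phi_a,\theta\rangle,\qquad I_t(a)=\tfrac12\log\det\big(I_m+(M_aW)W_t^{-1}(M_aW)^\top\big).$$ Conditionally on $\mathcal F_{t-1}$, the action $a_t$ is sampled from a probability distribution $\mu_t$ on $\mathcal A$ that minimizes $\mu\mapsto(\int\hat\Delta_t\,d\mu)^2/\int I_t\,d\mu$. Let $\gamma_n=\sum_{t=1}^nI_t(a_t)$.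 **Local observability.** Let $\mathcal C_a=\{\theta\in\Theta:\langle\phi_a,\theta\rangle=\max_b\langle\phi_b,\theta\rangle\}$. The action $a$ is Pareto optimal, $a\in\mathcal P$, if $\mathcal C_a\ne\emptyset$ and $\dim\mathcal C_a=\dim\Theta$ (dimensions of affine hulls). Assume that every $\theta\in\Theta$ lies in $\mathcal C_a$ for some $a\in\mathcal P$ (this is automatic for finite $\mathcal A$). Let $\mathcal V=\mathrm{span}\{\theta-\nu:\theta,\nu\in\Theta\}$ and $\Delta(a|\theta)=\max_b\langle\phi_b-\phi_a,\theta\rangle$. For $\mathcal E\subset\Theta$ and $\eta>0$ let $\mathcal P(\mathcal E)=\{a\in\mathcal P:\mathcal C_a\cap\mathcal E\neq\emptyset\}$, let $\bar{\mathcal P}_\eta(\mathcal E)$ be the set of all $a\in\mathcal A$ with $\max_{\theta\in\mathcal E}\Delta(a|\theta)\le\eta\max_{b\in\mathcal P(\mathcal E)}\max_{\theta\in\mathcal E}\Delta(b|\theta)$, and let $$\alpha_\eta(\mathcal E)=\max_{\nu\in\mathcal V}\ \max_{a,b\in\mathcal P(\mathcal E)}\ \min_{c\in\bar{\mathcal P}_\eta(\mathcal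 E)}\frac{\langle\phi_a-\phi_b,\nu\rangle^2}{\|M_c\nu\|^2},\qquad\alpha(\mathcal E)=\inf_{\eta>0}\eta^2\alpha_\eta(\mathcal E)$$ (suprema and infima if not attained). The game is locally observable if $\sup_{\mathcal E\subset\Theta}\alpha(\mathcal E)<\infty$. Let $\bar\alpha_n=\frac1n\sum_{t=1}^n\alpha(\mathcal E_t)$. **Theorem.** There is an absolute constant $C$ such that in every locally observable game as above, for every $\lambda>0$, $n$ and $\theta^*\in\Theta$, the regret of IDS satisfies $$\mathfrak R_n\le\sqrt{16\max\{1,L^2/\lambda\}\;\mathbb E[\bar\alpha_n\beta_n]\;\mathbb E[\gamma_n]\;n}+C\,\Delta_{\max};$$ in particular, for $\lambda\ge L^2$ the constant under the root is $16$. Moreover $$\mathfrak R_n\le K\,r\sqrt{n\,\mathbb E[\bar\alpha_n]}\,\log(1+n)+C\,\Delta_{\max}$$ with $K$ depending only on $B,L,\lambda,\rho$, and, for every game and input $(W,\theta_0,B,L,\lambda,\rho)$, $$\mathfrak R_n\le K'\,r\sqrt{n\,\mathbb E[\bar\alpha_n]}\,\log(1+n)$$ with $K'$ depending only on the game and the input,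 not on $n$, $\theta^*$ or the noise. -/

import Mathlib

universe u v

open MeasureTheory ProbabilityTheory
open scoped ENNReal Matrix RealInnerProductSpace

noncomputable section

namespace LinPM

/-- A linear partial monitoring game with actions `A`: reward features `φ a ∈ ℝ^d`, observation
maps `M a ∈ ℝ^{m × d}` and a parameter set `Θ ⊆ ℝ^d`. -/
structure Game (A : Type*) (d m : ℕ) where
  φ : A → EuclideanSpace ℝ (Fin d)
  M : A → Matrix (Fin m) (Fin d) ℝ
  Θ : Set (EuclideanSpace ℝ (Fin d))

/-- The input of the learner: a basis `W ∈ ℝ^{d × r}`, the prior estimate `θ₀`, the bounds `B` on the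
parameters and `L` on the observation maps, the regularizer `lam` and the noise level `ρ`. -/
structure Input (d r : ℕ) where
  W : Matrix (Fin d) (Fin r) ℝ
  θ₀ : EuclideanSpace ℝ (Fin d)
  B : ℝ
  L : ℝ
  lam : ℝ
  ρ : ℝ

section Geometry

variable {A : Type*} {d m : ℕ} (G : Game A d m)

/-- The gap `Δ(a|θ) = max_b ⟨φ_b - φ_a, θ⟩`. -/
def Game.gap (a : A) (θ : EuclideanSpace ℝ (Fin d)) : ℝ :=
  ⨆ b : A, ⟪G.φ b - G.φ a, θ⟫

/-- `max_{θ ∈ E} Δ(a|θ)`. -/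
def Game.maxGap (E : Set (EuclideanSpace ℝ (Fin d))) (a : A) : ℝ :=
  sSup (G.gap a '' E)

/-- The cell of `a`: the parameters for which `a` is optimal. -/
def Game.cell (a : A) : Set (EuclideanSpace ℝ (Fin d)) :=
  {θ | θ ∈ G.Θ ∧ ∀ b, ⟪G.φ b, θ⟫ ≤ ⟪G.φ a, θ⟫}

/-- The Pareto optimal actions: those whose cell is nonempty and has the dimension (of the affine
hull) of `Θ`. -/
def Game.pareto : Set A :=
  {a | (G.cell a).Nonempty ∧
    Module.finrank ℝ (vectorSpan ℝ (G.cell a)) = Module.finrank ℝ (vectorSpan ℝ G.Θ)}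

/-- Every parameter has an optimal action that is Pareto optimal. -/
def Game.ParetoCovers : Prop :=
  ∀ θ ∈ G.Θ, ∃ a ∈ G.pareto, θ ∈ G.cell a

/-- The plausible Pareto set: Pareto optimal actions that are optimal for some `θ ∈ E`. -/
def Game.plausible (E : Set (EuclideanSpace ℝ (Fin d))) : Set A :=
  {a | a ∈ G.pareto ∧ ∃ θ ∈ E, θ ∈ G.cell a}

/-- The extended plausible Pareto set. -/
def Game.extPlausible (η : ℝ) (E : Set (EuclideanSpace ℝ (Fin d))) : Set A :=
  {a | G.maxGap E a ≤ η * sSup (G.maxGap E '' G.plausible E)}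

/-- The local alignment constant at scale `η`. The linear span of parameter differences is
`vectorSpan ℝ Θ`; in `ℝ≥0∞` one has `0 / 0 = 0` and `x / 0 = ∞` for `x > 0`. -/
def Game.alphaEta (η : ℝ) (E : Set (EuclideanSpace ℝ (Fin d))) : ℝ≥0∞ :=
  ⨆ ν ∈ vectorSpan ℝ G.Θ, ⨆ a ∈ G.plausible E, ⨆ b ∈ G.plausible E,
    ⨅ c ∈ G.extPlausible η E,
      ENNReal.ofReal (⟪G.φ a - G.φ b, ν⟫ ^ 2) /
        ENNReal.ofReal (‖Matrix.toEuclideanLin (G.M c) ν‖ ^ 2)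

/-- The local alignment constant `α(E) = inf_{η > 0} η² α_η(E)`. -/
def Game.alpha (E : Set (EuclideanSpace ℝ (Fin d))) : ℝ≥0∞ :=
  ⨅ (η : ℝ) (_ : 0 < η), ENNReal.ofReal (η ^ 2) * G.alphaEta η E

/-- Local observability: `sup_{E ⊆ Θ} α(E) < ∞`. -/
def Game.LocallyObservable : Prop :=
  (⨆ (E : Set (EuclideanSpace ℝ (Fin d))) (_ : E ⊆ G.Θ), G.alpha E) < ∞

/-- The largest gap `max_{a,b} ⟨φ_a - φ_b, θ⟩` under the parameter `θ`. -/
def Game.deltaMax (θ : EuclideanSpace ℝ (Fin d)) : ℝ :=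
  ⨆ a : A, ⨆ b : A, ⟪G.φ a - G.φ b, θ⟫

/-- The standing assumptions: features and observation maps depend continuously on the action (the
compactness of the action set being an instance), `Θ` is convex, everything is bounded, and `W` is a
valid basis. `‖M_a‖` is the spectral norm. -/
structure Admissible [TopologicalSpace A] {r : ℕ} (p : Input d r) : Prop where
  continuous_φ : Continuous G.φ
  continuous_M : Continuous G.M
  convex_Θ : Convex ℝ G.Θ
  prior_mem : p.θ₀ ∈ G.Θ
  norm_φ_le : ∀ a, ‖G.φ a‖ ≤ 1
  norm_M_le : ∀ a, ‖(Matrix.toEuclideanLin (G.M a)).toContinuousLinearMap‖ ≤ p.L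
  norm_Θ_le : ∀ θ ∈ G.Θ, ‖θ - p.θ₀‖ ≤ p.B
  L_nonneg : 0 ≤ p.L
  B_nonneg : 0 ≤ p.B
  lam_pos : 0 < p.lam
  ρ_nonneg : 0 ≤ p.ρ
  basis_orthonormal : p.Wᵀ * p.W = 1
  basis_valid : ∀ a, ∀ θ ∈ G.Θ, ∀ ν ∈ G.Θ,
    Matrix.toEuclideanLin (G.M a) (θ - ν) = Matrix.toEuclideanLin (G.M a * p.W * p.Wᵀ) (θ - ν)

end Geometry

/-- The random variables produced by an interaction. Rounds are `1, 2, 3, …`; the values at index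
`0` play no role. `act t` is the action, `obs t` the observation, `est t` the least-squares estimate
before round `t` and `samp t` the distribution from which the action of round `t` is sampled. -/
structure Run (A : Type*) [MeasurableSpace A] (d m : ℕ) (Ω : Type*) where
  act : ℕ → Ω → A
  obs : ℕ → Ω → EuclideanSpace ℝ (Fin m)
  est : ℕ → Ω → EuclideanSpace ℝ (Fin d)
  samp : ℕ → Ω → Measure A

section Algorithm

variable {A : Type*} [MeasurableSpace A] {d m r : ℕ} {Ω : Type*}
  (G : Game A d m) (p : Input d r) (R : Run A d m Ω)

/-- The σ-algebra `F_{t-1}` generated by the actions and observations of the rounds before `t`. -/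
@[reducible] def Run.past (t : ℕ) : MeasurableSpace Ω :=
  ⨆ s ∈ Finset.Ico 1 t,
    (MeasurableSpace.comap (R.act s) inferInstance ⊔ MeasurableSpace.comap (R.obs s) inferInstance)

/-- The σ-algebra generated by `F_{t-1}` and the action of round `t`. -/
@[reducible] def Run.pastAct (t : ℕ) : MeasurableSpace Ω :=
  R.past t ⊔ MeasurableSpace.comap (R.act t) inferInstance

/-- The regularized least-squares objective before round `t`. -/
def Run.lsLoss (t : ℕ) (ω : Ω) (θ : EuclideanSpace ℝ (Fin d)) : ℝ :=
  ∑ s ∈ Finset.Ico 1 t, ‖Matrix.toEuclideanLin (G.M (R.act s ω)) θ - R.obs s ω‖ ^ 2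
    + p.lam * ‖θ - p.θ₀‖ ^ 2

/-- `V_t = ∑_{s<t} M_{a_s}ᵀ M_{a_s} + λ I_d`. -/
def Run.V (t : ℕ) (ω : Ω) : Matrix (Fin d) (Fin d) ℝ :=
  ∑ s ∈ Finset.Ico 1 t, (G.M (R.act s ω))ᵀ * G.M (R.act s ω) + p.lam • 1

/-- `W_t = Wᵀ V_t W`. -/
def Run.Wt (t : ℕ) (ω : Ω) : Matrix (Fin r) (Fin r) ℝ :=
  p.Wᵀ * R.V G p t ω * p.W

/-- The confidence coefficient `β_t = β_{t,δ}` with `δ = 1 / t²`. -/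
def Run.beta (t : ℕ) (ω : Ω) : ℝ :=
  (p.ρ * √(2 * Real.log ((t : ℝ) ^ 2) + Real.log (R.Wt G p t ω).det
      - Real.log (p.lam • (1 : Matrix (Fin r) (Fin r) ℝ)).det)
    + √p.lam * p.B) ^ 2

/-- The confidence set `E_t = {θ ∈ Θ : ‖θ - θ̂_t‖²_{V_t} ≤ β_t}`. -/
def Run.conf (t : ℕ) (ω : Ω) : Set (EuclideanSpace ℝ (Fin d)) :=
  {θ | θ ∈ G.Θ ∧
    (θ - R.est t ω).ofLp ⬝ᵥ (R.V G p t ω *ᵥ (θ - R.est t ω).ofLp) ≤ R.beta G p t ω}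

/-- The gap estimate `max_{θ ∈ E_t} max_b ⟨φ_b - φ_a, θ⟩`. -/
def Run.gapEst (t : ℕ) (ω : Ω) (a : A) : ℝ :=
  G.maxGap (R.conf G p t ω) a

/-- The information gain `I_t(a) = ½ log det (I_m + (M_a W) W_t⁻¹ (M_a W)ᵀ)`. -/
def Run.info (t : ℕ) (ω : Ω) (a : A) : ℝ :=
  1 / 2 * Real.log
    (1 + (G.M a * p.W) * (R.Wt G p t ω)⁻¹ * (G.M a * p.W)ᵀ : Matrix (Fin m) (Fin m) ℝ).det

/-- The information ratio of a sampling distribution; here too `0 / 0 = 0` and `x / 0 = ∞` for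
`x > 0`. -/
def Run.ratio (t : ℕ) (ω : Ω) (μ : Measure A) : ℝ≥0∞ :=
  ENNReal.ofReal ((∫ a, R.gapEst G p t ω a ∂μ) ^ 2) /
    ENNReal.ofReal (∫ a, R.info G p t ω a ∂μ)

/-- The total information gain `γ_n`. -/
def Run.gamma (n : ℕ) (ω : Ω) : ℝ :=
  ∑ t ∈ Finset.Icc 1 n, R.info G p t ω (R.act t ω)

/-- The average realized local alignment constant `ᾱ_n`. -/
def Run.alphaBar (n : ℕ) (ω : Ω) : ℝ≥0∞ :=
  (∑ t ∈ Finset.Icc 1 n, G.alpha (R.conf G p t ω)) / n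

/-- The expected regret `max_a 𝔼[∑_{t=1}^n ⟨φ_a - φ_{a_t}, θ⟩]` for the true parameter `θ`. -/
def Run.regret [MeasurableSpace Ω] (P : Measure Ω) (θ : EuclideanSpace ℝ (Fin d)) (n : ℕ) : ℝ :=
  ⨆ a : A, ∫ ω, ∑ t ∈ Finset.Icc 1 n, ⟪G.φ a - G.φ (R.act t ω), θ⟫ ∂P

/-- `R` is a run over `n` rounds of information-directed sampling in the game `G` with true parameter
`θ`. -/
structure IsIDS [MeasurableSpace Ω] (P : Measure Ω) (θ : EuclideanSpace ℝ (Fin d)) (n : ℕ) :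
    Prop where
  measurable_act : ∀ t ∈ Finset.Icc 1 n, Measurable (R.act t)
  measurable_obs : ∀ t ∈ Finset.Icc 1 n, Measurable (R.obs t)
  /-- The noise `obs t - M_{a_t} θ` is conditionally `ρ`-sub-Gaussian given the past and the action
  of round `t`. -/
  noise : ∀ t ∈ Finset.Icc 1 n, ∀ u : EuclideanSpace ℝ (Fin m),
    Integrable
      (fun ω => Real.exp ⟪u, R.obs t ω - Matrix.toEuclideanLin (G.M (R.act t ω)) θ⟫) P ∧
    ∀ᵐ ω ∂P,
      (P[fun ω' => Real.exp ⟪u, R.obs t ω' - Matrix.toEuclideanLin (G.M (R.act t ω')) θ⟫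
        | R.pastAct t]) ω ≤ Real.exp (‖u‖ ^ 2 * p.ρ ^ 2 / 2)
  est_mem : ∀ t ∈ Finset.Icc 1 n, ∀ ω, R.est t ω ∈ G.Θ
  est_min : ∀ t ∈ Finset.Icc 1 n, ∀ ω, IsMinOn (R.lsLoss G p t ω) G.Θ (R.est t ω)
  samp_prob : ∀ t ∈ Finset.Icc 1 n, ∀ ω, IsProbabilityMeasure (R.samp t ω)
  /-- The sampling distribution is a function of the past. -/
  samp_past : ∀ t ∈ Finset.Icc 1 n, Measurable[R.past t] (R.samp t)
  samp_min : ∀ t ∈ Finset.Icc 1 n, ∀ ω, ∀ μ : Measure A, IsProbabilityMeasure μ →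
    R.ratio G p t ω (R.samp t ω) ≤ R.ratio G p t ω μ
  /-- Given the past, the action of round `t` has the distribution `samp t`. -/
  act_law : ∀ t ∈ Finset.Icc 1 n, ∀ S : Set A, MeasurableSet S →
    P[(R.act t ⁻¹' S).indicator (fun _ => (1 : ℝ)) | R.past t]
      =ᵐ[P] fun ω => (R.samp t ω).real S

end Algorithm

end LinPM

end

/-! The regret is at most the sum over rounds of the mean gap of the sampled action. When θ* ∈ E_t,
estimated gaps dominate true gaps, so the squared mean gap under μ_t is at most the information
ratio of μ_t times its mean information gain. Cauchy–Schwarz over the probability space and the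
rounds yields √(E[∑ ratio] · E[γ_n]). The event θ* ∉ E_t has probability at most 1/t², so it costs
at most ∑ Δ_max/t² ≤ 2Δ_max in total.

Since μ_t minimizes the ratio, one good action suffices to bound it
(`Admissible.exists_dirac_ratio_le`). Let D be the worst estimated gap among plausible actions,
nearly attained by a plausible b at some θ ∈ E_t; let a be Pareto optimal at θ, and let b be optimal
at θ_b ∈ E_t. Then D is essentially at most ⟨φ_a − φ_b, θ − θ_b⟩, and the alignment constant
supplies an action c of estimated gap at most ηD with ⟨φ_a − φ_b, θ − θ_b⟩² ≤ x ‖M_c(θ − θ_b)‖² for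
any x above α_η. The information gain controls this observation: ‖M_c ν‖² ≤ 4 max{1, L²/λ} I_t(c)
‖ν‖²_{V_t} (`Admissible.norm_sq_le_info`), while ‖θ − θ_b‖²_{V_t} ≤ 4β_t. Hence the constant 16.

The confidence sets come from the method of mixtures: exponential supermartingales in fixed
directions are averaged against a Gaussian (`IsIDS.lintegral_exp_noiseNormSq_le`). Convexity of Θ
gives the first-order condition for the constrained least-squares estimate, which converts the noise
bound into a bound on its error (`Admissible.mem_conf`). By the matrix determinant lemma log det W_t
is a telescoping sum of information gains, so γ_n is at most of order r log(1+n), and so is β_n once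
r ≥ 1.

To absorb the additive term, note that E_1 = Θ, so n·ᾱ_n ≥ α(Θ). If α(Θ) > 0 and r ≥ 1, the main
term is bounded below and swallows 2Δ_max. If α(Θ) = 0 or r = 0, a single action is optimal for all
of Θ, and then IDS has no regret at all (`IsIDS.regret_nonpos`). -/

set_option linter.unusedSectionVars false

noncomputable section

namespace LinPM

/-! ### Determinants, quadratic forms and Gaussian integrals -/

section MatrixLemmas

variable {ι κ : Type*} [Fintype ι] [Fintype κ]

theorem one_add_sum_le_prod_one_add {ι : Type*} (s : Finset ι) {f : ι → ℝ} (hf : ∀ i, 0 ≤ f i) :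
    1 + ∑ i ∈ s, f i ≤ ∏ i ∈ s, (1 + f i) := by
  classical
  induction s using Finset.induction_on with
  | empty => simp
  | insert a s ha ih =>
    rw [Finset.sum_insert ha, Finset.prod_insert ha]
    have := Finset.sum_nonneg fun i (_ : i ∈ s) => hf i
    nlinarith [hf a, mul_nonneg (hf a) this, mul_le_mul_of_nonneg_left ih (hf a)]

theorem exists_transpose_mul_self [DecidableEq ι] {N : Matrix ι ι ℝ} (hN : N.PosSemidef) :
    ∃ B : Matrix ι ι ℝ, N = Bᵀ * B := by
  open scoped MatrixOrder in
  obtain ⟨B, hB⟩ := CStarAlgebra.nonneg_iff_eq_star_mul_self.mp hN.nonneg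
  exact ⟨B, by simpa [Matrix.star_eq_conjTranspose, Matrix.conjTranspose_eq_transpose_of_trivial]
    using hB⟩

theorem dotProduct_gram_mulVec (B : Matrix κ ι ℝ) (x y : ι → ℝ) :
    x ⬝ᵥ (Bᵀ * B) *ᵥ y = (B *ᵥ x) ⬝ᵥ (B *ᵥ y) := by
  rw [← Matrix.mulVec_mulVec, Matrix.dotProduct_mulVec, Matrix.vecMul_transpose]

theorem dotProduct_mulVec_symm {A : Matrix ι ι ℝ} (hA : A.PosSemidef) (x y : ι → ℝ) :
    x ⬝ᵥ A *ᵥ y = y ⬝ᵥ A *ᵥ x := by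
  have h : Aᵀ = A := by
    simpa [Matrix.conjTranspose_eq_transpose_of_trivial] using hA.isHermitian.eq
  rw [Matrix.dotProduct_mulVec, ← Matrix.mulVec_transpose, h, dotProduct_comm]

/-- Writing N = BᵀB, this is Cauchy–Schwarz applied to each row of B. -/
theorem rayleigh_le_trace {N : Matrix ι ι ℝ} (hN : N.PosSemidef) (x : ι → ℝ)
    (hx : x ⬝ᵥ x = 1) : x ⬝ᵥ N *ᵥ x ≤ N.trace := by
  classical
  obtain ⟨B, rfl⟩ := exists_transpose_mul_self hN
  rw [dotProduct_gram_mulVec, Matrix.trace_mul_comm]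
  simp only [dotProduct, Matrix.trace, Matrix.diag, Matrix.mul_apply, Matrix.mulVec,
    Matrix.transpose_apply] at hx ⊢
  refine Finset.sum_le_sum fun i _ => ?_
  have := Finset.sum_mul_sq_le_sq_mul_sq Finset.univ (B i) x
  calc _ = (∑ j, B i j * x j) ^ 2 := by ring
    _ ≤ _ := this
    _ = _ := by
      have h1 : ∑ i, x i ^ 2 = 1 := by rw [← hx]; exact Finset.sum_congr rfl fun _ _ => sq _
      rw [h1, mul_one]; exact Finset.sum_congr rfl fun _ _ => sq _

/-- The characteristic polynomial is evaluated at −1; the signs on both sides cancel. -/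
theorem det_one_add_eq_prod [DecidableEq ι] {N : Matrix ι ι ℝ} (hN : N.IsHermitian) :
    (1 + N).det = ∏ i, (1 + hN.eigenvalues i) := by
  have h1 : N.charpoly.eval (-1) = ∏ i, (-1 - hN.eigenvalues i) := by
    rw [hN.charpoly_eq, Polynomial.eval_prod]; simp
  rw [Matrix.eval_charpoly] at h1
  have h2 : (Matrix.scalar ι (-1 : ℝ) - N) = -(1 + N) := by
    ext i j; simp [Matrix.scalar, Matrix.diagonal_apply, Matrix.one_apply]; split_ifs <;> ring
  rw [h2, Matrix.det_neg] at h1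
  have h3 : ∏ i, (-1 - hN.eigenvalues i) =
      (-1) ^ Fintype.card ι * ∏ i, (1 + hN.eigenvalues i) := by
    rw [← Finset.card_univ, ← Finset.prod_const, ← Finset.prod_mul_distrib]
    exact Finset.prod_congr rfl fun i _ => by ring
  rw [h3] at h1
  exact mul_left_cancel₀ (pow_ne_zero _ (by norm_num)) h1

theorem one_add_trace_le_det_one_add [DecidableEq ι] {N : Matrix ι ι ℝ} (hN : N.PosSemidef) :
    1 + N.trace ≤ (1 + N).det := by
  rw [det_one_add_eq_prod hN.isHermitian, hN.isHermitian.trace_eq_sum_eigenvalues]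
  exact one_add_sum_le_prod_one_add _ fun i => hN.eigenvalues_nonneg i

theorem one_le_det_one_add [DecidableEq ι] {N : Matrix ι ι ℝ} (hN : N.PosSemidef) :
    1 ≤ (1 + N).det := by
  linarith [one_add_trace_le_det_one_add hN, hN.trace_nonneg]

theorem inv_mulVec_cancel [DecidableEq ι] {A : Matrix ι ι ℝ} (hA : A.PosDef) (x : ι → ℝ) :
    A *ᵥ (A⁻¹ *ᵥ x) = x := by
  rw [Matrix.mulVec_mulVec, Matrix.mul_nonsing_inv _ hA.det_pos.ne'.isUnit, Matrix.one_mulVec]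

/-- The Cauchy–Schwarz inequality for the dual norms given by `A⁻¹` and `A`. -/
theorem dotProduct_sq_le [DecidableEq ι] {A : Matrix ι ι ℝ} (hA : A.PosDef) (x y : ι → ℝ) :
    (x ⬝ᵥ y) ^ 2 ≤ (x ⬝ᵥ A⁻¹ *ᵥ x) * (y ⬝ᵥ A *ᵥ y) := by
  -- The quadratic in s is the squared A-norm of A⁻¹x − s·y; its discriminant cannot be positive.
  have key : ∀ s : ℝ, 0 ≤ (y ⬝ᵥ A *ᵥ y) * (s * s) + (-2 * (x ⬝ᵥ y)) * s + x ⬝ᵥ A⁻¹ *ᵥ x := by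
    intro s
    have h := hA.posSemidef.dotProduct_mulVec_nonneg (A⁻¹ *ᵥ x - s • y)
    simp only [star_trivial, Matrix.mulVec_sub, inv_mulVec_cancel hA, Matrix.mulVec_smul,
      dotProduct_sub, sub_dotProduct, dotProduct_smul, smul_dotProduct, smul_eq_mul] at h
    have h2 : A⁻¹ *ᵥ x ⬝ᵥ A *ᵥ y = y ⬝ᵥ x := by
      rw [dotProduct_mulVec_symm hA.posSemidef, inv_mulVec_cancel hA]
    rw [h2, dotProduct_comm _ x, dotProduct_comm y x] at h
    linarith
  have := discrim_le_zero key
  simp only [discrim] at this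
  nlinarith

/-- With w = A⁻¹x one has c‖w‖² ≤ x·w ≤ ‖x‖‖w‖, which bounds x·w itself. -/
theorem inv_quadratic_le [DecidableEq ι] {A : Matrix ι ι ℝ} (hA : A.PosDef) {c : ℝ} (hc : 0 < c)
    (h : ∀ y, c * (y ⬝ᵥ y) ≤ y ⬝ᵥ A *ᵥ y) (x : ι → ℝ) :
    x ⬝ᵥ A⁻¹ *ᵥ x ≤ (x ⬝ᵥ x) / c := by
  set w := A⁻¹ *ᵥ x
  have h1 := h w
  have h2 : w ⬝ᵥ A *ᵥ w = x ⬝ᵥ w := by rw [inv_mulVec_cancel hA, dotProduct_comm]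
  have h3 : (x ⬝ᵥ w) ^ 2 ≤ (x ⬝ᵥ x) * (w ⬝ᵥ w) := by
    have := dotProduct_sq_le (Matrix.PosDef.one (n := ι) (R := ℝ)) x w
    simpa using this
  rw [h2] at h1
  have h0 : 0 ≤ x ⬝ᵥ x := by simpa using dotProduct_star_self_nonneg x
  have hw : 0 ≤ w ⬝ᵥ w := by simpa using dotProduct_star_self_nonneg w
  rw [le_div_iff₀ hc]
  by_contra hlt
  push Not at hlt
  have hp : 0 < x ⬝ᵥ w := pos_of_mul_pos_left (lt_of_le_of_lt h0 hlt) hc.le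
  nlinarith

/-- Each eigenvalue is the value of the form at a unit eigenvector. -/
theorem det_le_pow [DecidableEq ι] {A : Matrix ι ι ℝ} (hA : A.PosSemidef) {c : ℝ}
    (h : ∀ y, y ⬝ᵥ A *ᵥ y ≤ c * (y ⬝ᵥ y)) : A.det ≤ c ^ Fintype.card ι := by
  have hdet := hA.isHermitian.det_eq_prod_eigenvalues
  simp only [RCLike.ofReal_real_eq_id, id_eq] at hdet
  rw [hdet, ← Finset.card_univ, ← Finset.prod_const]
  refine Finset.prod_le_prod (fun i _ => hA.eigenvalues_nonneg i) fun i _ => ?_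
  set v : ι → ℝ := (hA.isHermitian.eigenvectorBasis i).ofLp
  have hv : A *ᵥ v = hA.isHermitian.eigenvalues i • v := hA.isHermitian.mulVec_eigenvectorBasis i
  have h1 : v ⬝ᵥ v = 1 := by
    have := hA.isHermitian.eigenvectorBasis.orthonormal.1 i
    have h2 := EuclideanSpace.real_norm_sq_eq (hA.isHermitian.eigenvectorBasis i)
    rw [this] at h2
    simp only [dotProduct, ← sq]
    linarith
  have := h v
  rw [hv, dotProduct_smul, h1] at this
  simpa using this

/-- The total mass of the unnormalized standard Gaussian density. -/
def gaussMass (ι : Type*) [Fintype ι] : ℝ≥0∞ :=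
  ∫⁻ x : ι → ℝ, ENNReal.ofReal (Real.exp (-(x ⬝ᵥ x) / 2))

/-- Only finiteness and positivity of this mass matter: it cancels in the mixture inequality, so its
value is never computed. -/
theorem gaussMass_ne_top : gaussMass ι ≠ ∞ := by
  have h : Integrable (fun x : ι → ℝ => ∏ i, Real.exp (-(1 / 2) * x i ^ 2)) :=
    Integrable.fintype_prod fun _ => integrable_exp_neg_mul_sq (by norm_num)
  have h2 : (fun x : ι → ℝ => ∏ i, Real.exp (-(1 / 2) * x i ^ 2)) =
      fun x => Real.exp (-(x ⬝ᵥ x) / 2) := by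
    ext x
    rw [← Real.exp_sum, ← Finset.mul_sum]
    congr 1
    simp only [dotProduct, ← sq]; ring
  rw [h2] at h
  exact h.lintegral_lt_top.ne

theorem gaussMass_ne_zero : gaussMass ι ≠ 0 := by
  unfold gaussMass
  rw [Ne, lintegral_eq_zero_iff (by fun_prop)]
  intro h
  have : ∀ᵐ x : ι → ℝ, False := by
    filter_upwards [h] with x hx
    simp only [Pi.zero_apply, ENNReal.ofReal_eq_zero] at hx
    exact absurd hx (not_le.2 (Real.exp_pos _))
  rw [Filter.eventually_false_iff_eq_bot, ae_eq_bot] at this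
  have hp := isOpen_univ.measure_pos (volume : Measure (ι → ℝ)) ⟨0, trivial⟩
  simp [this] at hp

/-- Complete the square around A⁻¹z, translate, and substitute y ↦ By with A = BᵀB; the Jacobian is
|det B| = √(det A). -/
theorem lintegral_gauss [DecidableEq ι] {A : Matrix ι ι ℝ} (hA : A.PosDef) (z : ι → ℝ) :
    ∫⁻ x : ι → ℝ, ENNReal.ofReal (Real.exp (x ⬝ᵥ z - (x ⬝ᵥ A *ᵥ x) / 2)) =
      ENNReal.ofReal (Real.exp ((z ⬝ᵥ A⁻¹ *ᵥ z) / 2)) * ENNReal.ofReal ((√A.det)⁻¹) *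
        gaussMass ι := by
  set u := A⁻¹ *ᵥ z with hu
  have hAu : A *ᵥ u = z := inv_mulVec_cancel hA z
  have hsq : ∀ x : ι → ℝ, x ⬝ᵥ z - (x ⬝ᵥ A *ᵥ x) / 2 =
      (z ⬝ᵥ u) / 2 + -((x - u) ⬝ᵥ A *ᵥ (x - u)) / 2 := by
    intro x
    simp only [Matrix.mulVec_sub, dotProduct_sub, sub_dotProduct, hAu]
    rw [dotProduct_mulVec_symm hA.posSemidef u x, hAu, dotProduct_comm u z]
    ring
  simp_rw [hsq, Real.exp_add, ENNReal.ofReal_mul (Real.exp_pos _).le]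
  rw [lintegral_const_mul _ (by fun_prop), mul_assoc]
  congr 1
  rw [lintegral_sub_right_eq_self
    (fun y : ι → ℝ => ENNReal.ofReal (Real.exp (-(y ⬝ᵥ A *ᵥ y) / 2))) u]
  obtain ⟨B, hB⟩ := exists_transpose_mul_self hA.posSemidef
  have hdet : A.det = B.det ^ 2 := by rw [hB, Matrix.det_mul, Matrix.det_transpose, sq]
  have hB0 : B.det ≠ 0 := by
    intro h; have := hA.det_pos; rw [hdet, h] at this; norm_num at this
  have hmap := Real.map_matrix_volume_pi_eq_smul_volume_pi hB0
  have h1 : ∀ y : ι → ℝ, ENNReal.ofReal (Real.exp (-(y ⬝ᵥ A *ᵥ y) / 2)) =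
      (fun x : ι → ℝ => ENNReal.ofReal (Real.exp (-(x ⬝ᵥ x) / 2))) (Matrix.toLin' B y) := by
    intro y
    simp only [hB, dotProduct_gram_mulVec, Matrix.toLin'_apply]
  simp_rw [h1]
  rw [← lintegral_map (f := (fun x : ι → ℝ => ENNReal.ofReal (Real.exp (-(x ⬝ᵥ x) / 2))))
    (by fun_prop) (LinearMap.continuous_of_finiteDimensional _).measurable, hmap,
    lintegral_smul_measure, smul_eq_mul, hdet, Real.sqrt_sq_eq_abs, abs_inv]
  rfl

end MatrixLemmas

/-! ### Euclidean norms and elementary inequalities -/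

section Quadratic

theorem dotProduct_self_nonneg {ι : Type*} [Fintype ι] (x : ι → ℝ) : 0 ≤ x ⬝ᵥ x := by
  simpa using dotProduct_star_self_nonneg x

theorem norm_sq_eq_dotProduct {ι : Type*} [Fintype ι] (x : EuclideanSpace ℝ ι) :
    ‖x‖ ^ 2 = x.ofLp ⬝ᵥ x.ofLp := by
  rw [EuclideanSpace.real_norm_sq_eq]; simp [dotProduct, sq]

theorem norm_toEuclideanLin_sq {d m : ℕ} (M : Matrix (Fin m) (Fin d) ℝ)
    (x : EuclideanSpace ℝ (Fin d)) :
    ‖Matrix.toEuclideanLin M x‖ ^ 2 = (M *ᵥ x.ofLp) ⬝ᵥ (M *ᵥ x.ofLp) := by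
  rw [norm_sq_eq_dotProduct]; rfl

theorem dotProduct_sq_le_mul {ι : Type*} [Fintype ι] (x y : ι → ℝ) :
    (x ⬝ᵥ y) ^ 2 ≤ (x ⬝ᵥ x) * (y ⬝ᵥ y) := by
  classical
  simpa using dotProduct_sq_le (Matrix.PosDef.one (n := ι) (R := ℝ)) x y

/-- A matrix and its transpose have the same spectral norm: q = ‖Bᵀu‖² = u·BBᵀu gives q² ≤ ‖u‖² · c
q, and q cancels. -/
theorem transpose_mulVec_sq_le {ι κ : Type*} [Fintype ι] [Fintype κ] {B : Matrix κ ι ℝ} {c : ℝ}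
    (hc : 0 ≤ c) (h : ∀ x, (B *ᵥ x) ⬝ᵥ (B *ᵥ x) ≤ c * (x ⬝ᵥ x)) (u : κ → ℝ) :
    (Bᵀ *ᵥ u) ⬝ᵥ (Bᵀ *ᵥ u) ≤ c * (u ⬝ᵥ u) := by
  set q := (Bᵀ *ᵥ u) ⬝ᵥ (Bᵀ *ᵥ u) with hq
  have h1 : q = u ⬝ᵥ (B *ᵥ (Bᵀ *ᵥ u)) := by
    rw [hq, Matrix.dotProduct_mulVec, ← Matrix.mulVec_transpose, Matrix.transpose_transpose,
      dotProduct_comm]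
  have h2 := dotProduct_sq_le_mul u (B *ᵥ (Bᵀ *ᵥ u))
  have h3 := h (Bᵀ *ᵥ u)
  rw [← h1] at h2
  have hu := dotProduct_self_nonneg u
  have hq0 : 0 ≤ q := dotProduct_self_nonneg _
  have h4 : q * q ≤ (c * (u ⬝ᵥ u)) * q := by nlinarith [mul_le_mul_of_nonneg_left h3 hu]
  rcases hq0.eq_or_lt with h0 | h0
  · rw [← h0]; positivity
  · exact le_of_mul_le_mul_right h4 h0

/-- From log(1+x) ≥ 2x/(x+2) and x + 2 ≤ 4X. Taking X = max{1, L²/λ} is the origin of that factor in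
the regret. -/
theorem half_div_le_log_one_add {x X : ℝ} (hx : 0 ≤ x) (hxX : x ≤ X) (hX : 1 ≤ X) :
    x / (2 * X) ≤ Real.log (1 + x) := by
  refine le_trans ?_ (Real.le_log_one_add_of_nonneg hx)
  rw [div_le_div_iff₀ (by positivity) (by positivity)]
  nlinarith

end Quadratic

/-! ### Design matrices, information gain and confidence coefficients -/

section RunAlgebra

variable {A : Type*} [TopologicalSpace A] [MeasurableSpace A] {d m r : ℕ} {Ω : Type*}
  {G : Game A d m} {p : Input d r} {R : Run A d m Ω}

theorem Admissible.mulVec_sq_le (h : Admissible G p) (a : A) (x : Fin d → ℝ) :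
    (G.M a *ᵥ x) ⬝ᵥ (G.M a *ᵥ x) ≤ p.L ^ 2 * (x ⬝ᵥ x) := by
  have h1 := (Matrix.toEuclideanLin (G.M a)).toContinuousLinearMap.le_opNorm (WithLp.toLp 2 x)
  have h2 : ‖Matrix.toEuclideanLin (G.M a) (WithLp.toLp 2 x)‖ ≤ p.L * ‖WithLp.toLp 2 x‖ :=
    h1.trans (mul_le_mul_of_nonneg_right (h.norm_M_le a) (norm_nonneg _))
  have h3 := pow_le_pow_left₀ (norm_nonneg _) h2 2
  rw [mul_pow, norm_toEuclideanLin_sq, norm_sq_eq_dotProduct] at h3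
  exact h3

theorem Admissible.basis_sq (h : Admissible G p) (x : Fin r → ℝ) :
    (p.W *ᵥ x) ⬝ᵥ (p.W *ᵥ x) = x ⬝ᵥ x := by
  rw [← dotProduct_gram_mulVec, h.basis_orthonormal, Matrix.one_mulVec]

theorem Admissible.basis_transpose_sq_le (h : Admissible G p) (x : Fin d → ℝ) :
    (p.Wᵀ *ᵥ x) ⬝ᵥ (p.Wᵀ *ᵥ x) ≤ x ⬝ᵥ x := by
  simpa using transpose_mulVec_sq_le zero_le_one (fun y => by rw [h.basis_sq, one_mul]) x

theorem Admissible.obsBasis_sq_le (h : Admissible G p) (a : A) (x : Fin r → ℝ) :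
    ((G.M a * p.W) *ᵥ x) ⬝ᵥ ((G.M a * p.W) *ᵥ x) ≤ p.L ^ 2 * (x ⬝ᵥ x) := by
  rw [← Matrix.mulVec_mulVec, ← h.basis_sq]
  exact h.mulVec_sq_le a _

theorem dotProduct_V_mulVec (t : ℕ) (ω : Ω) (x : Fin d → ℝ) :
    x ⬝ᵥ R.V G p t ω *ᵥ x =
      ∑ s ∈ Finset.Ico 1 t, (G.M (R.act s ω) *ᵥ x) ⬝ᵥ (G.M (R.act s ω) *ᵥ x)
        + p.lam * (x ⬝ᵥ x) := by
  rw [Run.V, Matrix.add_mulVec, dotProduct_add, Matrix.smul_mulVec, Matrix.one_mulVec,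
    dotProduct_smul, smul_eq_mul, Matrix.sum_mulVec, dotProduct_sum]
  simp_rw [dotProduct_gram_mulVec]

theorem Admissible.Wt_eq (h : Admissible G p) (t : ℕ) (ω : Ω) :
    R.Wt G p t ω =
      ∑ s ∈ Finset.Ico 1 t, (G.M (R.act s ω) * p.W)ᵀ * (G.M (R.act s ω) * p.W) + p.lam • 1 := by
  rw [Run.Wt, Run.V, Matrix.mul_add, Matrix.add_mul, Matrix.mul_smul, Matrix.mul_one,
    Matrix.smul_mul, h.basis_orthonormal, Matrix.mul_sum, Matrix.sum_mul]
  simp [Matrix.transpose_mul, Matrix.mul_assoc]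

theorem Admissible.dotProduct_Wt_mulVec (h : Admissible G p) (t : ℕ) (ω : Ω) (x : Fin r → ℝ) :
    x ⬝ᵥ R.Wt G p t ω *ᵥ x =
      ∑ s ∈ Finset.Ico 1 t,
        ((G.M (R.act s ω) * p.W) *ᵥ x) ⬝ᵥ ((G.M (R.act s ω) * p.W) *ᵥ x)
        + p.lam * (x ⬝ᵥ x) := by
  rw [h.Wt_eq, Matrix.add_mulVec, dotProduct_add, Matrix.smul_mulVec, Matrix.one_mulVec,
    dotProduct_smul, smul_eq_mul, Matrix.sum_mulVec, dotProduct_sum]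
  simp_rw [dotProduct_gram_mulVec]

theorem Admissible.lam_le_Wt (h : Admissible G p) (t : ℕ) (ω : Ω) (x : Fin r → ℝ) :
    p.lam * (x ⬝ᵥ x) ≤ x ⬝ᵥ R.Wt G p t ω *ᵥ x := by
  rw [h.dotProduct_Wt_mulVec]
  have := Finset.sum_nonneg fun s (_ : s ∈ Finset.Ico 1 t) =>
    dotProduct_self_nonneg ((G.M (R.act s ω) * p.W) *ᵥ x)
  linarith

theorem Admissible.lam_le_V (_h : Admissible G p) (t : ℕ) (ω : Ω) (x : Fin d → ℝ) :
    p.lam * (x ⬝ᵥ x) ≤ x ⬝ᵥ R.V G p t ω *ᵥ x := by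
  rw [dotProduct_V_mulVec]
  have := Finset.sum_nonneg fun s (_ : s ∈ Finset.Ico 1 t) =>
    dotProduct_self_nonneg ((G.M (R.act s ω)) *ᵥ x)
  linarith

theorem Admissible.smul_one_posDef (h : Admissible G p) :
    (p.lam • (1 : Matrix (Fin r) (Fin r) ℝ)).PosDef :=
  Matrix.PosDef.one.smul h.lam_pos

theorem gram_posSemidef {ι κ : Type*} [Fintype ι] [Fintype κ] (B : Matrix κ ι ℝ) :
    (Bᵀ * B).PosSemidef := by
  simpa [Matrix.conjTranspose_eq_transpose_of_trivial] using
    Matrix.posSemidef_conjTranspose_mul_self B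

theorem Admissible.Wt_posDef (h : Admissible G p) (t : ℕ) (ω : Ω) : (R.Wt G p t ω).PosDef := by
  rw [h.Wt_eq]
  exact Matrix.PosDef.posSemidef_add
    (Matrix.posSemidef_sum _ fun s _ => gram_posSemidef _) h.smul_one_posDef

theorem Admissible.Wt_one (h : Admissible G p) (ω : Ω) : R.Wt G p 1 ω = p.lam • 1 := by
  simp [h.Wt_eq]

theorem Admissible.Wt_succ (h : Admissible G p) {t : ℕ} (ht : 1 ≤ t) (ω : Ω) :
    R.Wt G p (t + 1) ω =
      R.Wt G p t ω + (G.M (R.act t ω) * p.W)ᵀ * (G.M (R.act t ω) * p.W) := by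
  rw [h.Wt_eq, h.Wt_eq, Finset.sum_Ico_succ_top ht]
  abel

theorem Admissible.infoMatrix_posSemidef (h : Admissible G p) (t : ℕ) (ω : Ω) (a : A) :
    ((G.M a * p.W) * (R.Wt G p t ω)⁻¹ * (G.M a * p.W)ᵀ).PosSemidef := by
  simpa [Matrix.conjTranspose_eq_transpose_of_trivial] using
    (h.Wt_posDef t ω (R := R)).inv.posSemidef.mul_mul_conjTranspose_same (G.M a * p.W)

theorem Admissible.info_nonneg (h : Admissible G p) (t : ℕ) (ω : Ω) (a : A) :
    0 ≤ R.info G p t ω a := by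
  unfold Run.info
  have := Real.log_nonneg (one_le_det_one_add (h.infoMatrix_posSemidef t ω a (R := R)))
  positivity

/-- The matrix determinant lemma: observing a multiplies det W_t by det(I + M_a W W_t⁻¹ (M_a W)ᵀ).
-/
theorem Admissible.det_add_gram (h : Admissible G p) (t : ℕ) (ω : Ω) (a : A) :
    Real.log (R.Wt G p t ω + (G.M a * p.W)ᵀ * (G.M a * p.W)).det =
      Real.log (R.Wt G p t ω).det + 2 * R.info G p t ω a := by
  have hW := (h.Wt_posDef t ω (R := R)).det_pos
  rw [Matrix.det_add_mul _ _ hW.ne'.isUnit, Real.log_mul hW.ne'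
    (lt_of_lt_of_le one_pos (one_le_det_one_add (h.infoMatrix_posSemidef t ω a (R := R)))).ne',
    Run.info]
  ring

theorem Admissible.log_det_Wt (h : Admissible G p) {t : ℕ} (ht : 1 ≤ t) (ω : Ω) :
    Real.log (R.Wt G p t ω).det = Real.log (p.lam • (1 : Matrix (Fin r) (Fin r) ℝ)).det +
      2 * ∑ s ∈ Finset.Ico 1 t, R.info G p s ω (R.act s ω) := by
  induction t, ht using Nat.le_induction with
  | base => simp [h.Wt_one]
  | succ t ht ih =>
    rw [h.Wt_succ ht, h.det_add_gram, ih, Finset.sum_Ico_succ_top ht]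
    ring

theorem Admissible.log_det_Wt_mono (h : Admissible G p) {s t : ℕ} (hs : 1 ≤ s) (hst : s ≤ t)
    (ω : Ω) : Real.log (R.Wt G p s ω).det ≤ Real.log (R.Wt G p t ω).det := by
  rw [h.log_det_Wt hs, h.log_det_Wt (hs.trans hst)]
  have := Finset.sum_le_sum_of_subset_of_nonneg (Finset.Ico_subset_Ico_right (a := 1) hst)
    fun i _ _ => h.info_nonneg i ω (R.act i ω) (R := R)
  linarith

theorem Admissible.log_det_Wt_ge (h : Admissible G p) {t : ℕ} (ht : 1 ≤ t) (ω : Ω) :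
    Real.log (p.lam • (1 : Matrix (Fin r) (Fin r) ℝ)).det ≤ Real.log (R.Wt G p t ω).det := by
  have := h.log_det_Wt_mono le_rfl ht ω (R := R)
  rwa [h.Wt_one] at this

theorem log_det_smul_one (p : Input d r) :
    Real.log (p.lam • (1 : Matrix (Fin r) (Fin r) ℝ)).det = r * Real.log p.lam := by
  simp [Real.log_pow]

theorem Admissible.log_det_Wt_add_gram_le (h : Admissible G p) {t : ℕ} (ht : 1 ≤ t) (ω : Ω)
    (a : A) :
    Real.log (R.Wt G p t ω + (G.M a * p.W)ᵀ * (G.M a * p.W)).det ≤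
      Real.log (p.lam • (1 : Matrix (Fin r) (Fin r) ℝ)).det +
        r * Real.log (1 + t * (p.L ^ 2 / p.lam)) := by
  have hlam := h.lam_pos
  have hpd : (R.Wt G p t ω + (G.M a * p.W)ᵀ * (G.M a * p.W)).PosDef :=
    (h.Wt_posDef t ω).add_posSemidef (gram_posSemidef _)
  have hq : ∀ y, y ⬝ᵥ (R.Wt G p t ω + (G.M a * p.W)ᵀ * (G.M a * p.W)) *ᵥ y ≤
      (p.lam + t * p.L ^ 2) * (y ⬝ᵥ y) := by
    intro y
    rw [Matrix.add_mulVec, dotProduct_add, h.dotProduct_Wt_mulVec, dotProduct_gram_mulVec]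
    -- There are t − 1 past rounds, and the added Gram matrix supplies the t-th multiple of L².
    have h1 := Finset.sum_le_card_nsmul (Finset.Ico 1 t) _ _ fun s _ =>
      h.obsBasis_sq_le (R.act s ω) y
    have h2 := h.obsBasis_sq_le a y
    rw [Nat.card_Ico, nsmul_eq_mul, Nat.cast_sub ht] at h1
    push_cast at h1
    linarith
  have hle := det_le_pow hpd.posSemidef hq
  have hpos : 0 < 1 + t * (p.L ^ 2 / p.lam) := by positivity
  have heq : p.lam + t * p.L ^ 2 = p.lam * (1 + t * (p.L ^ 2 / p.lam)) := by
    field_simp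
  calc _ ≤ Real.log ((p.lam + t * p.L ^ 2) ^ Fintype.card (Fin r)) :=
        Real.log_le_log hpd.det_pos hle
    _ = _ := by
        rw [Real.log_pow, heq, Real.log_mul hlam.ne' hpos.ne', Fintype.card_fin,
          log_det_smul_one p]
        ring

theorem Admissible.info_le (h : Admissible G p) {t : ℕ} (ht : 1 ≤ t) (ω : Ω) (a : A) :
    2 * R.info G p t ω a ≤ r * Real.log (1 + t * (p.L ^ 2 / p.lam)) := by
  have h1 := h.log_det_Wt_add_gram_le ht ω a (R := R)
  rw [h.det_add_gram] at h1
  linarith [h.log_det_Wt_ge ht ω (R := R)]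

theorem Admissible.gamma_le (h : Admissible G p) {n : ℕ} (hn : 1 ≤ n) (ω : Ω) :
    2 * R.gamma G p n ω ≤ r * Real.log (1 + n * (p.L ^ 2 / p.lam)) := by
  have h1 := h.log_det_Wt_add_gram_le hn ω (R.act n ω) (R := R)
  rw [h.det_add_gram, h.log_det_Wt hn] at h1
  have h2 : R.gamma G p n ω =
      ∑ s ∈ Finset.Ico 1 n, R.info G p s ω (R.act s ω) + R.info G p n ω (R.act n ω) := by
    rw [Run.gamma, ← Finset.sum_Ico_succ_top hn]; rfl
  rw [h2]
  linarith

theorem Admissible.beta_mono (h : Admissible G p) {t n : ℕ} (ht : 1 ≤ t) (htn : t ≤ n) (ω : Ω) :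
    R.beta G p t ω ≤ R.beta G p n ω := by
  have hB := h.B_nonneg
  have hρ := h.ρ_nonneg
  have h1 := h.log_det_Wt_mono ht htn ω (R := R)
  have ht' : (1 : ℝ) ≤ t := by exact_mod_cast ht
  have htn' : (t : ℝ) ≤ n := by exact_mod_cast htn
  have h2 : Real.log ((t : ℝ) ^ 2) ≤ Real.log ((n : ℝ) ^ 2) :=
    Real.log_le_log (by positivity) (by gcongr)
  unfold Run.beta
  gcongr

/-- The prior part of β_t alone. It makes the first confidence set all of Θ, and for B > 0 it gives
every confidence set a positive radius. -/
theorem Admissible.beta_ge (h : Admissible G p) (t : ℕ) (ω : Ω) :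
    p.lam * p.B ^ 2 ≤ R.beta G p t ω := by
  have hB := h.B_nonneg
  have hρ := h.ρ_nonneg
  have h3 : p.lam * p.B ^ 2 = (0 + √p.lam * p.B) ^ 2 := by
    rw [zero_add, mul_pow, Real.sq_sqrt h.lam_pos.le]
  rw [h3]
  unfold Run.beta
  gcongr
  positivity

theorem Admissible.beta_le (h : Admissible G p) {n : ℕ} (hn : 1 ≤ n) (ω : Ω) :
    R.beta G p n ω ≤ 2 * p.ρ ^ 2 * (4 * Real.log n + r * Real.log (1 + n * (p.L ^ 2 / p.lam)))
      + 2 * p.lam * p.B ^ 2 := by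
  have h0 := h.info_nonneg n ω (R.act n ω) (R := R)
  have h1 := h.log_det_Wt_add_gram_le hn ω (R.act n ω) (R := R)
  rw [h.det_add_gram] at h1
  have h2 := h.log_det_Wt_ge hn ω (R := R)
  have hlog : 0 ≤ Real.log n := Real.log_natCast_nonneg n
  unfold Run.beta
  rw [Real.log_pow]
  set S := (2 * ((2 : ℕ) * Real.log n) + Real.log (R.Wt G p n ω).det
      - Real.log (p.lam • (1 : Matrix (Fin r) (Fin r) ℝ)).det) with hS
  have hS0 : 0 ≤ S := by rw [hS]; push_cast; linarith
  have hS1 : S ≤ 4 * Real.log n + r * Real.log (1 + n * (p.L ^ 2 / p.lam)) := by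
    rw [hS]; push_cast; linarith
  have h3 := Real.sq_sqrt hS0
  have h4 := Real.sq_sqrt h.lam_pos.le
  calc (p.ρ * √S + √p.lam * p.B) ^ 2 ≤ 2 * (p.ρ * √S) ^ 2 + 2 * (√p.lam * p.B) ^ 2 := by
        nlinarith [sq_nonneg (p.ρ * √S - √p.lam * p.B)]
    _ = 2 * p.ρ ^ 2 * S + 2 * p.lam * p.B ^ 2 := by rw [mul_pow, mul_pow, h3, h4]; ring
    _ ≤ _ := by gcongr

/-- Directions along which the observation maps factor through the basis `W`. -/
def BasisValid (G : Game A d m) (p : Input d r) (ν : EuclideanSpace ℝ (Fin d)) : Prop :=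
  ∀ a, G.M a *ᵥ ν.ofLp = (G.M a * p.W) *ᵥ (p.Wᵀ *ᵥ ν.ofLp)

theorem Admissible.basisValid_sub (h : Admissible G p) {θ ν : EuclideanSpace ℝ (Fin d)}
    (hθ : θ ∈ G.Θ) (hν : ν ∈ G.Θ) : BasisValid G p (θ - ν) := by
  intro a
  have := congrArg WithLp.ofLp (h.basis_valid a θ hθ ν hν)
  rw [Matrix.mulVec_mulVec]
  exact this

/-- The observation terms agree on valid directions; only the regularizer shrinks, because Wᵀ is a
contraction. -/
theorem Admissible.Wt_basis_le_V (h : Admissible G p) (t : ℕ) (ω : Ω)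
    {ν : EuclideanSpace ℝ (Fin d)} (hν : BasisValid G p ν) :
    (p.Wᵀ *ᵥ ν.ofLp) ⬝ᵥ R.Wt G p t ω *ᵥ (p.Wᵀ *ᵥ ν.ofLp) ≤
      ν.ofLp ⬝ᵥ R.V G p t ω *ᵥ ν.ofLp := by
  rw [h.dotProduct_Wt_mulVec, dotProduct_V_mulVec]
  have h1 := mul_le_mul_of_nonneg_left (h.basis_transpose_sq_le ν.ofLp) h.lam_pos.le
  simp_rw [fun s => hν (R.act s ω)]
  linarith

/-- The information gain dominates the squared observation of plausible directions. -/
theorem Admissible.norm_sq_le_info (h : Admissible G p) (t : ℕ) (ω : Ω) (c : A)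
    {ν : EuclideanSpace ℝ (Fin d)} (hν : BasisValid G p ν) :
    ‖Matrix.toEuclideanLin (G.M c) ν‖ ^ 2 ≤
      4 * max 1 (p.L ^ 2 / p.lam) * R.info G p t ω c * (ν.ofLp ⬝ᵥ R.V G p t ω *ᵥ ν.ofLp) := by
  set X := max 1 (p.L ^ 2 / p.lam)
  set Q := ν.ofLp ⬝ᵥ R.V G p t ω *ᵥ ν.ofLp
  set N := G.M c * p.W
  set y := p.Wᵀ *ᵥ ν.ofLp
  set v := N *ᵥ y with hv
  have hX : 1 ≤ X := le_max_left _ _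
  have hI := h.info_nonneg t ω c (R := R)
  have hQ : 0 ≤ Q :=
    le_trans (mul_nonneg h.lam_pos.le (dotProduct_self_nonneg _)) (h.lam_le_V t ω ν.ofLp (R := R))
  have hWQ := h.Wt_basis_le_V t ω hν (R := R)
  have hWpd := h.Wt_posDef t ω (R := R)
  rw [norm_toEuclideanLin_sq, hν c]
  change v ⬝ᵥ v ≤ _
  rcases (dotProduct_self_nonneg v).eq_or_lt with h0 | h0
  · rw [← h0]; positivity
  set k := v ⬝ᵥ v
  -- Testing the information matrix on the unit vector along the observation v reduces the
  -- determinant to a scalar: det ≥ 1 + trace ≥ 1 + x.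
  set u : Fin m → ℝ := (√k)⁻¹ • v with hu
  have hk : √k * √k = k := Real.mul_self_sqrt h0.le
  have hk0 : 0 < √k := Real.sqrt_pos.2 h0
  have hu1 : u ⬝ᵥ u = 1 := by
    simp only [hu, smul_dotProduct, dotProduct_smul, smul_eq_mul]
    change (√k)⁻¹ * ((√k)⁻¹ * k) = 1
    field_simp
    rw [sq, hk]
  set z := Nᵀ *ᵥ u with hz
  set x := z ⬝ᵥ (R.Wt G p t ω)⁻¹ *ᵥ z
  have hx0 : 0 ≤ x := by simpa using hWpd.inv.posSemidef.dotProduct_mulVec_nonneg z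
  have hxX : x ≤ X := by
    have h1 := inv_quadratic_le hWpd h.lam_pos (fun y => h.lam_le_Wt t ω y) z
    have h2 := transpose_mulVec_sq_le (sq_nonneg p.L) (fun y => h.obsBasis_sq_le c y) u
    rw [hu1, mul_one] at h2
    exact h1.trans ((div_le_div_of_nonneg_right h2 h.lam_pos.le).trans (le_max_right _ _))
  have hdet : 1 + x ≤ (1 + N * (R.Wt G p t ω)⁻¹ * Nᵀ).det := by
    have hps := h.infoMatrix_posSemidef t ω c (R := R)
    refine le_trans ?_ (one_add_trace_le_det_one_add hps)
    have h1 := rayleigh_le_trace hps u hu1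
    have h2 : u ⬝ᵥ (N * (R.Wt G p t ω)⁻¹ * Nᵀ) *ᵥ u = x := by
      rw [← Matrix.mulVec_mulVec, ← Matrix.mulVec_mulVec, Matrix.dotProduct_mulVec,
        ← Matrix.mulVec_transpose]
    linarith
  have hlog : x / (2 * X) ≤ 2 * R.info G p t ω c := by
    refine (half_div_le_log_one_add hx0 hxX hX).trans ?_
    have := Real.log_le_log (by linarith) hdet
    unfold Run.info
    linarith
  -- Since z·y = u·v = ‖v‖, this is Cauchy–Schwarz for the dual norms of W_t.
  have hcs : k ≤ x * Q := by
    have h1 := dotProduct_sq_le hWpd z y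
    have h2 : z ⬝ᵥ y = √k := by
      rw [hz, Matrix.mulVec_transpose, ← Matrix.dotProduct_mulVec, hu, smul_dotProduct, ← hv]
      change (√k)⁻¹ * k = √k
      field_simp
      rw [sq, hk]
    rw [h2, sq, hk] at h1
    exact h1.trans (mul_le_mul_of_nonneg_left hWQ hx0)
  have hx2 : x ≤ 4 * X * R.info G p t ω c := by
    rw [div_le_iff₀ (by positivity)] at hlog
    linarith
  exact hcs.trans (mul_le_mul_of_nonneg_right hx2 hQ)

end RunAlgebra

/-! ### Gaps, cells and alignment constants -/

section GameGeometry

variable {A : Type*} [TopologicalSpace A] {d m r : ℕ} {G : Game A d m} {p : Input d r}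

/-- A bound on the norm of the parameters. -/
def Input.radius (p : Input d r) : ℝ := ‖p.θ₀‖ + p.B

theorem Admissible.radius_nonneg (h : Admissible G p) : 0 ≤ p.radius :=
  add_nonneg (norm_nonneg _) h.B_nonneg

theorem Admissible.norm_le_radius (h : Admissible G p) {θ : EuclideanSpace ℝ (Fin d)}
    (hθ : θ ∈ G.Θ) : ‖θ‖ ≤ p.radius := by
  have := norm_add_le p.θ₀ (θ - p.θ₀)
  rw [add_sub_cancel] at this
  exact this.trans (add_le_add_right (h.norm_Θ_le θ hθ) _)

theorem Admissible.norm_feature_sub_le (h : Admissible G p) (a b : A) : ‖G.φ b - G.φ a‖ ≤ 2 := by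
  linarith [_root_.norm_sub_le (G.φ b) (G.φ a), h.norm_φ_le a, h.norm_φ_le b]

theorem Admissible.inner_le (h : Admissible G p) (a b : A) (θ : EuclideanSpace ℝ (Fin d)) :
    ⟪G.φ b - G.φ a, θ⟫ ≤ 2 * ‖θ‖ :=
  (real_inner_le_norm _ _).trans
    (mul_le_mul_of_nonneg_right (h.norm_feature_sub_le a b) (norm_nonneg _))

theorem Admissible.inner_le_gap (h : Admissible G p) (a b : A) (θ : EuclideanSpace ℝ (Fin d)) :
    ⟪G.φ b - G.φ a, θ⟫ ≤ G.gap a θ :=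
  le_ciSup (f := fun b => ⟪G.φ b - G.φ a, θ⟫)
    ⟨2 * ‖θ‖, by rintro _ ⟨b, rfl⟩; exact h.inner_le a b θ⟩ b

theorem Admissible.gap_nonneg (h : Admissible G p) (a : A) (θ : EuclideanSpace ℝ (Fin d)) :
    0 ≤ G.gap a θ := by
  simpa using h.inner_le_gap a a θ

theorem Admissible.gap_le (h : Admissible G p) (a : A) (θ : EuclideanSpace ℝ (Fin d)) :
    G.gap a θ ≤ 2 * ‖θ‖ :=
  have : Nonempty A := ⟨a⟩
  ciSup_le fun b => h.inner_le a b θ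

theorem Admissible.gap_le_add (h : Admissible G p) (a a' : A) (θ : EuclideanSpace ℝ (Fin d)) :
    G.gap a θ ≤ G.gap a' θ + ⟪G.φ a' - G.φ a, θ⟫ := by
  have : Nonempty A := ⟨a⟩
  refine ciSup_le fun b => ?_
  have := h.inner_le_gap a' b θ
  simp only [inner_sub_left] at this ⊢
  linarith

/-- The two suprema differ by a constant shift. Continuity in the action follows without
differentiating through a supremum. -/
theorem Admissible.gap_eq_add (h : Admissible G p) (a a' : A) (θ : EuclideanSpace ℝ (Fin d)) :
    G.gap a θ = G.gap a' θ + ⟪G.φ a' - G.φ a, θ⟫ := by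
  refine le_antisymm (h.gap_le_add a a' θ) ?_
  have := h.gap_le_add a' a θ
  simp only [inner_sub_left] at this ⊢
  linarith

theorem Admissible.gap_eq_zero_of_mem_cell (h : Admissible G p) {a : A}
    {θ : EuclideanSpace ℝ (Fin d)} (hθ : θ ∈ G.cell a) : G.gap a θ = 0 := by
  have : Nonempty A := ⟨a⟩
  refine le_antisymm (ciSup_le fun b => ?_) (h.gap_nonneg a θ)
  have := hθ.2 b
  rw [inner_sub_left]
  linarith

theorem Admissible.gap_eq_of_mem_cell (h : Admissible G p) {a b : A}
    {θ : EuclideanSpace ℝ (Fin d)} (hθ : θ ∈ G.cell a) :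
    G.gap b θ = ⟪G.φ a - G.φ b, θ⟫ := by
  rw [h.gap_eq_add b a, h.gap_eq_zero_of_mem_cell hθ, zero_add]

theorem Admissible.continuous_gap (h : Admissible G p) (θ : EuclideanSpace ℝ (Fin d)) :
    Continuous fun a => G.gap a θ := by
  by_cases hA : Nonempty A
  · obtain ⟨a'⟩ := hA
    rw [show (fun a => G.gap a θ) = fun a => G.gap a' θ + ⟪G.φ a' - G.φ a, θ⟫ from
      funext fun a => h.gap_eq_add a a' θ]
    have := h.continuous_φ
    fun_prop
  · have := not_nonempty_iff.1 hA
    exact continuous_of_discreteTopology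

variable {E : Set (EuclideanSpace ℝ (Fin d))}

theorem Admissible.bddAbove_gap (h : Admissible G p) (hE : E ⊆ G.Θ) (a : A) :
    BddAbove (G.gap a '' E) :=
  ⟨2 * p.radius, by
    rintro _ ⟨θ, hθ, rfl⟩
    exact (h.gap_le a θ).trans (by gcongr; exact h.norm_le_radius (hE hθ))⟩

theorem Admissible.gap_le_maxGap (h : Admissible G p) (hE : E ⊆ G.Θ) (a : A)
    {θ : EuclideanSpace ℝ (Fin d)} (hθ : θ ∈ E) : G.gap a θ ≤ G.maxGap E a :=
  le_csSup (h.bddAbove_gap hE a) ⟨θ, hθ, rfl⟩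

theorem Admissible.maxGap_nonneg (h : Admissible G p) (a : A) : 0 ≤ G.maxGap E a :=
  Real.sSup_nonneg (by rintro _ ⟨θ, -, rfl⟩; exact h.gap_nonneg a θ)

theorem Admissible.maxGap_le (h : Admissible G p) (hE : E ⊆ G.Θ) (a : A) :
    G.maxGap E a ≤ 2 * p.radius :=
  Real.sSup_le (by
    rintro _ ⟨θ, hθ, rfl⟩
    exact (h.gap_le a θ).trans (by gcongr; exact h.norm_le_radius (hE hθ)))
    (mul_nonneg zero_le_two h.radius_nonneg)

theorem Admissible.maxGap_le_add (h : Admissible G p) (hE : E ⊆ G.Θ) (a a' : A) :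
    G.maxGap E a ≤ G.maxGap E a' + p.radius * ‖G.φ a - G.φ a'‖ := by
  refine Real.sSup_le ?_
    (add_nonneg (h.maxGap_nonneg a') (mul_nonneg h.radius_nonneg (norm_nonneg _)))
  rintro _ ⟨θ, hθ, rfl⟩
  rw [h.gap_eq_add a a']
  refine add_le_add (h.gap_le_maxGap hE a' hθ) ((real_inner_le_norm _ _).trans ?_)
  rw [mul_comm, norm_sub_rev]
  gcongr
  exact h.norm_le_radius (hE hθ)

theorem Admissible.continuous_maxGap (h : Admissible G p) (hE : E ⊆ G.Θ) :
    Continuous (G.maxGap E) := by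
  rw [continuous_iff_continuousAt]
  intro a
  have hφ : Filter.Tendsto (fun x => p.radius * ‖G.φ x - G.φ a‖) (nhds a) (nhds 0) := by
    have hc : Continuous fun x => p.radius * ‖G.φ x - G.φ a‖ := by
      have := h.continuous_φ
      fun_prop
    simpa using hc.tendsto a
  refine tendsto_iff_dist_tendsto_zero.2 (squeeze_zero (fun _ => dist_nonneg) (fun x => ?_) hφ)
  rw [Real.dist_eq, abs_sub_le_iff]
  have h1 := h.maxGap_le_add hE x a
  have h2 := h.maxGap_le_add hE a x
  rw [norm_sub_rev] at h2
  constructor <;> linarith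

/-- At θb the action b is at least as good as a, so subtracting ⟨φ_a − φ_b, θb⟩ ≤ 0 only increases
the value. This turns a gap into a pairing with a parameter difference, the only thing the alignment
constant controls. -/
theorem Admissible.inner_mem_plausible_le (h : Admissible G p) {a b : A}
    {θ θb : EuclideanSpace ℝ (Fin d)} (hθ : θ ∈ G.cell a) (hb : θb ∈ G.cell b) :
    G.gap b θ ≤ ⟪G.φ a - G.φ b, θ - θb⟫ := by
  rw [h.gap_eq_of_mem_cell hθ, inner_sub_right]
  have := hb.2 a
  have h2 : ⟪G.φ a - G.φ b, θb⟫ ≤ 0 := by rw [inner_sub_left]; linarith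
  linarith

theorem sub_mem_vectorSpan {θ ν : EuclideanSpace ℝ (Fin d)} (hθ : θ ∈ G.Θ) (hν : ν ∈ G.Θ) :
    θ - ν ∈ vectorSpan ℝ G.Θ := by
  simpa using vsub_mem_vectorSpan ℝ hθ hν

/-- The form in which alignment is used; the strict bound stands in for an infimum that need not be
attained. -/
theorem Game.exists_extPlausible_of_alphaEta_lt {η : ℝ} {x : ℝ≥0∞} (hx : G.alphaEta η E < x)
    {ν : EuclideanSpace ℝ (Fin d)} (hν : ν ∈ vectorSpan ℝ G.Θ) {a b : A}
    (ha : a ∈ G.plausible E) (hb : b ∈ G.plausible E) :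
    ∃ c ∈ G.extPlausible η E, ENNReal.ofReal (⟪G.φ a - G.φ b, ν⟫ ^ 2) /
        ENNReal.ofReal (‖Matrix.toEuclideanLin (G.M c) ν‖ ^ 2) < x := by
  have h1 : (⨅ c ∈ G.extPlausible η E, ENNReal.ofReal (⟪G.φ a - G.φ b, ν⟫ ^ 2) /
        ENNReal.ofReal (‖Matrix.toEuclideanLin (G.M c) ν‖ ^ 2)) ≤ G.alphaEta η E :=
    le_iSup₂_of_le ν hν (le_iSup₂_of_le a ha (le_iSup₂_of_le b hb le_rfl))
  simpa only [iInf_lt_iff, exists_prop] using h1.trans_lt hx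

theorem Game.alpha_lt_top (hG : G.LocallyObservable) (hE : E ⊆ G.Θ) : G.alpha E < ∞ :=
  lt_of_le_of_lt (le_iSup₂ (f := fun E (_ : E ⊆ G.Θ) => G.alpha E) E hE) hG

/-- An action optimal at θ₀ stays optimal at every θ, because moving from θ₀ to θ never separates it
from the optimal action there. -/
theorem Admissible.exists_optimal_of_plausible_eq (h : Admissible G p) (hP : G.ParetoCovers)
    (heq : ∀ ν ∈ vectorSpan ℝ G.Θ, ∀ a ∈ G.plausible G.Θ, ∀ b ∈ G.plausible G.Θ,
      ⟪G.φ a - G.φ b, ν⟫ = 0) : ∃ c, ∀ θ ∈ G.Θ, G.gap c θ = 0 := by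
  obtain ⟨b, hb, hb0⟩ := hP p.θ₀ h.prior_mem
  refine ⟨b, fun θ hθ => le_antisymm ?_ (h.gap_nonneg b θ)⟩
  obtain ⟨a, ha, ha0⟩ := hP θ hθ
  refine (h.inner_mem_plausible_le ha0 hb0).trans ?_
  rw [heq _ (sub_mem_vectorSpan hθ h.prior_mem) a ⟨ha, θ, hθ, ha0⟩ b ⟨hb, p.θ₀, h.prior_mem, hb0⟩]

theorem Admissible.mulVec_eq_zero_of_rank_zero (h : Admissible G p) (hr : r = 0) (a : A)
    {ν : EuclideanSpace ℝ (Fin d)} (hν : ν ∈ vectorSpan ℝ G.Θ) :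
    Matrix.toEuclideanLin (G.M a) ν = 0 := by
  have hle : vectorSpan ℝ G.Θ ≤ LinearMap.ker (Matrix.toEuclideanLin (G.M a)) := by
    rw [vectorSpan_def, Submodule.span_le]
    rintro _ ⟨θ, hθ, θ', hθ', rfl⟩
    have := h.basis_valid a θ hθ θ' hθ'
    have h0 : G.M a * p.W * p.Wᵀ = 0 := by
      subst hr
      ext i j
      simp [Matrix.mul_apply]
    rw [h0] at this
    simpa using this
  exact hle hν

/-- With r = 0 no parameter difference is observable. Since x/0 = ∞ for x > 0, a finite alignment
constant forces plausible actions to be indistinguishable in reward. -/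
theorem Admissible.exists_optimal_of_rank_zero (h : Admissible G p) (hP : G.ParetoCovers)
    (hG : G.LocallyObservable) (hr : r = 0) : ∃ c, ∀ θ ∈ G.Θ, G.gap c θ = 0 := by
  refine h.exists_optimal_of_plausible_eq hP fun ν hν a ha b hb => ?_
  have h1 := Game.alpha_lt_top hG (Set.Subset.refl G.Θ)
  simp only [Game.alpha, iInf_lt_iff] at h1
  obtain ⟨η, hη, h1⟩ := h1
  have h2 : G.alphaEta η G.Θ < ∞ := by
    by_contra h3
    rw [not_lt, top_le_iff] at h3
    rw [h3, ENNReal.mul_top (by simpa using hη.ne')] at h1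
    exact lt_irrefl _ h1
  obtain ⟨c, -, hc⟩ := Game.exists_extPlausible_of_alphaEta_lt h2 hν ha hb
  rw [h.mulVec_eq_zero_of_rank_zero hr c hν] at hc
  by_contra hne
  rw [norm_zero, zero_pow two_ne_zero, ENNReal.ofReal_zero, ENNReal.div_zero
    (by simpa using hne)] at hc
  exact lt_irrefl _ hc

/-- By compactness some c minimizes the worst gap. If that minimum δ is positive, small η leave no
admissible action, while bounded observations keep α_η away from zero; so a nonzero reward
difference would force α(Θ) > 0. -/
theorem Admissible.exists_optimal_of_alpha_eq_zero [CompactSpace A] (h : Admissible G p)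
    (hP : G.ParetoCovers) (hα : G.alpha G.Θ = 0) : ∃ c, ∀ θ ∈ G.Θ, G.gap c θ = 0 := by
  obtain ⟨a₀, ha₀, ha₀'⟩ := hP p.θ₀ h.prior_mem
  have : Nonempty A := ⟨a₀⟩
  obtain ⟨c, -, hc⟩ := isCompact_univ.exists_isMinOn (f := G.maxGap G.Θ) Set.univ_nonempty
    (h.continuous_maxGap subset_rfl).continuousOn
  have hc' : ∀ a, G.maxGap G.Θ c ≤ G.maxGap G.Θ a := fun a => hc (Set.mem_univ a)
  rcases (h.maxGap_nonneg c (E := G.Θ)).eq_or_lt with h0 | h0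
  · exact ⟨c, fun θ hθ => le_antisymm ((h.gap_le_maxGap subset_rfl c hθ).trans h0.symm.le)
      (h.gap_nonneg c θ)⟩
  refine h.exists_optimal_of_plausible_eq hP fun ν hν a ha b hb => ?_
  by_contra hne
  have hx : 0 < ⟪G.φ a - G.φ b, ν⟫ ^ 2 := by positivity
  set D := sSup (G.maxGap G.Θ '' G.plausible G.Θ)
  set δ := G.maxGap G.Θ c
  set Y := p.L ^ 2 * ‖ν‖ ^ 2 + 1
  have hY : 0 < Y := by positivity
  set q := ⟪G.φ a - G.φ b, ν⟫ ^ 2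
  have hD0 : 0 ≤ D := Real.sSup_nonneg (by rintro _ ⟨e, -, rfl⟩; exact h.maxGap_nonneg e)
  -- The first factor bounds η² below and the second bounds α_η below; the summands 1 in D + 1 and Y
  -- only avoid division by zero.
  set w : ℝ := (δ / (D + 1)) ^ 2 * (q / Y)
  have hw : 0 < w := by positivity
  have key : ENNReal.ofReal w ≤ G.alpha G.Θ := by
    refine le_iInf₂ fun η hη => ?_
    -- An empty extended plausible set gives α_η = ∞, so finiteness provides an action e with δ ≤
    -- ηD.
    rcases eq_or_ne (G.alphaEta η G.Θ) ∞ with htop | htop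
    · rw [htop, ENNReal.mul_top (by simpa using hη.ne')]; exact le_top
    have hη' : δ / (D + 1) ≤ η := by
      obtain ⟨e, he, -⟩ := Game.exists_extPlausible_of_alphaEta_lt (lt_top_iff_ne_top.2 htop) hν ha hb
      have h1 : δ ≤ η * D := (hc' e).trans he
      rw [div_le_iff₀ (by positivity)]
      nlinarith
    rw [ENNReal.ofReal_mul (by positivity)]
    refine mul_le_mul' (ENNReal.ofReal_le_ofReal (by gcongr)) ?_
    refine le_of_forall_gt fun x hx' => ?_
    obtain ⟨e, -, he⟩ := Game.exists_extPlausible_of_alphaEta_lt hx' hν ha hb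
    refine lt_of_le_of_lt ?_ he
    rw [ENNReal.ofReal_div_of_pos hY]
    refine ENNReal.div_le_div_left (ENNReal.ofReal_le_ofReal ?_) _
    have h1 := (Matrix.toEuclideanLin (G.M e)).toContinuousLinearMap.le_opNorm ν
    have h2 : ‖Matrix.toEuclideanLin (G.M e) ν‖ ≤ p.L * ‖ν‖ :=
      h1.trans (mul_le_mul_of_nonneg_right (h.norm_M_le e) (norm_nonneg _))
    have h3 := pow_le_pow_left₀ (norm_nonneg _) h2 2
    rw [mul_pow] at h3
    linarith
  rw [hα, nonpos_iff_eq_zero, ENNReal.ofReal_eq_zero] at key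
  linarith

theorem Admissible.deltaMax_bounds (h : Admissible G p) (θ : EuclideanSpace ℝ (Fin d)) (a b : A) :
    ⟪G.φ a - G.φ b, θ⟫ ≤ G.deltaMax θ := by
  have h1 : ∀ a, BddAbove (Set.range fun b => ⟪G.φ a - G.φ b, θ⟫) := fun a =>
    ⟨2 * ‖θ‖, by rintro _ ⟨b, rfl⟩; exact h.inner_le b a θ⟩
  have : Nonempty A := ⟨a⟩
  exact (le_ciSup (h1 a) b).trans (le_ciSup (f := fun a => ⨆ b, ⟪G.φ a - G.φ b, θ⟫)
    ⟨2 * ‖θ‖, by rintro _ ⟨a, rfl⟩; exact ciSup_le fun b => h.inner_le b a θ⟩ a)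

theorem Admissible.gap_le_deltaMax (h : Admissible G p) (θ : EuclideanSpace ℝ (Fin d)) (a : A) :
    G.gap a θ ≤ G.deltaMax θ :=
  have : Nonempty A := ⟨a⟩
  ciSup_le fun b => h.deltaMax_bounds θ b a

theorem Admissible.deltaMax_le [Nonempty A] (h : Admissible G p)
    (θ : EuclideanSpace ℝ (Fin d)) : G.deltaMax θ ≤ 2 * ‖θ‖ :=
  ciSup_le fun a => ciSup_le fun b => h.inner_le b a θ

theorem Admissible.deltaMax_nonneg [Nonempty A] (h : Admissible G p)
    (θ : EuclideanSpace ℝ (Fin d)) : 0 ≤ G.deltaMax θ := by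
  obtain ⟨a⟩ := ‹Nonempty A›
  simpa using h.deltaMax_bounds θ a a

end GameGeometry

/-! ### Bounding the minimal information ratio -/

section InformationRatio

variable {A : Type*} [TopologicalSpace A] [MeasurableSpace A] [BorelSpace A] {d m r : ℕ}
  {Ω : Type*} {G : Game A d m} {p : Input d r} {R : Run A d m Ω}

theorem conf_subset (t : ℕ) (ω : Ω) : R.conf G p t ω ⊆ G.Θ := fun _ hθ => hθ.1

theorem Admissible.continuous_gapEst (h : Admissible G p) (t : ℕ) (ω : Ω) :
    Continuous (R.gapEst G p t ω) := h.continuous_maxGap (conf_subset t ω)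

theorem Admissible.measurable_gapEst (h : Admissible G p) (t : ℕ) (ω : Ω) :
    Measurable (R.gapEst G p t ω) := (h.continuous_gapEst t ω).measurable

theorem Admissible.continuous_info (h : Admissible G p) (t : ℕ) (ω : Ω) :
    Continuous (R.info G p t ω) := by
  have hM := h.continuous_M
  unfold Run.info
  refine continuous_const.mul (Continuous.log ?_ fun a => ?_)
  · exact Continuous.matrix_det (continuous_const.add
      (((hM.matrix_mul continuous_const).matrix_mul continuous_const).matrix_mul
        (hM.matrix_mul continuous_const).matrix_transpose))
  · exact (lt_of_lt_of_le one_pos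
      (one_le_det_one_add (h.infoMatrix_posSemidef t ω a (R := R)))).ne'

theorem Admissible.ratio_dirac (h : Admissible G p) (t : ℕ) (ω : Ω) (c : A) :
    R.ratio G p t ω (Measure.dirac c) =
      ENNReal.ofReal (R.gapEst G p t ω c ^ 2) / ENNReal.ofReal (R.info G p t ω c) := by
  rw [Run.ratio, integral_dirac' _ _ (h.measurable_gapEst t ω).stronglyMeasurable,
    integral_dirac' _ _ (h.continuous_info t ω).measurable.stronglyMeasurable]

/-- The parallelogram law, dropping the nonnegative term at x + y. -/
theorem sub_quadratic_le {V : Matrix (Fin d) (Fin d) ℝ} (hV : V.PosSemidef) (x y : Fin d → ℝ) :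
    (x - y) ⬝ᵥ V *ᵥ (x - y) ≤ 2 * (x ⬝ᵥ V *ᵥ x) + 2 * (y ⬝ᵥ V *ᵥ y) := by
  have h := hV.dotProduct_mulVec_nonneg (x + y)
  simp only [star_trivial, Matrix.mulVec_sub, Matrix.mulVec_add, dotProduct_sub, sub_dotProduct,
    dotProduct_add, add_dotProduct] at h ⊢
  linarith

theorem Admissible.V_posDef (h : Admissible G p) (t : ℕ) (ω : Ω) : (R.V G p t ω).PosDef :=
  Matrix.PosDef.posSemidef_add
    (Matrix.posSemidef_sum _ fun _ _ => gram_posSemidef _) (Matrix.PosDef.one.smul h.lam_pos)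

theorem Admissible.conf_sub_le (h : Admissible G p) (t : ℕ) (ω : Ω)
    {θ ν : EuclideanSpace ℝ (Fin d)} (hθ : θ ∈ R.conf G p t ω) (hν : ν ∈ R.conf G p t ω) :
    (θ - ν).ofLp ⬝ᵥ R.V G p t ω *ᵥ (θ - ν).ofLp ≤ 4 * R.beta G p t ω := by
  have h1 := sub_quadratic_le (h.V_posDef t ω (R := R)).posSemidef
    (θ - R.est t ω).ofLp (ν - R.est t ω).ofLp
  have h2 : (θ - R.est t ω).ofLp - (ν - R.est t ω).ofLp = (θ - ν).ofLp := by
    simp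
  rw [h2] at h1
  linarith [hθ.2, hν.2]

/-- The factor 16 is 4 from inverting the logarithm times 4 from the squared diameter of the
confidence ellipsoid. -/
theorem Admissible.norm_sq_le_beta_info (h : Admissible G p) (t : ℕ) (ω : Ω) (c : A)
    {θ ν : EuclideanSpace ℝ (Fin d)} (hθ : θ ∈ R.conf G p t ω) (hν : ν ∈ R.conf G p t ω) :
    ‖Matrix.toEuclideanLin (G.M c) (θ - ν)‖ ^ 2 ≤
      16 * max 1 (p.L ^ 2 / p.lam) * R.beta G p t ω * R.info G p t ω c := by
  have h1 := h.norm_sq_le_info t ω c (h.basisValid_sub hθ.1 hν.1) (R := R)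
  have h2 := h.conf_sub_le t ω hθ hν
  have h3 := h.info_nonneg t ω c (R := R)
  have h4 : (0 : ℝ) ≤ max 1 (p.L ^ 2 / p.lam) := zero_le_one.trans (le_max_left _ _)
  have h5 := mul_le_mul_of_nonneg_left h2 (mul_nonneg (mul_nonneg zero_le_four h4) h3)
  linarith

/-- At scale `η`, some Dirac measure has a small information ratio. -/
theorem Admissible.exists_dirac_ratio_le (h : Admissible G p) (hP : G.ParetoCovers) {t : ℕ} {ω : Ω}
    (hE : (R.conf G p t ω).Nonempty) {η : ℝ} (hη : 0 < η) {x : ℝ} (hx : 0 < x)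
    (hα : G.alphaEta η (R.conf G p t ω) < ENNReal.ofReal x) {κ : ℝ} (hκ0 : 0 < κ) (hκ : κ < 1) :
    ∃ c, R.ratio G p t ω (Measure.dirac c) ≤ ENNReal.ofReal
      (16 * max 1 (p.L ^ 2 / p.lam) * R.beta G p t ω * (η ^ 2 * x) / κ ^ 2) := by
  set E := R.conf G p t ω
  set D := sSup (G.maxGap E '' G.plausible E)
  set X := max 1 (p.L ^ 2 / p.lam)
  set β := R.beta G p t ω
  have hEΘ : E ⊆ G.Θ := conf_subset t ω
  have hβ : 0 ≤ β := sq_nonneg _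
  have hX : 1 ≤ X := le_max_left _ _
  have hbdd : BddAbove (G.maxGap E '' G.plausible E) :=
    ⟨2 * p.radius, by rintro _ ⟨b, -, rfl⟩; exact h.maxGap_le hEΘ b⟩
  obtain ⟨θ₁, hθ₁⟩ := hE
  obtain ⟨b₁, hb₁, hb₁'⟩ := hP θ₁ (hEΘ hθ₁)
  have hb₁P : b₁ ∈ G.plausible E := ⟨hb₁, θ₁, hθ₁, hb₁'⟩
  have hD0 : 0 ≤ D := Real.sSup_nonneg (by rintro _ ⟨e, -, rfl⟩; exact h.maxGap_nonneg e)
  -- If D = 0, a plausible action has zero estimated gap, and its ratio is 0 even when its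
  -- information gain vanishes.
  rcases hD0.eq_or_lt with h0 | h0
  · refine ⟨b₁, ?_⟩
    have h1 : G.maxGap E b₁ ≤ D := le_csSup hbdd ⟨b₁, hb₁P, rfl⟩
    have h2 : R.gapEst G p t ω b₁ = 0 := le_antisymm (h1.trans h0.symm.le) (h.maxGap_nonneg b₁)
    rw [h.ratio_dirac, h2]
    simp
  have hκD : κ * D < D := by nlinarith
  -- The suprema defining D need not be attained, so b and then θ are chosen only to exceed κD.
  obtain ⟨_, ⟨b, hb, rfl⟩, hbD⟩ := exists_lt_of_lt_csSup (Set.Nonempty.image _ ⟨b₁, hb₁P⟩) hκD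
  obtain ⟨_, ⟨θ, hθ, rfl⟩, hθD⟩ := exists_lt_of_lt_csSup (Set.Nonempty.image _ ⟨θ₁, hθ₁⟩) hbD
  obtain ⟨a, ha, ha'⟩ := hP θ (hEΘ hθ)
  obtain ⟨hbP, θb, hθb, hθb'⟩ := id hb
  have hgap := h.inner_mem_plausible_le ha' hθb'
  obtain ⟨c, hc, hcx⟩ := Game.exists_extPlausible_of_alphaEta_lt hα
    (sub_mem_vectorSpan (hEΘ hθ) (hEΘ hθb)) ⟨ha, θ, hθ, ha'⟩ hb
  refine ⟨c, ?_⟩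
  set q := ⟪G.φ a - G.φ b, θ - θb⟫
  set y := ‖Matrix.toEuclideanLin (G.M c) (θ - θb)‖ ^ 2
  have hκD0 : 0 < κ * D := mul_pos hκ0 h0
  have hq : κ * D < q := hθD.trans_le hgap
  have hq2 : (κ * D) ^ 2 < q ^ 2 := pow_lt_pow_left₀ hq hκD0.le two_ne_zero
  have hy0 : 0 ≤ y := sq_nonneg _
  have hqy : q ^ 2 ≤ x * y := by
    rcases hy0.eq_or_lt with hy | hy
    · rw [← hy, ENNReal.ofReal_zero, ENNReal.div_zero
        (by simpa using (hκD0.trans hq).ne')] at hcx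
      exact absurd hcx not_top_lt
    · rw [← ENNReal.ofReal_div_of_pos hy, ENNReal.ofReal_lt_ofReal_iff hx, div_lt_iff₀ hy] at hcx
      exact hcx.le
  have hyI := h.norm_sq_le_beta_info t ω c hθ hθb
  change y ≤ 16 * X * β * R.info G p t ω c at hyI
  set I := R.info G p t ω c
  have hI0 : 0 ≤ I := h.info_nonneg t ω c
  have hDI : (κ * D) ^ 2 ≤ x * (16 * X * β * I) :=
    hq2.le.trans (hqy.trans (mul_le_mul_of_nonneg_left hyI hx.le))
  -- A positive D forces c to be informative, so the ratio of c is an honest quotient.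
  have hI : 0 < I := by
    rcases hI0.eq_or_lt with hI | hI
    · rw [← hI] at hDI
      have : 0 < (κ * D) ^ 2 := by positivity
      linarith
    · exact hI
  have hcD : R.gapEst G p t ω c ≤ η * D := hc
  have hc0 : 0 ≤ R.gapEst G p t ω c := h.maxGap_nonneg c
  rw [h.ratio_dirac, ← ENNReal.ofReal_div_of_pos hI]
  refine ENNReal.ofReal_le_ofReal ?_
  rw [div_le_div_iff₀ hI (by positivity)]
  calc R.gapEst G p t ω c ^ 2 * κ ^ 2 ≤ (η * D) ^ 2 * κ ^ 2 := by gcongr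
    _ = η ^ 2 * (κ * D) ^ 2 := by ring
    _ ≤ η ^ 2 * (x * (16 * X * β * I)) := by gcongr
    _ = _ := by ring

/-- The bound on the minimal information ratio in locally observable games. -/
theorem Admissible.ratio_le (h : Admissible G p) (hP : G.ParetoCovers) {t : ℕ} {ω : Ω}
    (hE : (R.conf G p t ω).Nonempty) (hα : G.alpha (R.conf G p t ω) ≠ ∞) {ψ : ℝ≥0∞}
    (hψ : ∀ μ : Measure A, IsProbabilityMeasure μ → ψ ≤ R.ratio G p t ω μ) :
    ψ ≤ ENNReal.ofReal (16 * max 1 (p.L ^ 2 / p.lam)) *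
      (G.alpha (R.conf G p t ω) * ENNReal.ofReal (R.beta G p t ω)) := by
  set E := R.conf G p t ω
  set X := max 1 (p.L ^ 2 / p.lam)
  set β := R.beta G p t ω
  have hβ : 0 ≤ β := sq_nonneg _
  have hX : 1 ≤ X := le_max_left _ _
  set α := (G.alpha E).toReal
  -- The slack ε serves both to exceed the infimum α and as the loss κ = 1 − ε in the suprema; it is
  -- sent to 0.
  have hlim : Filter.Tendsto
      (fun ε : ℝ => ENNReal.ofReal (16 * X * β * (α + ε) / (1 - ε) ^ 2))
      (nhdsWithin 0 (Set.Ioi 0)) (nhds (ENNReal.ofReal (16 * X * β * α))) := by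
    have hc : ContinuousAt (fun ε : ℝ => ENNReal.ofReal (16 * X * β * (α + ε) / (1 - ε) ^ 2)) 0 := by
      refine ENNReal.continuous_ofReal.continuousAt.comp (f := fun ε : ℝ => _)
        (ContinuousAt.div (by fun_prop) (by fun_prop) (by norm_num))
    have := hc.tendsto
    simp only [add_zero, sub_zero, one_pow, div_one] at this
    exact this.mono_left nhdsWithin_le_nhds
  have hαE : G.alpha E = ENNReal.ofReal α := (ENNReal.ofReal_toReal hα).symm
  rw [hαE, ← ENNReal.ofReal_mul ENNReal.toReal_nonneg, ← ENNReal.ofReal_mul (by positivity),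
    show 16 * X * (α * β) = 16 * X * β * α by ring]
  refine ge_of_tendsto hlim ?_
  filter_upwards [Ioo_mem_nhdsGT (zero_lt_one (α := ℝ))] with ε hε
  have hα0 : 0 ≤ α := ENNReal.toReal_nonneg
  have hlt : G.alpha E < ENNReal.ofReal (α + ε) := by
    rw [hαE]
    exact (ENNReal.ofReal_lt_ofReal_iff (by linarith [hε.1])).2 (by linarith [hε.1])
  simp only [Game.alpha, iInf_lt_iff] at hlt
  obtain ⟨η, hη, hlt⟩ := hlt
  have hη2 : 0 < η ^ 2 := by positivity
  have hx : G.alphaEta η E < ENNReal.ofReal ((α + ε) / η ^ 2) := by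
    rw [ENNReal.ofReal_div_of_pos hη2, ENNReal.lt_div_iff_mul_lt (Or.inl (by simpa using hη.ne'))
      (by simp), mul_comm]
    exact hlt
  obtain ⟨c, hc⟩ := h.exists_dirac_ratio_le hP hE hη (by have := hε.1; positivity) hx
    (κ := 1 - ε) (by linarith [hε.2]) (by linarith [hε.1])
  refine (hψ _ inferInstance).trans (hc.trans ?_)
  rw [mul_div_cancel₀ _ hη2.ne']

end InformationRatio

/-! ### Conditional sub-Gaussian noise in random directions -/

section SubGaussian

variable {Ω : Type*} {𝓖 mΩ : MeasurableSpace Ω} {P : Measure Ω} [IsProbabilityMeasure P]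
  {m : ℕ} {ε : Ω → EuclideanSpace ℝ (Fin m)} {ρ : ℝ}

/-- The exponential weight whose conditional expectation is at most `1` for sub-Gaussian noise. -/
def expWeight (ρ : ℝ) (u e : EuclideanSpace ℝ (Fin m)) : ℝ≥0∞ :=
  ENNReal.ofReal (Real.exp (⟪u, e⟫ - ‖u‖ ^ 2 * ρ ^ 2 / 2))

theorem continuous_expWeight_left (ρ : ℝ) (e : EuclideanSpace ℝ (Fin m)) :
    Continuous fun u => expWeight ρ u e := by
  unfold expWeight
  exact ENNReal.continuous_ofReal.comp (by fun_prop)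

theorem measurable_expWeight {Ω : Type*} {m₀ : MeasurableSpace Ω} (ρ : ℝ)
    {U ε : Ω → EuclideanSpace ℝ (Fin m)} (hU : Measurable U) (hε : Measurable ε) :
    Measurable fun ω => expWeight ρ (U ω) (ε ω) := by
  unfold expWeight
  have h1 : Measurable fun ω => ⟪U ω, ε ω⟫ := hU.inner hε
  have h2 : Measurable fun ω => ‖U ω‖ := hU.norm
  fun_prop

/-- Conditional sub-Gaussianity given `𝓖`. -/
def CondSubGaussian {Ω : Type*} (𝓖 : MeasurableSpace Ω) {mΩ : MeasurableSpace Ω} (P : Measure Ω)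
    (ε : Ω → EuclideanSpace ℝ (Fin m)) (ρ : ℝ) : Prop :=
  ∀ u : EuclideanSpace ℝ (Fin m), Integrable (fun ω => Real.exp ⟪u, ε ω⟫) P ∧
    ∀ᵐ ω ∂P, (P[fun ω' => Real.exp ⟪u, ε ω'⟫ | 𝓖]) ω ≤ Real.exp (‖u‖ ^ 2 * ρ ^ 2 / 2)

/-- Permits a strictly positive noise level, which the Gaussian mixture requires. -/
theorem CondSubGaussian.mono (hsub : CondSubGaussian 𝓖 P ε ρ) (hρ : 0 ≤ ρ) {ρ' : ℝ}
    (h : ρ ≤ ρ') : CondSubGaussian 𝓖 P ε ρ' := fun u =>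
  ⟨(hsub u).1, by
    filter_upwards [(hsub u).2] with ω hω
    exact hω.trans (Real.exp_le_exp.2 (by gcongr))⟩

theorem CondSubGaussian.setLIntegral_le (hsub : CondSubGaussian 𝓖 P ε ρ) (h𝓖 : 𝓖 ≤ mΩ)
    (u : EuclideanSpace ℝ (Fin m)) {S : Set Ω} (hS : MeasurableSet[𝓖] S) :
    ∫⁻ ω in S, expWeight ρ u (ε ω) ∂P ≤ P S := by
  obtain ⟨hint, hle⟩ := hsub u
  set c := Real.exp (‖u‖ ^ 2 * ρ ^ 2 / 2)
  have hc : 0 < c := Real.exp_pos _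
  have h1 : ∫ ω in S, Real.exp ⟪u, ε ω⟫ ∂P ≤ c * P.real S := by
    rw [← setIntegral_condExp h𝓖 hint hS]
    calc _ ≤ ∫ _ in S, c ∂P :=
          setIntegral_mono_ae integrable_condExp.integrableOn (integrable_const _).integrableOn hle
      _ = _ := by rw [setIntegral_const, smul_eq_mul, mul_comm]
  have h2 : ∀ ω, expWeight ρ u (ε ω) = ENNReal.ofReal (c⁻¹ * Real.exp ⟪u, ε ω⟫) := by
    intro ω
    rw [expWeight, Real.exp_sub, div_eq_inv_mul]
  simp_rw [h2]
  rw [← ofReal_integral_eq_lintegral_ofReal (hint.const_mul _).integrableOn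
    (Filter.Eventually.of_forall fun ω => by positivity), integral_const_mul]
  refine ENNReal.ofReal_le_of_le_toReal ?_
  rw [inv_mul_le_iff₀ hc]
  exact h1

/-- The bound on 𝓖-measurable sets says that the measure with density `expWeight`, restricted to 𝓖,
is dominated by P; 𝓖-measurable weights can then be integrated against both. -/
theorem CondSubGaussian.lintegral_const_le (hsub : CondSubGaussian 𝓖 P ε ρ) (h𝓖 : 𝓖 ≤ mΩ)
    (hε : Measurable ε) (u : EuclideanSpace ℝ (Fin m)) {Z : Ω → ℝ≥0∞} (hZ : Measurable[𝓖] Z) :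
    ∫⁻ ω, Z ω * expWeight ρ u (ε ω) ∂P ≤ ∫⁻ ω, Z ω ∂P := by
  have hf : Measurable fun ω => expWeight ρ u (ε ω) :=
    measurable_expWeight ρ measurable_const hε
  have hle : (P.withDensity fun ω => expWeight ρ u (ε ω)).trim h𝓖 ≤ P.trim h𝓖 := by
    refine Measure.le_iff.2 fun S hS => ?_
    rw [trim_measurableSet_eq h𝓖 hS, trim_measurableSet_eq h𝓖 hS, withDensity_apply _ (h𝓖 S hS)]
    exact hsub.setLIntegral_le h𝓖 u hS
  have hZ' : Measurable Z := hZ.mono h𝓖 le_rfl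
  calc _ = ∫⁻ ω, Z ω ∂(P.withDensity fun ω => expWeight ρ u (ε ω)) := by
        rw [lintegral_withDensity_eq_lintegral_mul _ hf hZ']
        simp [mul_comm]
    _ = ∫⁻ ω, Z ω ∂(P.withDensity fun ω => expWeight ρ u (ε ω)).trim h𝓖 :=
        (lintegral_trim h𝓖 hZ).symm
    _ ≤ ∫⁻ ω, Z ω ∂P.trim h𝓖 := lintegral_mono' hle le_rfl
    _ = _ := lintegral_trim h𝓖 hZ

/-- On each level set of U the direction is constant, and its indicator can be absorbed into the
weight Z. -/
theorem CondSubGaussian.lintegral_finite_range_le (hsub : CondSubGaussian 𝓖 P ε ρ) (h𝓖 : 𝓖 ≤ mΩ)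
    (hε : Measurable ε) {U : Ω → EuclideanSpace ℝ (Fin m)}
    (hmeas : ∀ u, MeasurableSet[𝓖] (U ⁻¹' {u})) (hfin : (Set.range U).Finite)
    {Z : Ω → ℝ≥0∞} (hZ : Measurable[𝓖] Z) :
    ∫⁻ ω, Z ω * expWeight ρ (U ω) (ε ω) ∂P ≤ ∫⁻ ω, Z ω ∂P := by
  classical
  have hZu : ∀ u, Measurable[𝓖] ((U ⁻¹' {u}).indicator Z) := fun u => hZ.indicator (hmeas u)
  have hsplit : ∀ g : EuclideanSpace ℝ (Fin m) → Ω → ℝ≥0∞, ∀ ω, Z ω * g (U ω) ω =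
      ∑ u ∈ hfin.toFinset, (U ⁻¹' {u}).indicator Z ω * g u ω := by
    intro g ω
    rw [Finset.sum_eq_single (U ω)]
    · simp
    · intro u _ hu
      rw [Set.indicator_of_notMem (fun h => hu (by simpa using h.symm)), zero_mul]
    · intro h
      exact absurd (hfin.mem_toFinset.2 ⟨ω, rfl⟩) h
  calc _ = ∑ u ∈ hfin.toFinset, ∫⁻ ω, (U ⁻¹' {u}).indicator Z ω * expWeight ρ u (ε ω) ∂P := by
        simp_rw [hsplit fun u ω => expWeight ρ u (ε ω)]
        refine lintegral_finsetSum _ fun u _ => ?_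
        exact ((hZu u).mono h𝓖 le_rfl).mul (measurable_expWeight ρ measurable_const hε)
    _ ≤ ∑ u ∈ hfin.toFinset, ∫⁻ ω, (U ⁻¹' {u}).indicator Z ω ∂P :=
        Finset.sum_le_sum fun u _ => hsub.lintegral_const_le h𝓖 hε u (hZu u)
    _ = ∫⁻ ω, Z ω ∂P := by
        rw [← lintegral_finsetSum _ fun u _ => (hZu u).mono h𝓖 le_rfl]
        congr 1
        ext ω
        simpa using (hsplit (fun _ _ => 1) ω).symm

/-- The sub-Gaussian bound for directions that are `𝓖`-measurable random vectors. -/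
theorem CondSubGaussian.lintegral_le (hsub : CondSubGaussian 𝓖 P ε ρ) (h𝓖 : 𝓖 ≤ mΩ)
    (hε : Measurable ε) {U : Ω → EuclideanSpace ℝ (Fin m)} (hU : Measurable[𝓖] U)
    {Z : Ω → ℝ≥0∞} (hZ : Measurable[𝓖] Z) :
    ∫⁻ ω, Z ω * expWeight ρ (U ω) (ε ω) ∂P ≤ ∫⁻ ω, Z ω ∂P := by
  have hU' : StronglyMeasurable[𝓖] U := hU.stronglyMeasurable
  obtain ⟨Us, hUs, hfin, hlimU⟩ : ∃ Us : ℕ → Ω → EuclideanSpace ℝ (Fin m),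
      (∀ k, Measurable[𝓖] (Us k)) ∧ (∀ k, (Set.range (Us k)).Finite) ∧
      ∀ ω, Filter.Tendsto (fun k => Us k ω) Filter.atTop (nhds (U ω)) :=
    ⟨fun k => hU'.approx k, fun k => @SimpleFunc.measurable _ _ 𝓖 _ (hU'.approx k),
      fun k => @SimpleFunc.finite_range _ _ 𝓖 (hU'.approx k),
      hU'.tendsto_approx⟩
  have hlim : ∀ ω, Filter.Tendsto (fun k => Z ω * expWeight ρ (Us k ω) (ε ω)) Filter.atTop
      (nhds (Z ω * expWeight ρ (U ω) (ε ω))) := by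
    intro ω
    refine ENNReal.Tendsto.const_mul
      (((continuous_expWeight_left ρ (ε ω)).tendsto _).comp (hlimU ω)) (Or.inl ?_)
    simp [expWeight, Real.exp_pos]
  -- Fatou's lemma along simple approximations of U; no domination is needed since only an upper
  -- bound is claimed.
  calc _ = ∫⁻ ω, Filter.liminf (fun k => Z ω * expWeight ρ (Us k ω) (ε ω)) Filter.atTop ∂P := by
        congr 1; ext ω; exact (hlim ω).liminf_eq.symm
    _ ≤ Filter.liminf (fun k => ∫⁻ ω, Z ω * expWeight ρ (Us k ω) (ε ω) ∂P) Filter.atTop := by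
        exact lintegral_liminf_le fun k => (hZ.mono h𝓖 le_rfl).mul
          (measurable_expWeight ρ ((hUs k).mono h𝓖 le_rfl) hε)
    _ ≤ Filter.liminf (fun _ => ∫⁻ ω, Z ω ∂P) Filter.atTop :=
        Filter.liminf_le_liminf (Filter.Eventually.of_forall fun k =>
          hsub.lintegral_finite_range_le h𝓖 hε (fun u => hUs k (measurableSet_singleton u)) (hfin k) hZ)
    _ = _ := Filter.liminf_const _

end SubGaussian

/-! ### Measurability of matrix operations -/

section MatrixMeasurability

variable {ι κ : Type*} [Fintype ι] [Fintype κ]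

instance matrixMeasurableSpace : MeasurableSpace (Matrix ι κ ℝ) :=
  inferInstanceAs (MeasurableSpace (ι → κ → ℝ))

instance matrixBorelSpace : BorelSpace (Matrix ι κ ℝ) :=
  inferInstanceAs (BorelSpace (ι → κ → ℝ))

instance matrixSecondCountable : SecondCountableTopology (Matrix ι κ ℝ) :=
  inferInstanceAs (SecondCountableTopology (ι → κ → ℝ))

/-- Inversion is discontinuous at singular matrices, but it is the measurable scalar det⁻¹ times the
continuous adjugate. -/
theorem measurable_matrix_inv [DecidableEq ι] :
    Measurable fun B : Matrix ι ι ℝ => B⁻¹ := by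
  have h1 : Measurable fun B : Matrix ι ι ℝ => B.det :=
    (Continuous.matrix_det continuous_id).measurable
  have h2 : Measurable fun B : Matrix ι ι ℝ => B.adjugate :=
    (Continuous.matrix_adjugate continuous_id).measurable
  have h3 : Continuous fun x : ℝ × Matrix ι ι ℝ => x.1 • x.2 := continuous_fst.smul continuous_snd
  have := h3.measurable.comp (h1.inv.prodMk h2)
  convert this using 2 with B
  rw [Matrix.inv_def, Ring.inverse_eq_inv']
  rfl

end MatrixMeasurability

/-! ### Measurability with respect to the past -/

section RunMeasurability

variable {A : Type*} [TopologicalSpace A] [MeasurableSpace A] [BorelSpace A] {d m r : ℕ}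
  {Ω : Type*} {G : Game A d m} {p : Input d r} {R : Run A d m Ω}

/-- The observation noise of a round under the parameter `θ`. -/
def Run.noiseAt (R : Run A d m Ω) (G : Game A d m) (θ : EuclideanSpace ℝ (Fin d)) (s : ℕ) (ω : Ω) :
    EuclideanSpace ℝ (Fin m) :=
  R.obs s ω - Matrix.toEuclideanLin (G.M (R.act s ω)) θ

/-- The accumulated noise in the coordinates given by `W`. -/
def Run.noiseSum (R : Run A d m Ω) (G : Game A d m) (p : Input d r)
    (θ : EuclideanSpace ℝ (Fin d)) (t : ℕ) (ω : Ω) : Fin r → ℝ :=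
  ∑ s ∈ Finset.Ico 1 t, (G.M (R.act s ω) * p.W)ᵀ *ᵥ (R.noiseAt G θ s ω).ofLp

theorem comap_act_le_past {s t : ℕ} (hs : 1 ≤ s) (hst : s < t) :
    MeasurableSpace.comap (R.act s) inferInstance ≤ R.past t :=
  le_trans le_sup_left (le_iSup₂_of_le (f := fun s (_ : s ∈ Finset.Ico 1 t) =>
    (MeasurableSpace.comap (R.act s) inferInstance ⊔ MeasurableSpace.comap (R.obs s) inferInstance))
    s (Finset.mem_Ico.2 ⟨hs, hst⟩) le_rfl)

theorem measurable_act_past {s t : ℕ} (hs : 1 ≤ s) (hst : s < t) :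
    Measurable[R.past t] (R.act s) :=
  measurable_iff_comap_le.2 (comap_act_le_past hs hst)

theorem measurable_obs_past {s t : ℕ} (hs : 1 ≤ s) (hst : s < t) :
    Measurable[R.past t] (R.obs s) :=
  measurable_iff_comap_le.2 (le_trans le_sup_right
    (le_iSup₂_of_le (f := fun s (_ : s ∈ Finset.Ico 1 t) =>
    (MeasurableSpace.comap (R.act s) inferInstance ⊔ MeasurableSpace.comap (R.obs s) inferInstance))
    s (Finset.mem_Ico.2 ⟨hs, hst⟩) le_rfl))

theorem measurable_act_pastAct (t : ℕ) : Measurable[R.pastAct t] (R.act t) :=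
  measurable_iff_comap_le.2 le_sup_right

theorem past_le_pastAct (t : ℕ) : R.past t ≤ R.pastAct t := le_sup_left

section

variable {m₀ : MeasurableSpace Ω}

theorem Admissible.measurable_M_act (h : Admissible G p) {s : ℕ} (hact : Measurable (R.act s)) :
    Measurable fun ω => G.M (R.act s ω) := h.continuous_M.measurable.comp hact

theorem Admissible.measurable_noiseAt (h : Admissible G p) {s : ℕ} (hact : Measurable (R.act s))
    (hobs : Measurable (R.obs s)) (θ : EuclideanSpace ℝ (Fin d)) :
    Measurable (R.noiseAt G θ s) := by
  have h1 : Continuous fun B : Matrix (Fin m) (Fin d) ℝ => Matrix.toEuclideanLin B θ :=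
    (PiLp.continuous_toLp 2 _).comp (Continuous.matrix_mulVec continuous_id continuous_const)
  exact hobs.sub (h1.measurable.comp (h.measurable_M_act hact))

theorem Admissible.measurable_obsBasis_mulVec (h : Admissible G p) {s : ℕ}
    (hact : Measurable (R.act s)) (x : Fin r → ℝ) :
    Measurable fun ω => WithLp.toLp 2 ((G.M (R.act s ω) * p.W) *ᵥ x) := by
  have h1 : Continuous fun B : Matrix (Fin m) (Fin d) ℝ => WithLp.toLp 2 ((B * p.W) *ᵥ x) :=
    (PiLp.continuous_toLp 2 _).comp
      (Continuous.matrix_mulVec (continuous_id.matrix_mul continuous_const) continuous_const)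
  exact h1.measurable.comp (h.measurable_M_act hact)

theorem Admissible.measurable_Wt (h : Admissible G p) {t : ℕ}
    (hact : ∀ s ∈ Finset.Ico 1 t, Measurable (R.act s)) : Measurable (R.Wt G p t) := by
  have h1 : Continuous fun B : Matrix (Fin m) (Fin d) ℝ => (B * p.W)ᵀ * (B * p.W) :=
    (continuous_id.matrix_mul continuous_const).matrix_transpose.matrix_mul
      (continuous_id.matrix_mul continuous_const)
  have h2 : R.Wt G p t = fun ω =>
      ∑ s ∈ Finset.Ico 1 t, (G.M (R.act s ω) * p.W)ᵀ * (G.M (R.act s ω) * p.W) + p.lam • 1 :=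
    funext fun ω => h.Wt_eq t ω
  rw [h2]
  exact (Finset.measurable_fun_sum _ fun s hs =>
    h1.measurable.comp (h.measurable_M_act (hact s hs))).add_const _

theorem Admissible.measurable_noiseSum (h : Admissible G p) {t : ℕ}
    (hact : ∀ s ∈ Finset.Ico 1 t, Measurable (R.act s))
    (hobs : ∀ s ∈ Finset.Ico 1 t, Measurable (R.obs s)) (θ : EuclideanSpace ℝ (Fin d)) :
    Measurable (R.noiseSum G p θ t) := by
  have h1 : Continuous fun x : Matrix (Fin m) (Fin d) ℝ × EuclideanSpace ℝ (Fin m) =>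
      (x.1 * p.W)ᵀ *ᵥ x.2.ofLp := by
    have h2 : Continuous fun x : Matrix (Fin m) (Fin d) ℝ × EuclideanSpace ℝ (Fin m) =>
      x.2.ofLp := by fun_prop
    exact Continuous.matrix_mulVec (continuous_fst.matrix_mul continuous_const).matrix_transpose h2
  have h3 : ∀ s ∈ Finset.Ico 1 t, Measurable fun ω =>
      (G.M (R.act s ω) * p.W)ᵀ *ᵥ (R.noiseAt G θ s ω).ofLp := by
    intro s hs
    have h4 : Measurable fun ω => (G.M (R.act s ω), R.noiseAt G θ s ω) :=
      (h.measurable_M_act (hact s hs)).prodMk (h.measurable_noiseAt (hact s hs) (hobs s hs) θ)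
    have h5 := h1.measurable
    have h6 := h5.comp h4
    exact h6
  exact Finset.measurable_fun_sum _ h3

/-- The information gain of an observation map relative to a regularized design matrix. -/
def infoFn (p : Input d r) (x : Matrix (Fin r) (Fin r) ℝ × Matrix (Fin m) (Fin d) ℝ) : ℝ :=
  1 / 2 * Real.log
    (1 + (x.2 * p.W) * x.1⁻¹ * (x.2 * p.W)ᵀ : Matrix (Fin m) (Fin m) ℝ).det

theorem measurable_infoFn (p : Input d r) : Measurable (infoFn (m := m) p) := by
  have h1 : Continuous fun x : Matrix (Fin r) (Fin r) ℝ × Matrix (Fin m) (Fin d) ℝ =>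
      (1 + (x.2 * p.W) * x.1 * (x.2 * p.W)ᵀ : Matrix (Fin m) (Fin m) ℝ).det :=
    Continuous.matrix_det (continuous_const.add
      (((continuous_snd.matrix_mul continuous_const).matrix_mul continuous_fst).matrix_mul
        (continuous_snd.matrix_mul continuous_const).matrix_transpose))
  have h2 : Measurable fun x : Matrix (Fin r) (Fin r) ℝ × Matrix (Fin m) (Fin d) ℝ =>
      (x.1⁻¹, x.2) := (measurable_matrix_inv.comp measurable_fst).prodMk measurable_snd
  exact ((Real.measurable_log.comp (h1.measurable.comp h2)).const_mul _)

end

end RunMeasurability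

/-! ### Exponential supermartingales in fixed directions -/

section Confidence

variable {A : Type*} [TopologicalSpace A] [MeasurableSpace A] [BorelSpace A] {d m r : ℕ}
  {Ω : Type*} {G : Game A d m} {p : Input d r} {R : Run A d m Ω} {θ : EuclideanSpace ℝ (Fin d)}

theorem inner_eq_dotProduct {k : ℕ} (x y : EuclideanSpace ℝ (Fin k)) :
    ⟪x, y⟫ = x.ofLp ⬝ᵥ y.ofLp := by
  rw [EuclideanSpace.inner_eq_star_dotProduct, star_trivial, dotProduct_comm]

/-- The compensators sum to the quadratic form of W_t − λI, the part of the design matrix that comes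
from data. -/
theorem prod_expWeight_eq (h : Admissible G p) (ρ : ℝ) (x : Fin r → ℝ) (t : ℕ) (ω : Ω) :
    ∏ s ∈ Finset.Ico 1 t, expWeight ρ (WithLp.toLp 2 ((G.M (R.act s ω) * p.W) *ᵥ x))
        (R.noiseAt G θ s ω) =
      ENNReal.ofReal (Real.exp (x ⬝ᵥ R.noiseSum G p θ t ω -
        ρ ^ 2 / 2 * (x ⬝ᵥ R.Wt G p t ω *ᵥ x - p.lam * (x ⬝ᵥ x)))) := by
  unfold expWeight
  rw [← ENNReal.ofReal_prod_of_nonneg fun _ _ => (Real.exp_pos _).le, ← Real.exp_sum]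
  congr 2
  rw [h.dotProduct_Wt_mulVec, add_sub_cancel_right, Run.noiseSum, dotProduct_sum, Finset.mul_sum,
    ← Finset.sum_sub_distrib]
  refine Finset.sum_congr rfl fun s _ => ?_
  rw [inner_eq_dotProduct, norm_sq_eq_dotProduct, Matrix.dotProduct_mulVec x,
    Matrix.vecMul_transpose]
  ring

variable {mΩ : MeasurableSpace Ω} {P : Measure Ω} [IsProbabilityMeasure P] {n : ℕ}

theorem IsIDS.past_le (hR : IsIDS G p R P θ n) {t : ℕ} (ht : t ≤ n + 1) : R.past t ≤ mΩ := by
  refine iSup₂_le fun s hs => ?_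
  have hs' : s ∈ Finset.Icc 1 n := by
    simp only [Finset.mem_Ico, Finset.mem_Icc] at hs ⊢; omega
  exact sup_le (hR.measurable_act s hs').comap_le (hR.measurable_obs s hs').comap_le

theorem IsIDS.pastAct_le (hR : IsIDS G p R P θ n) {t : ℕ} (ht : t ∈ Finset.Icc 1 n) :
    R.pastAct t ≤ mΩ := by
  refine sup_le (hR.past_le ?_) (hR.measurable_act t ht).comap_le
  simp only [Finset.mem_Icc] at ht; omega

theorem IsIDS.condSubGaussian (hR : IsIDS G p R P θ n) {t : ℕ} (ht : t ∈ Finset.Icc 1 n) :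
    CondSubGaussian (R.pastAct t) P (R.noiseAt G θ t) p.ρ := fun u => hR.noise t ht u

/-- Supermartingale induction: the last factor is removed conditionally on the past and the current
action, which together determine its direction M_{a_t}Wx and all earlier factors. -/
theorem IsIDS.lintegral_prod_expWeight_le (hR : IsIDS G p R P θ n) (h : Admissible G p) {ρ : ℝ}
    (hρ : p.ρ ≤ ρ) (x : Fin r → ℝ) {t : ℕ} (ht1 : 1 ≤ t) (ht : t ≤ n + 1) :
    ∫⁻ ω, ∏ s ∈ Finset.Ico 1 t, expWeight ρ (WithLp.toLp 2 ((G.M (R.act s ω) * p.W) *ᵥ x))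
        (R.noiseAt G θ s ω) ∂P ≤ 1 := by
  induction t, ht1 using Nat.le_induction with
  | base => simp
  | succ t ht1 ih =>
    have htn : t ∈ Finset.Icc 1 n := Finset.mem_Icc.2 ⟨ht1, by omega⟩
    refine le_trans ?_ (ih (by omega))
    simp_rw [Finset.prod_Ico_succ_top ht1]
    refine ((hR.condSubGaussian htn).mono h.ρ_nonneg hρ).lintegral_le (hR.pastAct_le htn)
      (h.measurable_noiseAt (hR.measurable_act t htn) (hR.measurable_obs t htn) θ)
      (h.measurable_obsBasis_mulVec (measurable_act_pastAct t) x) ?_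
    refine Finset.measurable_fun_prod _ fun s hs => ?_
    have hs' := Finset.mem_Ico.1 hs
    have hact : Measurable[R.pastAct t] (R.act s) :=
      (measurable_act_past hs'.1 hs'.2).mono (past_le_pastAct t) le_rfl
    have hobs : Measurable[R.pastAct t] (R.obs s) :=
      (measurable_obs_past hs'.1 hs'.2).mono (past_le_pastAct t) le_rfl
    exact measurable_expWeight ρ (h.measurable_obsBasis_mulVec hact x)
      (h.measurable_noiseAt hact hobs θ)

end Confidence

/-! ### Method of mixtures and the probability of the bad event -/

section Mixture

variable {A : Type*} [TopologicalSpace A] [MeasurableSpace A] [BorelSpace A] {d m r : ℕ}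
  {Ω : Type*} {G : Game A d m} {p : Input d r} {R : Run A d m Ω} {θ : EuclideanSpace ℝ (Fin d)}
  {mΩ : MeasurableSpace Ω} {P : Measure Ω} [IsProbabilityMeasure P] {n : ℕ}

theorem IsIDS.measurable_Wt (hR : IsIDS G p R P θ n) (h : Admissible G p) {t : ℕ}
    (ht : t ≤ n + 1) : Measurable (R.Wt G p t) :=
  h.measurable_Wt fun s hs => hR.measurable_act s (by
    simp only [Finset.mem_Ico, Finset.mem_Icc] at hs ⊢; omega)

theorem IsIDS.measurable_noiseSum (hR : IsIDS G p R P θ n) (h : Admissible G p) {t : ℕ}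
    (ht : t ≤ n + 1) : Measurable (R.noiseSum G p θ t) :=
  h.measurable_noiseSum (fun s hs => hR.measurable_act s (by
    simp only [Finset.mem_Ico, Finset.mem_Icc] at hs ⊢; omega))
    (fun s hs => hR.measurable_obs s (by
    simp only [Finset.mem_Ico, Finset.mem_Icc] at hs ⊢; omega)) θ

theorem measurable_quadratic {ι : Type*} [Fintype ι] {Ω' : Type*} {m₀ : MeasurableSpace Ω'}
    {B : Ω' → Matrix ι ι ℝ} {x y : Ω' → ι → ℝ} (hB : Measurable B) (hx : Measurable x)
    (hy : Measurable y) : Measurable fun ω => x ω ⬝ᵥ B ω *ᵥ y ω := by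
  have hBij : ∀ i j, Measurable fun ω => B ω i j := fun i j =>
    (measurable_pi_apply j).comp ((measurable_pi_apply i).comp hB)
  simp only [dotProduct, Matrix.mulVec]
  fun_prop

/-- The squared dual norm of the accumulated noise. -/
def Run.noiseNormSq (R : Run A d m Ω) (G : Game A d m) (p : Input d r)
    (θ : EuclideanSpace ℝ (Fin d)) (t : ℕ) (ω : Ω) : ℝ :=
  R.noiseSum G p θ t ω ⬝ᵥ (R.Wt G p t ω)⁻¹ *ᵥ R.noiseSum G p θ t ω

/-- The growth of the log-determinant of the design matrix. -/
def Run.logDetRatio (R : Run A d m Ω) (G : Game A d m) (p : Input d r) (t : ℕ) (ω : Ω) : ℝ :=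
  Real.log (R.Wt G p t ω).det - Real.log (p.lam • (1 : Matrix (Fin r) (Fin r) ℝ)).det

theorem IsIDS.measurable_noiseNormSq (hR : IsIDS G p R P θ n) (h : Admissible G p) {t : ℕ}
    (ht : t ≤ n + 1) : Measurable (R.noiseNormSq G p θ t) :=
  measurable_quadratic (measurable_matrix_inv.comp (hR.measurable_Wt h ht))
    (hR.measurable_noiseSum h ht) (hR.measurable_noiseSum h ht)

theorem IsIDS.measurable_logDetRatio (hR : IsIDS G p R P θ n) (h : Admissible G p) {t : ℕ}
    (ht : t ≤ n + 1) : Measurable (R.logDetRatio G p t) := by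
  have h1 : Measurable fun B : Matrix (Fin r) (Fin r) ℝ => B.det :=
    (Continuous.matrix_det continuous_id).measurable
  have h2 := h1.comp (hR.measurable_Wt h ht)
  exact (Real.measurable_log.comp h2).sub_const _

theorem inv_sqrt_eq_exp {x : ℝ} (hx : 0 < x) : (√x)⁻¹ = Real.exp (-(Real.log x / 2)) := by
  rw [Real.exp_neg, Real.exp_half, Real.exp_log hx]

theorem log_det_smul {ι : Type*} [Fintype ι] [DecidableEq ι] {B : Matrix ι ι ℝ} (hB : 0 < B.det)
    {c : ℝ} (hc : 0 < c) :
    Real.log (c • B).det = Fintype.card ι * Real.log c + Real.log B.det := by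
  rw [Matrix.det_smul, Real.log_mul (by positivity) hB.ne', Real.log_pow]

theorem inv_smul_quadratic {ι : Type*} [Fintype ι] [DecidableEq ι] {B : Matrix ι ι ℝ}
    (hB : 0 < B.det) {c : ℝ} (hc : 0 < c) (z : ι → ℝ) :
    z ⬝ᵥ (c • B)⁻¹ *ᵥ z = c⁻¹ * (z ⬝ᵥ B⁻¹ *ᵥ z) := by
  have : (c • B)⁻¹ = c⁻¹ • B⁻¹ := by
    have := Matrix.inv_smul' (A := B) (Units.mk0 c hc.ne') hB.ne'.isUnit
    simpa [Units.smul_def] using this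
  rw [this, Matrix.smul_mulVec, dotProduct_smul, smul_eq_mul]

/-- The method of mixtures: the self-normalized exponential moment is at most one. -/
theorem IsIDS.lintegral_exp_noiseNormSq_le (hR : IsIDS G p R P θ n) (h : Admissible G p) {ρ : ℝ}
    (hρ : p.ρ ≤ ρ) (hρ0 : 0 < ρ) {t : ℕ} (ht1 : 1 ≤ t) (ht : t ≤ n + 1) :
    ∫⁻ ω, ENNReal.ofReal (Real.exp (R.noiseNormSq G p θ t ω / ρ ^ 2 / 2 -
      R.logDetRatio G p t ω / 2)) ∂P ≤ 1 := by
  have hρ2 : 0 < ρ ^ 2 := by positivity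
  set D : Matrix (Fin r) (Fin r) ℝ := p.lam • 1 with hD
  have hDpd : D.PosDef := h.smul_one_posDef
  have hWpd := fun ω => h.Wt_posDef t ω (R := R)
  have hW := hR.measurable_Wt h ht
  have hz := hR.measurable_noiseSum h ht
  set z := R.noiseSum G p θ t with hzdef
  set Wt := R.Wt G p t with hWdef
  have hDq : ∀ x : Fin r → ℝ, x ⬝ᵥ (ρ ^ 2 • D) *ᵥ x = ρ ^ 2 * (p.lam * (x ⬝ᵥ x)) := by
    intro x
    simp [hD, Matrix.smul_mulVec]
  have hWq : ∀ ω, ∀ x : Fin r → ℝ, x ⬝ᵥ (ρ ^ 2 • Wt ω) *ᵥ x = ρ ^ 2 * (x ⬝ᵥ Wt ω *ᵥ x) := by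
    intro ω x
    simp [Matrix.smul_mulVec]
  have hjoint : Measurable fun q : Ω × (Fin r → ℝ) =>
      ENNReal.ofReal (Real.exp (q.2 ⬝ᵥ z q.1 - (q.2 ⬝ᵥ (ρ ^ 2 • Wt q.1) *ᵥ q.2) / 2)) := by
    have h1 : Measurable fun q : Ω × (Fin r → ℝ) => q.2 ⬝ᵥ Wt q.1 *ᵥ q.2 :=
      measurable_quadratic (hW.comp measurable_fst) measurable_snd measurable_snd
    have h2 : Measurable fun q : Ω × (Fin r → ℝ) => q.2 ⬝ᵥ z q.1 := by
      have hzi : ∀ i, Measurable fun ω => z ω i := fun i => (measurable_pi_apply i).comp hz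
      have hzi' : ∀ i, Measurable fun q : Ω × (Fin r → ℝ) => z q.1 i := fun i =>
        (hzi i).comp measurable_fst
      simp only [dotProduct]
      fun_prop
    simp_rw [hWq]
    fun_prop
  -- Average the supermartingales over x with the Gaussian weight of precision ρ²λI and exchange
  -- integrals: the weight supplies exactly the λI missing from the compensator.
  have hmix : ∫⁻ ω, (∫⁻ x : Fin r → ℝ,
      ENNReal.ofReal (Real.exp (x ⬝ᵥ z ω - (x ⬝ᵥ (ρ ^ 2 • Wt ω) *ᵥ x) / 2))) ∂P ≤
      ∫⁻ x : Fin r → ℝ, ENNReal.ofReal (Real.exp (x ⬝ᵥ 0 - (x ⬝ᵥ (ρ ^ 2 • D) *ᵥ x) / 2)) := by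
    rw [lintegral_lintegral_swap hjoint.aemeasurable]
    refine lintegral_mono fun x => ?_
    have hsplit : ∀ ω, ENNReal.ofReal (Real.exp (x ⬝ᵥ z ω - (x ⬝ᵥ (ρ ^ 2 • Wt ω) *ᵥ x) / 2)) =
        ENNReal.ofReal (Real.exp (x ⬝ᵥ 0 - (x ⬝ᵥ (ρ ^ 2 • D) *ᵥ x) / 2)) *
        ∏ s ∈ Finset.Ico 1 t, expWeight ρ (WithLp.toLp 2 ((G.M (R.act s ω) * p.W) *ᵥ x))
          (R.noiseAt G θ s ω) := by
      intro ω
      rw [prod_expWeight_eq h, ← ENNReal.ofReal_mul (Real.exp_pos _).le, ← Real.exp_add, hWq, hDq,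
        dotProduct_zero]
      congr 2
      ring
    simp_rw [hsplit]
    rw [lintegral_const_mul' _ _ ENNReal.ofReal_ne_top]
    exact mul_le_of_le_one_right' (hR.lintegral_prod_expWeight_le h hρ x ht1 ht)
  rw [lintegral_gauss (hDpd.smul hρ2)] at hmix
  simp_rw [fun ω => lintegral_gauss ((hWpd ω).smul hρ2) (z ω)] at hmix
  rw [lintegral_mul_const' _ _ gaussMass_ne_top,
    ENNReal.mul_le_mul_iff_left gaussMass_ne_zero gaussMass_ne_top] at hmix
  have hDdet := (hDpd.smul hρ2).det_pos
  set k := (√(ρ ^ 2 • D).det)⁻¹ with hk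
  have hk0 : 0 < k := by rw [hk]; positivity
  have hpt : ∀ ω, ENNReal.ofReal (Real.exp (R.noiseNormSq G p θ t ω / ρ ^ 2 / 2 -
      R.logDetRatio G p t ω / 2)) =
      ENNReal.ofReal k⁻¹ * (ENNReal.ofReal (Real.exp ((z ω ⬝ᵥ (ρ ^ 2 • Wt ω)⁻¹ *ᵥ z ω) / 2)) *
        ENNReal.ofReal ((√(ρ ^ 2 • Wt ω).det)⁻¹)) := by
    intro ω
    rw [← ENNReal.ofReal_mul (Real.exp_pos _).le, ← ENNReal.ofReal_mul (by positivity), hk,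
      inv_sqrt_eq_exp hDdet, inv_sqrt_eq_exp ((hWpd ω).smul hρ2).det_pos, ← Real.exp_neg,
      ← Real.exp_add, ← Real.exp_add, log_det_smul hDpd.det_pos hρ2,
      log_det_smul (hWpd ω).det_pos hρ2, inv_smul_quadratic (hWpd ω).det_pos hρ2, Run.noiseNormSq,
      Run.logDetRatio]
    congr 2
    ring
  simp_rw [hpt]
  rw [lintegral_const_mul' _ _ ENNReal.ofReal_ne_top]
  calc _ ≤ ENNReal.ofReal k⁻¹ * _ := mul_le_mul_right hmix _
    _ = 1 := by
      rw [zero_dotProduct, zero_div, Real.exp_zero, ENNReal.ofReal_one, one_mul,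
        ← ENNReal.ofReal_mul (by positivity), inv_mul_cancel₀ hk0.ne', ENNReal.ofReal_one]

/-- The event that the self-normalized noise is large. -/
def Run.badEvent (R : Run A d m Ω) (G : Game A d m) (p : Input d r)
    (θ : EuclideanSpace ℝ (Fin d)) (ρ : ℝ) (t : ℕ) : Set Ω :=
  {ω | ρ ^ 2 * (2 * Real.log ((t : ℝ) ^ 2) + R.logDetRatio G p t ω) < R.noiseNormSq G p θ t ω}

theorem IsIDS.measurableSet_badEvent (hR : IsIDS G p R P θ n) (h : Admissible G p) (ρ : ℝ) {t : ℕ}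
    (ht : t ≤ n + 1) : MeasurableSet (R.badEvent G p θ ρ t) :=
  measurableSet_lt (((hR.measurable_logDetRatio h ht).const_add _).const_mul _)
    (hR.measurable_noiseNormSq h ht)

/-- Markov's inequality at level t²: on the bad event the mixture's exponent is at least log(t²),
because β_t contains 2 log(t²). -/
theorem IsIDS.measure_badEvent_le_of_lt (hR : IsIDS G p R P θ n) (h : Admissible G p) {ρ : ℝ}
    (hρ : p.ρ < ρ) {t : ℕ} (ht1 : 1 ≤ t) (ht : t ≤ n + 1) :
    P (R.badEvent G p θ ρ t) ≤ ENNReal.ofReal (1 / (t : ℝ) ^ 2) := by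
  have hρ0 : 0 < ρ := h.ρ_nonneg.trans_lt hρ
  have ht0 : (0 : ℝ) < (t : ℝ) ^ 2 := by positivity
  have hmeas : Measurable fun ω => ENNReal.ofReal (Real.exp (R.noiseNormSq G p θ t ω / ρ ^ 2 / 2 -
      R.logDetRatio G p t ω / 2)) := by
    have h1 := hR.measurable_noiseNormSq h ht
    have h2 := hR.measurable_logDetRatio h ht
    fun_prop
  have hmarkov := (mul_meas_ge_le_lintegral hmeas (ENNReal.ofReal ((t : ℝ) ^ 2))).trans
    (hR.lintegral_exp_noiseNormSq_le h hρ.le hρ0 ht1 ht)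
  have hsub : R.badEvent G p θ ρ t ⊆ {ω | ENNReal.ofReal ((t : ℝ) ^ 2) ≤
      ENNReal.ofReal (Real.exp (R.noiseNormSq G p θ t ω / ρ ^ 2 / 2 -
      R.logDetRatio G p t ω / 2))} := by
    intro ω hω
    refine ENNReal.ofReal_le_ofReal ?_
    rw [← Real.exp_log ht0, Real.exp_le_exp]
    have h1 : ρ ^ 2 * (2 * Real.log ((t : ℝ) ^ 2) + R.logDetRatio G p t ω) <
      R.noiseNormSq G p θ t ω := hω
    rw [mul_comm, ← lt_div_iff₀ (by positivity)] at h1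
    linarith
  rw [one_div, ENNReal.ofReal_inv_of_pos ht0, ENNReal.le_inv_iff_mul_le, mul_comm]
  exact (mul_le_mul_right (measure_mono hsub) _).trans hmarkov

/-- The mixture needs a positive noise level, but ρ may be 0. As the defining inequality is strict,
the event lies in the increasing union of the events at levels ρ + 1/(k+1). -/
theorem IsIDS.measure_badEvent_le (hR : IsIDS G p R P θ n) (h : Admissible G p) {t : ℕ}
    (ht1 : 1 ≤ t) (ht : t ≤ n + 1) :
    P (R.badEvent G p θ p.ρ t) ≤ ENNReal.ofReal (1 / (t : ℝ) ^ 2) := by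
  have hρ := h.ρ_nonneg
  have hnn : ∀ ω, 0 ≤ 2 * Real.log ((t : ℝ) ^ 2) + R.logDetRatio G p t ω := fun ω => by
    have h1 := h.log_det_Wt_ge ht1 ω (R := R)
    have h2 : 0 ≤ Real.log ((t : ℝ) ^ 2) := by
      rw [Real.log_pow]; have := Real.log_natCast_nonneg t; positivity
    rw [Run.logDetRatio]
    linarith
  have hsub : R.badEvent G p θ p.ρ t ⊆ ⋃ k : ℕ, R.badEvent G p θ (p.ρ + 1 / ((k : ℝ) + 1)) t := by
    intro ω hω
    have hlim : Filter.Tendsto (fun k : ℕ => (p.ρ + 1 / ((k : ℝ) + 1)) ^ 2 *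
        (2 * Real.log ((t : ℝ) ^ 2) + R.logDetRatio G p t ω)) Filter.atTop
        (nhds (p.ρ ^ 2 * (2 * Real.log ((t : ℝ) ^ 2) + R.logDetRatio G p t ω))) := by
      have := ((tendsto_one_div_add_atTop_nhds_zero_nat (𝕜 := ℝ)).const_add p.ρ).pow 2
      rw [add_zero] at this
      exact this.mul_const _
    obtain ⟨k, hk⟩ := (hlim.eventually_lt_const hω).exists
    exact Set.mem_iUnion.2 ⟨k, hk⟩
  have hmono : Monotone fun k : ℕ => R.badEvent G p θ (p.ρ + 1 / ((k : ℝ) + 1)) t := by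
    intro k l hkl ω hω
    refine lt_of_le_of_lt (mul_le_mul_of_nonneg_right ?_ (hnn ω)) hω
    have h1 : 1 / ((l : ℝ) + 1) ≤ 1 / ((k : ℝ) + 1) := Nat.one_div_le_one_div hkl
    have h2 : 0 < 1 / ((l : ℝ) + 1) := by positivity
    gcongr
  refine (measure_mono hsub).trans ?_
  rw [hmono.measure_iUnion]
  exact iSup_le fun k => hR.measure_badEvent_le_of_lt h
    (lt_add_of_pos_right _ (by positivity)) ht1 ht

end Mixture

/-! ### Constrained least squares and the confidence set -/

section LeastSquares

variable {A : Type*} [TopologicalSpace A] [MeasurableSpace A] [BorelSpace A] {d m r : ℕ}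
  {Ω : Type*} {G : Game A d m} {p : Input d r} {R : Run A d m Ω} {θ : EuclideanSpace ℝ (Fin d)}

theorem lsLoss_add_smul (t : ℕ) (ω : Ω) (x v : EuclideanSpace ℝ (Fin d)) (s : ℝ) :
    R.lsLoss G p t ω (x + s • v) = R.lsLoss G p t ω x +
      2 * s * (∑ k ∈ Finset.Ico 1 t, ⟪Matrix.toEuclideanLin (G.M (R.act k ω)) x - R.obs k ω,
        Matrix.toEuclideanLin (G.M (R.act k ω)) v⟫ + p.lam * ⟪x - p.θ₀, v⟫) +
      s ^ 2 * (v.ofLp ⬝ᵥ R.V G p t ω *ᵥ v.ofLp) := by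
  have key : ∀ k : ℕ, ∀ B : EuclideanSpace ℝ (Fin k), ∀ w : EuclideanSpace ℝ (Fin k),
      ‖B + s • w‖ ^ 2 = ‖B‖ ^ 2 + 2 * s * ⟪B, w⟫ + s ^ 2 * (w.ofLp ⬝ᵥ w.ofLp) := by
    intro k B w
    rw [norm_add_sq_real, inner_smul_right, norm_smul, mul_pow, Real.norm_eq_abs, sq_abs,
      norm_sq_eq_dotProduct w]
    ring
  rw [dotProduct_V_mulVec]
  unfold Run.lsLoss
  have h1 : ∀ k, Matrix.toEuclideanLin (G.M (R.act k ω)) (x + s • v) - R.obs k ω =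
      (Matrix.toEuclideanLin (G.M (R.act k ω)) x - R.obs k ω) +
        s • Matrix.toEuclideanLin (G.M (R.act k ω)) v := by
    intro k
    rw [map_add, map_smul]
    abel
  have h2 : x + s • v - p.θ₀ = (x - p.θ₀) + s • v := by abel
  have h3 : ∀ k, (Matrix.toEuclideanLin (G.M (R.act k ω)) v).ofLp = G.M (R.act k ω) *ᵥ v.ofLp :=
    fun k => rfl
  simp_rw [h1, h2, key, h3, Finset.sum_add_distrib, ← Finset.mul_sum]
  ring

theorem nonneg_of_quadratic_nonneg {b c : ℝ} (h : ∀ s ∈ Set.Ioc (0 : ℝ) 1, 0 ≤ 2 * s * b + s ^ 2 * c) :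
    0 ≤ b := by
  by_contra hb
  push Not at hb
  have hden : 0 < |c| + 1 - b := by linarith [abs_nonneg c]
  -- At this s one has s·c ≤ s|c| < −b, so the linear term would win and make the quadratic
  -- negative.
  have hs1 : -b / (|c| + 1 - b) ≤ 1 := by
    rw [div_le_one hden]; linarith [abs_nonneg c]
  have hs0 : 0 < -b / (|c| + 1 - b) := div_pos (by linarith) hden
  have := h _ ⟨hs0, hs1⟩
  set s := -b / (|c| + 1 - b) with hs
  have h2 : s * (|c| + 1 - b) = -b := by rw [hs]; field_simp
  have h3 : 0 ≤ 2 * b + s * c := by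
    have : 0 ≤ s * (2 * b + s * c) := by linarith
    exact nonneg_of_mul_nonneg_right this hs0
  nlinarith [le_abs_self c, mul_le_mul_of_nonneg_left (le_abs_self c) hs0.le]

/-- The segment from the estimate to θ stays in the convex set Θ, so the directional derivative of
the loss at the minimizer cannot be negative. -/
theorem Admissible.est_first_order (h : Admissible G p) {t : ℕ} {ω : Ω}
    (hest : R.est t ω ∈ G.Θ) (hmin : IsMinOn (R.lsLoss G p t ω) G.Θ (R.est t ω)) (hθ : θ ∈ G.Θ) :
    0 ≤ ∑ k ∈ Finset.Ico 1 t, ⟪Matrix.toEuclideanLin (G.M (R.act k ω)) (R.est t ω) - R.obs k ω,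
        Matrix.toEuclideanLin (G.M (R.act k ω)) (θ - R.est t ω)⟫ +
        p.lam * ⟪R.est t ω - p.θ₀, θ - R.est t ω⟫ := by
  refine nonneg_of_quadratic_nonneg (c := (θ - R.est t ω).ofLp ⬝ᵥ R.V G p t ω *ᵥ
    (θ - R.est t ω).ofLp) fun s hs => ?_
  have hmem : R.est t ω + s • (θ - R.est t ω) ∈ G.Θ :=
    h.convex_Θ.add_smul_sub_mem hest hθ ⟨hs.1.le, hs.2⟩
  have h1 : R.lsLoss G p t ω (R.est t ω) ≤ R.lsLoss G p t ω (R.est t ω + s • (θ - R.est t ω)) :=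
    hmin hmem
  rw [lsLoss_add_smul] at h1
  linarith

/-- Off the bad event, the true parameter lies in the confidence set. -/
theorem Admissible.mem_conf (h : Admissible G p) {t : ℕ} {ω : Ω}
    (hest : R.est t ω ∈ G.Θ) (hmin : IsMinOn (R.lsLoss G p t ω) G.Θ (R.est t ω)) (hθ : θ ∈ G.Θ)
    (hω : ω ∉ R.badEvent G p θ p.ρ t) : θ ∈ R.conf G p t ω := by
  refine ⟨hθ, ?_⟩
  have hfo := h.est_first_order hest hmin hθ
  set e := θ - R.est t ω with he
  set Q := e.ofLp ⬝ᵥ R.V G p t ω *ᵥ e.ofLp with hQ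
  have hbv : BasisValid G p e := h.basisValid_sub hθ hest
  set y := p.Wᵀ *ᵥ e.ofLp with hy
  set z := R.noiseSum G p θ t ω with hz
  have hQ0 : 0 ≤ Q :=
    le_trans (mul_nonneg h.lam_pos.le (dotProduct_self_nonneg _)) (h.lam_le_V t ω e.ofLp (R := R))
  have hsum : ∑ k ∈ Finset.Ico 1 t, ⟪Matrix.toEuclideanLin (G.M (R.act k ω)) (R.est t ω) -
      R.obs k ω, Matrix.toEuclideanLin (G.M (R.act k ω)) e⟫ =
      -(∑ k ∈ Finset.Ico 1 t, (G.M (R.act k ω) *ᵥ e.ofLp) ⬝ᵥ (G.M (R.act k ω) *ᵥ e.ofLp))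
        - z ⬝ᵥ y := by
    rw [hz, Run.noiseSum, sum_dotProduct, ← Finset.sum_neg_distrib, ← Finset.sum_sub_distrib]
    refine Finset.sum_congr rfl fun k _ => ?_
    have h1 : Matrix.toEuclideanLin (G.M (R.act k ω)) (R.est t ω) - R.obs k ω =
        -Matrix.toEuclideanLin (G.M (R.act k ω)) e - R.noiseAt G θ k ω := by
      rw [Run.noiseAt, he, map_sub]; abel
    have h2 : ⟪R.noiseAt G θ k ω, Matrix.toEuclideanLin (G.M (R.act k ω)) e⟫ =
        ((G.M (R.act k ω) * p.W)ᵀ *ᵥ (R.noiseAt G θ k ω).ofLp) ⬝ᵥ y := by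
      rw [inner_eq_dotProduct, Matrix.mulVec_transpose, ← Matrix.dotProduct_mulVec]
      congr 1
      exact hbv (R.act k ω)
    rw [h1, inner_sub_left, inner_neg_left, h2, inner_eq_dotProduct]
    rfl
  have hreg : ⟪R.est t ω - p.θ₀, e⟫ = ⟪θ - p.θ₀, e⟫ - e.ofLp ⬝ᵥ e.ofLp := by
    rw [← norm_sq_eq_dotProduct, ← real_inner_self_eq_norm_sq, ← inner_sub_left, he]
    congr 1
    abel
  -- Once the observations are written as signal plus noise, the quadratic terms of the first-order
  -- condition assemble to −‖e‖²_V; what remains is the noise tested on e and the bias from the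
  -- prior.
  have hQle : Q ≤ -(z ⬝ᵥ y) + p.lam * ⟪θ - p.θ₀, e⟫ := by
    rw [hQ, dotProduct_V_mulVec]
    rw [hsum, hreg] at hfo
    linarith
  have hnoise : R.noiseNormSq G p θ t ω ≤
      p.ρ ^ 2 * (2 * Real.log ((t : ℝ) ^ 2) + R.logDetRatio G p t ω) := not_lt.1 hω
  set F := R.noiseNormSq G p θ t ω
  have hF0 : 0 ≤ F := by
    have := (h.Wt_posDef t ω (R := R)).inv.posSemidef.dotProduct_mulVec_nonneg z
    rwa [star_trivial] at this
  have hcs : -(z ⬝ᵥ y) ≤ √F * √Q := by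
    rw [← Real.sqrt_mul hF0]
    refine Real.le_sqrt_of_sq_le ?_
    rw [neg_sq]
    exact (dotProduct_sq_le (h.Wt_posDef t ω (R := R)) z y).trans
      (mul_le_mul_of_nonneg_left (h.Wt_basis_le_V t ω hbv) hF0)
  have hlam := h.lam_pos
  have hB := h.B_nonneg
  have hprior : p.lam * ⟪θ - p.θ₀, e⟫ ≤ √p.lam * p.B * √Q := by
    have h1 : √p.lam * ‖e‖ ≤ √Q := by
      refine Real.le_sqrt_of_sq_le ?_
      rw [mul_pow, Real.sq_sqrt hlam.le, norm_sq_eq_dotProduct]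
      exact h.lam_le_V t ω e.ofLp
    have h2 : ⟪θ - p.θ₀, e⟫ ≤ p.B * ‖e‖ := (real_inner_le_norm _ _).trans
      (mul_le_mul_of_nonneg_right (h.norm_Θ_le θ hθ) (norm_nonneg _))
    calc _ ≤ p.lam * (p.B * ‖e‖) := mul_le_mul_of_nonneg_left h2 hlam.le
      _ = (√p.lam * p.B) * (√p.lam * ‖e‖) := by
        nth_rewrite 1 [← Real.mul_self_sqrt hlam.le]; ring
      _ ≤ _ := mul_le_mul_of_nonneg_left h1 (by positivity)
  have hFle : √F ≤ p.ρ * √(2 * Real.log ((t : ℝ) ^ 2) + R.logDetRatio G p t ω) := by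
    calc √F ≤ √(p.ρ ^ 2 * (2 * Real.log ((t : ℝ) ^ 2) + R.logDetRatio G p t ω)) :=
          Real.sqrt_le_sqrt hnoise
      _ = _ := by rw [Real.sqrt_mul (sq_nonneg _), Real.sqrt_sq h.ρ_nonneg]
  -- Both remaining terms are proportional to √Q, one power of which cancels.
  have hmain : √Q ≤ √F + √p.lam * p.B := by
    rcases (Real.sqrt_nonneg Q).eq_or_lt with h0 | h0
    · rw [← h0]; positivity
    · have h1 : √Q * √Q ≤ (√F + √p.lam * p.B) * √Q := by
        rw [Real.mul_self_sqrt hQ0]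
        linarith
      exact le_of_mul_le_mul_right h1 h0
  calc Q = √Q ^ 2 := (Real.sq_sqrt hQ0).symm
    _ ≤ (p.ρ * √(2 * Real.log ((t : ℝ) ^ 2) + R.logDetRatio G p t ω) + √p.lam * p.B) ^ 2 := by
        gcongr
        linarith
    _ = R.beta G p t ω := by
        rw [Run.beta, Run.logDetRatio, add_sub_assoc]

end LeastSquares

/-! ### From realized actions to sampling distributions -/

section Sampling

/-- Integrals against a pair `(g, a)` where `a` has conditional law `κ ∘ g`. -/
theorem lintegral_pair_eq_of_law {Ω Ω' A : Type*} {mΩ : MeasurableSpace Ω}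
    {mΩ' : MeasurableSpace Ω'} {mA : MeasurableSpace A} {P : Measure Ω} [IsProbabilityMeasure P]
    {g : Ω → Ω'} (hg : Measurable g) {a : Ω → A} (ha : Measurable a) (κ : Kernel Ω' A)
    [IsMarkovKernel κ]
    (hlaw : ∀ S T, MeasurableSet S → MeasurableSet T →
      P (g ⁻¹' S ∩ a ⁻¹' T) = ∫⁻ ω in g ⁻¹' S, κ (g ω) T ∂P)
    {f : Ω' × A → ℝ≥0∞} (hf : Measurable f) :
    ∫⁻ ω, f (g ω, a ω) ∂P = ∫⁻ ω, ∫⁻ x, f (g ω, x) ∂(κ (g ω)) ∂P := by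
  have hmap : P.map (fun ω => (g ω, a ω)) = (P.map g) ⊗ₘ κ := by
    have : IsProbabilityMeasure (P.map g) := Measure.isProbabilityMeasure_map hg.aemeasurable
    have : IsProbabilityMeasure (P.map (fun ω => (g ω, a ω))) :=
      Measure.isProbabilityMeasure_map (hg.prodMk ha).aemeasurable
    refine Measure.ext_prod fun {S T} hS hT => ?_
    rw [Measure.map_apply (hg.prodMk ha) (hS.prod hT), Measure.compProd_apply_prod hS hT,
      setLIntegral_map hS (κ.measurable_coe hT) hg]
    exact hlaw S T hS hT
  rw [← lintegral_map hf (hg.prodMk ha), hmap, Measure.lintegral_compProd hf,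
    lintegral_map hf.lintegral_kernel_prod_right' hg]

theorem measurable_lintegral_markov {Ω' A : Type*} {mΩ' : MeasurableSpace Ω'}
    {mA : MeasurableSpace A} (κ : Kernel Ω' A) [IsMarkovKernel κ] {f : Ω' × A → ℝ≥0∞}
    (hf : Measurable f) : Measurable fun ω => ∫⁻ x, f (ω, x) ∂(κ ω) :=
  hf.lintegral_kernel_prod_right'

/-- Cauchy–Schwarz twice: inside each expectation, then across the rounds. -/
theorem sum_lintegral_sqrt_mul_le {Ω : Type*} {mΩ : MeasurableSpace Ω} {P : Measure Ω}
    (s : Finset ℕ) {g J : ℕ → Ω → ℝ≥0∞} (hg : ∀ t ∈ s, Measurable (g t))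
    (hJ : ∀ t ∈ s, Measurable (J t)) :
    ∑ t ∈ s, ∫⁻ ω, g t ω ^ (1 / 2 : ℝ) * J t ω ^ (1 / 2 : ℝ) ∂P ≤
      (∑ t ∈ s, ∫⁻ ω, g t ω ∂P) ^ (1 / 2 : ℝ) * (∑ t ∈ s, ∫⁻ ω, J t ω ∂P) ^ (1 / 2 : ℝ) := by
  have hc : (2 : ℝ).HolderConjugate 2 := Real.HolderConjugate.two_two
  have hsq : ∀ x : ℝ≥0∞, (x ^ (1 / 2 : ℝ)) ^ (2 : ℝ) = x := fun x => by
    rw [← ENNReal.rpow_mul]; norm_num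
  calc _ ≤ ∑ t ∈ s, (∫⁻ ω, g t ω ∂P) ^ (1 / 2 : ℝ) * (∫⁻ ω, J t ω ∂P) ^ (1 / 2 : ℝ) := by
        refine Finset.sum_le_sum fun t ht => ?_
        have := ENNReal.lintegral_mul_le_Lp_mul_Lq P hc
          ((hg t ht).pow_const (1 / 2 : ℝ)).aemeasurable
          ((hJ t ht).pow_const (1 / 2 : ℝ)).aemeasurable
        simpa only [Pi.mul_apply, hsq] using this
    _ ≤ _ := by
        have := ENNReal.inner_le_Lp_mul_Lq s (fun t => (∫⁻ ω, g t ω ∂P) ^ (1 / 2 : ℝ))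
          (fun t => (∫⁻ ω, J t ω ∂P) ^ (1 / 2 : ℝ)) hc
        simpa only [hsq] using this

/-- Telescoping 1/t² ≤ 1/(t−1) − 1/t. This bound is the absolute constant C = 2. -/
theorem sum_inv_sq_le (n : ℕ) : ∑ t ∈ Finset.Icc 1 n, 1 / (t : ℝ) ^ 2 ≤ 2 := by
  have key : ∀ n : ℕ, ∑ t ∈ Finset.Icc 1 (n + 1), 1 / (t : ℝ) ^ 2 ≤ 2 - 1 / ((n : ℝ) + 1) := by
    intro n
    induction n with
    | zero => simp; norm_num
    | succ n ih =>
      rw [Finset.sum_Icc_succ_top (by omega)]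
      have h1 : (0 : ℝ) < (n : ℝ) + 1 := by positivity
      have h2 : 1 / (((n + 1 + 1 : ℕ) : ℝ)) ^ 2 ≤ 1 / ((n : ℝ) + 1) - 1 / (((n + 1 : ℕ) : ℝ) + 1) := by
        push_cast
        rw [div_sub_div _ _ (by positivity) (by positivity), div_le_div_iff₀ (by positivity)
          (by positivity)]
        nlinarith
      linarith
  rcases n with - | n
  · simp
  · have h1 : (0 : ℝ) < 1 / ((n : ℝ) + 1) := by positivity
    linarith [key n]

variable {A : Type*} [TopologicalSpace A] [MeasurableSpace A] [BorelSpace A] {d m r : ℕ}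
  {Ω : Type*} {G : Game A d m} {p : Input d r} {R : Run A d m Ω} {θ : EuclideanSpace ℝ (Fin d)}

theorem Admissible.measurable_info_pair_of {m₀ : MeasurableSpace Ω} (h : Admissible G p) {t : ℕ}
    (hW : Measurable (R.Wt G p t)) :
    Measurable fun x : Ω × A => ENNReal.ofReal (R.info G p t x.1 x.2) := by
  have h2 : Measurable fun x : Ω × A => (R.Wt G p t x.1, G.M x.2) :=
    (hW.comp measurable_fst).prodMk (h.continuous_M.measurable.comp measurable_snd)
  have h3 := (measurable_infoFn p).comp h2
  exact ENNReal.measurable_ofReal.comp h3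

variable {mΩ : MeasurableSpace Ω} {P : Measure Ω} [IsProbabilityMeasure P] {n : ℕ}

/-- The sampling distribution as a kernel from the past. -/
def IsIDS.sampKernel (hR : IsIDS G p R P θ n) {t : ℕ} (ht : t ∈ Finset.Icc 1 n) :
    @Kernel Ω A (R.past t) _ :=
  @Kernel.mk Ω A (R.past t) _ (R.samp t) (hR.samp_past t ht)

theorem IsIDS.measure_inter_act (hR : IsIDS G p R P θ n) {t : ℕ} (ht : t ∈ Finset.Icc 1 n)
    {S : Set Ω} (hS : MeasurableSet[R.past t] S) {T : Set A} (hT : MeasurableSet T) :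
    P (S ∩ R.act t ⁻¹' T) = ∫⁻ ω in S, R.samp t ω T ∂P := by
  have hle : R.past t ≤ mΩ := hR.past_le (by simp only [Finset.mem_Icc] at ht; omega)
  have hTm : MeasurableSet (R.act t ⁻¹' T) := hR.measurable_act t ht hT
  have hint : Integrable ((R.act t ⁻¹' T).indicator (fun _ => (1 : ℝ))) P :=
    (integrable_const _).indicator hTm
  have hprob := hR.samp_prob t ht
  have h1 := setIntegral_condExp hle hint hS
  rw [setIntegral_congr_ae (g := fun ω => (R.samp t ω).real T) (hle S hS)
    ((hR.act_law t ht T hT).mono fun ω hω _ => hω), setIntegral_indicator hTm,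
    setIntegral_const, smul_eq_mul, mul_one] at h1
  have hmeas : Measurable fun ω => R.samp t ω T :=
    (Measure.measurable_coe hT).comp ((hR.samp_past t ht).mono hle le_rfl)
  rw [← ofReal_measureReal, ← h1, ofReal_integral_eq_lintegral_ofReal]
  · refine setLIntegral_congr_fun (hle S hS) fun ω _ => ?_
    exact ofReal_measureReal
  · refine Integrable.integrableOn (Integrable.of_bound
      hmeas.ennreal_toReal.aestronglyMeasurable 1 (Filter.Eventually.of_forall fun ω => ?_))
    rw [Real.norm_eq_abs, abs_of_nonneg measureReal_nonneg]
    exact measureReal_le_one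
  · exact Filter.Eventually.of_forall fun ω => measureReal_nonneg

/-- The history map is the identity, with the σ-algebra of the past on its target; the integrand
must therefore be jointly measurable over the past. -/
theorem IsIDS.lintegral_act (hR : IsIDS G p R P θ n) {t : ℕ} (ht : t ∈ Finset.Icc 1 n)
    {f : Ω × A → ℝ≥0∞}
    (hf : @Measurable _ _ (@Prod.instMeasurableSpace Ω A (R.past t) _) _ f) :
    ∫⁻ ω, f (ω, R.act t ω) ∂P = ∫⁻ ω, ∫⁻ a, f (ω, a) ∂(R.samp t ω) ∂P := by
  have hle : R.past t ≤ mΩ := hR.past_le (by simp only [Finset.mem_Icc] at ht; omega)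
  have hmk : @IsMarkovKernel Ω A (R.past t) _ (hR.sampKernel ht) :=
    @IsMarkovKernel.mk Ω A (R.past t) _ _ (hR.samp_prob t ht)
  exact @lintegral_pair_eq_of_law Ω Ω A mΩ (R.past t) _ P _ id (measurable_id'' hle) (R.act t)
    (hR.measurable_act t ht) (hR.sampKernel ht) hmk
    (fun S T hS hT => hR.measure_inter_act ht hS hT) f hf

theorem IsIDS.measurable_lintegral_samp (hR : IsIDS G p R P θ n) {t : ℕ} (ht : t ∈ Finset.Icc 1 n)
    {f : Ω × A → ℝ≥0∞}
    (hf : @Measurable _ _ (@Prod.instMeasurableSpace Ω A (R.past t) _) _ f) :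
    Measurable fun ω => ∫⁻ a, f (ω, a) ∂(R.samp t ω) := by
  have hle : R.past t ≤ mΩ := hR.past_le (by simp only [Finset.mem_Icc] at ht; omega)
  have hmk : @IsMarkovKernel Ω A (R.past t) _ (hR.sampKernel ht) :=
    @IsMarkovKernel.mk Ω A (R.past t) _ _ (hR.samp_prob t ht)
  have := @measurable_lintegral_markov Ω A (R.past t) _ (hR.sampKernel ht) hmk f hf
  exact this.mono hle le_rfl

theorem Admissible.measurable_info_pair (h : Admissible G p) (t : ℕ) :
    @Measurable _ _ (@Prod.instMeasurableSpace Ω A (R.past t) _) _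
      fun x : Ω × A => ENNReal.ofReal (R.info G p t x.1 x.2) := by
  have hW : Measurable[R.past t] (R.Wt G p t) := h.measurable_Wt fun s hs =>
    measurable_act_past (Finset.mem_Ico.1 hs).1 (Finset.mem_Ico.1 hs).2
  exact h.measurable_info_pair_of (m₀ := R.past t) hW

theorem Admissible.measurable_gap (h : Admissible G p) (θ : EuclideanSpace ℝ (Fin d)) :
    Measurable fun a => ENNReal.ofReal (G.gap a θ) :=
  ENNReal.measurable_ofReal.comp (h.continuous_gap θ).measurable

theorem Admissible.measurable_gap_pair (h : Admissible G p) (t : ℕ)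
    (θ : EuclideanSpace ℝ (Fin d)) :
    @Measurable _ _ (@Prod.instMeasurableSpace Ω A (R.past t) _) _
      fun x : Ω × A => ENNReal.ofReal (G.gap x.2 θ) :=
  (h.measurable_gap θ).comp (@measurable_snd Ω A (R.past t) _)

/-- The expected gap of the sampled action. -/
def Run.sampGap (R : Run A d m Ω) (G : Game A d m) (θ : EuclideanSpace ℝ (Fin d)) (t : ℕ)
    (ω : Ω) : ℝ≥0∞ :=
  ∫⁻ a, ENNReal.ofReal (G.gap a θ) ∂(R.samp t ω)

/-- The expected information gain of the sampled action. -/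
def Run.sampInfo (R : Run A d m Ω) (G : Game A d m) (p : Input d r) (t : ℕ) (ω : Ω) : ℝ≥0∞ :=
  ∫⁻ a, ENNReal.ofReal (R.info G p t ω a) ∂(R.samp t ω)

theorem IsIDS.measurable_sampGap (hR : IsIDS G p R P θ n) (h : Admissible G p) {t : ℕ}
    (ht : t ∈ Finset.Icc 1 n) : Measurable (R.sampGap G θ t) :=
  hR.measurable_lintegral_samp ht (h.measurable_gap_pair t θ)

theorem IsIDS.measurable_sampInfo (hR : IsIDS G p R P θ n) (h : Admissible G p) {t : ℕ}
    (ht : t ∈ Finset.Icc 1 n) : Measurable (R.sampInfo G p t) :=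
  hR.measurable_lintegral_samp ht (h.measurable_info_pair t)

theorem IsIDS.lintegral_sampGap (hR : IsIDS G p R P θ n) (h : Admissible G p) {t : ℕ}
    (ht : t ∈ Finset.Icc 1 n) :
    ∫⁻ ω, ENNReal.ofReal (G.gap (R.act t ω) θ) ∂P = ∫⁻ ω, R.sampGap G θ t ω ∂P :=
  hR.lintegral_act ht (h.measurable_gap_pair t θ)

theorem IsIDS.lintegral_sampInfo (hR : IsIDS G p R P θ n) (h : Admissible G p) {t : ℕ}
    (ht : t ∈ Finset.Icc 1 n) :
    ∫⁻ ω, ENNReal.ofReal (R.info G p t ω (R.act t ω)) ∂P = ∫⁻ ω, R.sampInfo G p t ω ∂P :=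
  hR.lintegral_act ht (h.measurable_info_pair t)

/-- Gap estimates and information gains are bounded, so the Bochner integrals take no default value
and agree with the Lebesgue integrals. -/
theorem ratio_eq (h : Admissible G p) {t : ℕ} (ht : 1 ≤ t) (ω : Ω) (μ : Measure A)
    [IsProbabilityMeasure μ] :
    R.ratio G p t ω μ = (∫⁻ a, ENNReal.ofReal (R.gapEst G p t ω a) ∂μ) ^ 2 /
      ∫⁻ a, ENNReal.ofReal (R.info G p t ω a) ∂μ := by
  have h0 : ∀ a, 0 ≤ R.gapEst G p t ω a := fun a => h.maxGap_nonneg a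
  have h1 : Integrable (R.gapEst G p t ω) μ :=
    Integrable.of_bound (h.measurable_gapEst t ω).aestronglyMeasurable (2 * p.radius)
      (Filter.Eventually.of_forall fun a => by
        rw [Real.norm_eq_abs, abs_of_nonneg (h0 a)]
        exact h.maxGap_le (conf_subset t ω) a)
  have h2 : Integrable (R.info G p t ω) μ :=
    Integrable.of_bound (h.continuous_info t ω).measurable.aestronglyMeasurable
      (r * Real.log (1 + t * (p.L ^ 2 / p.lam)))
      (Filter.Eventually.of_forall fun a => by
        have h3 := h.info_nonneg t ω a (R := R)
        rw [Real.norm_eq_abs, abs_of_nonneg h3]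
        linarith [h.info_le ht ω a (R := R)])
  rw [Run.ratio, ofReal_integral_eq_lintegral_ofReal h2
    (Filter.Eventually.of_forall fun a => h.info_nonneg t ω a),
    ENNReal.ofReal_pow (integral_nonneg h0), ofReal_integral_eq_lintegral_ofReal h1
    (Filter.Eventually.of_forall h0)]

theorem sampInfo_lt_top (hR : IsIDS G p R P θ n) (h : Admissible G p) {t : ℕ}
    (ht : t ∈ Finset.Icc 1 n) (ω : Ω) : R.sampInfo G p t ω ≠ ∞ := by
  have := hR.samp_prob t ht ω
  have ht1 := (Finset.mem_Icc.1 ht).1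
  refine ne_top_of_le_ne_top ENNReal.ofReal_ne_top
    (b := ENNReal.ofReal (r * Real.log (1 + t * (p.L ^ 2 / p.lam)))) ?_
  calc _ ≤ ∫⁻ _, ENNReal.ofReal (r * Real.log (1 + t * (p.L ^ 2 / p.lam))) ∂(R.samp t ω) :=
        lintegral_mono fun a => ENNReal.ofReal_le_ofReal (by
          linarith [h.info_le ht1 ω a (R := R), h.info_nonneg t ω a (R := R)])
    _ = _ := by simp

/-- The information ratio of the sampling distribution, evaluated at the true gaps. -/
def Run.trueRatio (R : Run A d m Ω) (G : Game A d m) (p : Input d r)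
    (θ : EuclideanSpace ℝ (Fin d)) (t : ℕ) (ω : Ω) : ℝ≥0∞ :=
  (R.badEvent G p θ p.ρ t)ᶜ.indicator
    (fun ω => R.sampGap G θ t ω ^ 2 / R.sampInfo G p t ω) ω

/-- The estimate θ̂_t is not assumed measurable in ω. Using true gaps instead of estimated ones
gives an integrand to which Hölder's inequality applies. -/
theorem IsIDS.measurable_trueRatio (hR : IsIDS G p R P θ n) (h : Admissible G p) {t : ℕ}
    (ht : t ∈ Finset.Icc 1 n) : Measurable (R.trueRatio G p θ t) := by
  refine Measurable.indicator (((hR.measurable_sampGap h ht).pow_const 2).div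
    (hR.measurable_sampInfo h ht)) (hR.measurableSet_badEvent h p.ρ ?_).compl
  simp only [Finset.mem_Icc] at ht; omega

theorem IsIDS.est_mem_conf (hR : IsIDS G p R P θ n) {t : ℕ}
    (ht : t ∈ Finset.Icc 1 n) (ω : Ω) : R.est t ω ∈ R.conf G p t ω :=
  ⟨hR.est_mem t ht ω, by
    simp only [sub_self, WithLp.ofLp_zero, zero_dotProduct]
    exact sq_nonneg _⟩

theorem IsIDS.samp_ratio_le (hR : IsIDS G p R P θ n) (h : Admissible G p) (hP : G.ParetoCovers)
    (hG : G.LocallyObservable) {t : ℕ} (ht : t ∈ Finset.Icc 1 n) (ω : Ω) :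
    R.ratio G p t ω (R.samp t ω) ≤ ENNReal.ofReal (16 * max 1 (p.L ^ 2 / p.lam)) *
      (G.alpha (R.conf G p t ω) * ENNReal.ofReal (R.beta G p n ω)) := by
  refine (h.ratio_le hP ⟨_, hR.est_mem_conf ht ω⟩
    (Game.alpha_lt_top hG (conf_subset t ω)).ne (hR.samp_min t ht ω)).trans ?_
  have h1 := Finset.mem_Icc.1 ht
  gcongr
  exact h.beta_mono h1.1 h1.2 ω

theorem IsIDS.sampGap_sq_div_le (hR : IsIDS G p R P θ n) (h : Admissible G p) (hθ : θ ∈ G.Θ)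
    {t : ℕ} (ht : t ∈ Finset.Icc 1 n) {ω : Ω} (hω : ω ∉ R.badEvent G p θ p.ρ t) :
    R.sampGap G θ t ω ^ 2 / R.sampInfo G p t ω ≤ R.ratio G p t ω (R.samp t ω) := by
  have := hR.samp_prob t ht ω
  have hmem := h.mem_conf (hR.est_mem t ht ω) (hR.est_min t ht ω) hθ hω
  rw [ratio_eq h (Finset.mem_Icc.1 ht).1]
  refine ENNReal.div_le_div_right (pow_le_pow_left₀ zero_le (lintegral_mono fun a => ?_) 2) _
  exact ENNReal.ofReal_le_ofReal (h.gap_le_maxGap (conf_subset t ω) a hmem)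

theorem IsIDS.trueRatio_le (hR : IsIDS G p R P θ n) (h : Admissible G p) (hP : G.ParetoCovers)
    (hG : G.LocallyObservable) (hθ : θ ∈ G.Θ) {t : ℕ} (ht : t ∈ Finset.Icc 1 n) (ω : Ω) :
    R.trueRatio G p θ t ω ≤ ENNReal.ofReal (16 * max 1 (p.L ^ 2 / p.lam)) *
      (G.alpha (R.conf G p t ω) * ENNReal.ofReal (R.beta G p n ω)) :=
  Set.indicator_le' (s := (R.badEvent G p θ p.ρ t)ᶜ)
    (g := fun ω => ENNReal.ofReal (16 * max 1 (p.L ^ 2 / p.lam)) *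
      (G.alpha (R.conf G p t ω) * ENNReal.ofReal (R.beta G p n ω)))
    (fun _ hω => (hR.sampGap_sq_div_le h hθ ht hω).trans (hR.samp_ratio_le h hP hG ht _))
    (fun _ _ => zero_le) ω

/-- Off the bad event the mean gap is the geometric mean of ratio and information; on it, Δ_max is
paid with probability at most 1/t². -/
theorem IsIDS.lintegral_sampGap_le (hR : IsIDS G p R P θ n) (h : Admissible G p)
    (hP : G.ParetoCovers) (hG : G.LocallyObservable) (hθ : θ ∈ G.Θ) {t : ℕ}
    (ht : t ∈ Finset.Icc 1 n) :
    ∫⁻ ω, R.sampGap G θ t ω ∂P ≤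
      ∫⁻ ω, R.trueRatio G p θ t ω ^ (1 / 2 : ℝ) * R.sampInfo G p t ω ^ (1 / 2 : ℝ) ∂P +
      ENNReal.ofReal (G.deltaMax θ) * ENNReal.ofReal (1 / (t : ℝ) ^ 2) := by
  have htn := Finset.mem_Icc.1 ht
  have hbad := hR.measurableSet_badEvent h p.ρ (t := t) (by omega)
  have hpt : ∀ ω, R.sampGap G θ t ω ≤
      R.trueRatio G p θ t ω ^ (1 / 2 : ℝ) * R.sampInfo G p t ω ^ (1 / 2 : ℝ) +
      (R.badEvent G p θ p.ρ t).indicator (fun _ => ENNReal.ofReal (G.deltaMax θ)) ω := by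
    intro ω
    by_cases hω : ω ∈ R.badEvent G p θ p.ρ t
    · have := hR.samp_prob t ht ω
      refine le_add_left ?_
      rw [Set.indicator_of_mem hω]
      calc _ ≤ ∫⁻ _, ENNReal.ofReal (G.deltaMax θ) ∂(R.samp t ω) :=
            lintegral_mono fun a => ENNReal.ofReal_le_ofReal (h.gap_le_deltaMax θ a)
        _ = _ := by simp
    · refine le_add_right ?_
      have hfin : R.trueRatio G p θ t ω ≠ ∞ :=
        ne_top_of_le_ne_top (ENNReal.mul_ne_top ENNReal.ofReal_ne_top (ENNReal.mul_ne_top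
          (Game.alpha_lt_top hG (conf_subset t ω)).ne ENNReal.ofReal_ne_top))
          (hR.trueRatio_le h hP hG hθ ht ω)
      rw [← ENNReal.mul_rpow_of_nonneg _ _ (by norm_num)]
      have hT : R.trueRatio G p θ t ω = R.sampGap G θ t ω ^ 2 / R.sampInfo G p t ω :=
        Set.indicator_of_mem (s := (R.badEvent G p θ p.ρ t)ᶜ) hω _
      have hle : R.sampGap G θ t ω ^ 2 ≤ R.trueRatio G p θ t ω * R.sampInfo G p t ω := by
        rw [hT] at hfin ⊢
        -- Without information, finiteness of the ratio forces the mean gap to be 0, by x/0 = ∞.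
        rcases eq_or_ne (R.sampInfo G p t ω) 0 with h0 | h0
        · rw [h0] at hfin ⊢
          by_contra hne
          refine hfin (ENNReal.div_zero fun h1 => hne ?_)
          rw [h1]; exact zero_le
        · rw [ENNReal.div_mul_cancel h0 (sampInfo_lt_top hR h ht ω)]
      calc R.sampGap G θ t ω = (R.sampGap G θ t ω ^ 2) ^ (1 / 2 : ℝ) := by
            rw [← ENNReal.rpow_natCast, ← ENNReal.rpow_mul]; norm_num
        _ ≤ _ := ENNReal.rpow_le_rpow hle (by norm_num)
  refine (lintegral_mono hpt).trans ?_
  rw [lintegral_add_right _ (measurable_const.indicator hbad), lintegral_indicator_const hbad]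
  gcongr
  exact hR.measure_badEvent_le h htn.1 (by omega)

end Sampling

/-! ### Regret bounds -/

section Regret

variable {A : Type*} [TopologicalSpace A] [MeasurableSpace A] [BorelSpace A] {d m r : ℕ}
  {Ω : Type*} {G : Game A d m} {p : Input d r} {R : Run A d m Ω} {θ : EuclideanSpace ℝ (Fin d)}
  {mΩ : MeasurableSpace Ω} {P : Measure Ω} [IsProbabilityMeasure P] {n : ℕ}

theorem IsIDS.integrable_gap (hR : IsIDS G p R P θ n) (h : Admissible G p) {t : ℕ}
    (ht : t ∈ Finset.Icc 1 n) : Integrable (fun ω => G.gap (R.act t ω) θ) P :=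
  Integrable.of_bound
    ((h.continuous_gap θ).measurable.comp (hR.measurable_act t ht)).aestronglyMeasurable
    (2 * ‖θ‖) (Filter.Eventually.of_forall fun ω => by
      rw [Real.norm_eq_abs, abs_of_nonneg (h.gap_nonneg _ _)]
      exact h.gap_le _ _)

theorem IsIDS.integral_gap (hR : IsIDS G p R P θ n) (h : Admissible G p) {t : ℕ}
    (ht : t ∈ Finset.Icc 1 n) :
    ∫ ω, G.gap (R.act t ω) θ ∂P = (∫⁻ ω, R.sampGap G θ t ω ∂P).toReal := by
  rw [← hR.lintegral_sampGap h ht, integral_eq_lintegral_of_nonneg_ae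
    (Filter.Eventually.of_forall fun ω => h.gap_nonneg _ _)
    (hR.integrable_gap h ht).aestronglyMeasurable]

theorem IsIDS.lintegral_sampGap_ne_top (hR : IsIDS G p R P θ n) (h : Admissible G p) {t : ℕ}
    (ht : t ∈ Finset.Icc 1 n) : ∫⁻ ω, R.sampGap G θ t ω ∂P ≠ ∞ := by
  rw [← hR.lintegral_sampGap h ht]
  exact (hR.integrable_gap h ht).lintegral_lt_top.ne

/-- The gap compares with the best action for θ, hence dominates the comparison with any fixed
action. -/
theorem IsIDS.regret_le_sum [Nonempty A] (hR : IsIDS G p R P θ n) (h : Admissible G p) :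
    R.regret G P θ n ≤ (∑ t ∈ Finset.Icc 1 n, ∫⁻ ω, R.sampGap G θ t ω ∂P).toReal := by
  rw [ENNReal.toReal_sum fun t ht => hR.lintegral_sampGap_ne_top h ht]
  refine ciSup_le fun a => ?_
  rw [← Finset.sum_congr rfl fun t ht => hR.integral_gap h ht,
    ← integral_finsetSum _ fun t ht => hR.integrable_gap h ht]
  refine integral_mono (integrable_finsetSum _ fun t ht => ?_)
    (integrable_finsetSum _ fun t ht => hR.integrable_gap h ht) fun ω =>
    Finset.sum_le_sum fun t _ => h.inner_le_gap _ _ _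
  have hc : Continuous fun b => ⟪G.φ a - G.φ b, θ⟫ := by
    have := h.continuous_φ
    fun_prop
  refine Integrable.of_bound (hc.measurable.comp (hR.measurable_act t ht)).aestronglyMeasurable
    (2 * ‖θ‖) (Filter.Eventually.of_forall fun ω => ?_)
  exact (norm_inner_le_norm _ _).trans
    (mul_le_mul_of_nonneg_right (h.norm_feature_sub_le _ _) (norm_nonneg _))

theorem IsIDS.integrable_info (hR : IsIDS G p R P θ n) (h : Admissible G p) {t : ℕ}
    (ht : t ∈ Finset.Icc 1 n) : Integrable (fun ω => R.info G p t ω (R.act t ω)) P := by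
  have htn := Finset.mem_Icc.1 ht
  have hm : Measurable fun ω => (R.Wt G p t ω, G.M (R.act t ω)) :=
    (hR.measurable_Wt h (by omega)).prodMk (h.measurable_M_act (hR.measurable_act t ht))
  have hm2 := (measurable_infoFn p).comp hm
  refine Integrable.of_bound (C := r * Real.log (1 + t * (p.L ^ 2 / p.lam)))
    hm2.aestronglyMeasurable (Filter.Eventually.of_forall fun ω => ?_)
  change ‖R.info G p t ω (R.act t ω)‖ ≤ _
  have h3 := h.info_nonneg t ω (R.act t ω) (R := R)
  rw [Real.norm_eq_abs, abs_of_nonneg h3]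
  linarith [h.info_le htn.1 ω (R.act t ω) (R := R)]

theorem IsIDS.sum_lintegral_sampInfo (hR : IsIDS G p R P θ n) (h : Admissible G p) :
    ∑ t ∈ Finset.Icc 1 n, ∫⁻ ω, R.sampInfo G p t ω ∂P =
      ENNReal.ofReal (∫ ω, R.gamma G p n ω ∂P) := by
  have hnn : ∀ t ω, 0 ≤ R.info G p t ω (R.act t ω) := fun t ω => h.info_nonneg t ω _
  unfold Run.gamma
  rw [integral_finsetSum _ fun t ht => hR.integrable_info h ht,
    ENNReal.ofReal_sum_of_nonneg fun t _ => integral_nonneg (hnn t)]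
  refine Finset.sum_congr rfl fun t ht => ?_
  rw [ofReal_integral_eq_lintegral_ofReal (hR.integrable_info h ht)
    (Filter.Eventually.of_forall (hnn t)), hR.lintegral_sampInfo h ht]

theorem IsIDS.sum_lintegral_trueRatio_le (hR : IsIDS G p R P θ n) (h : Admissible G p)
    (hP : G.ParetoCovers) (hG : G.LocallyObservable) (hθ : θ ∈ G.Θ) (hn : n ≠ 0) :
    ∑ t ∈ Finset.Icc 1 n, ∫⁻ ω, R.trueRatio G p θ t ω ∂P ≤
      ENNReal.ofReal (16 * max 1 (p.L ^ 2 / p.lam)) * n *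
        ∫⁻ ω, R.alphaBar G p n ω * ENNReal.ofReal (R.beta G p n ω) ∂P := by
  rw [← lintegral_finsetSum _ fun t ht => hR.measurable_trueRatio h ht,
    ← lintegral_const_mul' _ _ (ENNReal.mul_ne_top ENNReal.ofReal_ne_top (ENNReal.natCast_ne_top n))]
  refine lintegral_mono fun ω => ?_
  calc _ ≤ ∑ t ∈ Finset.Icc 1 n, ENNReal.ofReal (16 * max 1 (p.L ^ 2 / p.lam)) *
        (G.alpha (R.conf G p t ω) * ENNReal.ofReal (R.beta G p n ω)) :=
        Finset.sum_le_sum fun t ht => hR.trueRatio_le h hP hG hθ ht ω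
    _ = _ := by
        rw [← Finset.mul_sum, ← Finset.sum_mul, mul_assoc, Run.alphaBar, ← mul_assoc (n : ℝ≥0∞),
          ENNReal.mul_div_cancel (by exact_mod_cast hn) (ENNReal.natCast_ne_top n)]

theorem alphaBar_le_sup (n : ℕ) (ω : Ω) : R.alphaBar G p n ω ≤
    ⨆ (E : Set (EuclideanSpace ℝ (Fin d))) (_ : E ⊆ G.Θ), G.alpha E := by
  refine ENNReal.div_le_of_le_mul ?_
  calc _ ≤ ∑ _t ∈ Finset.Icc 1 n, ⨆ (E : Set (EuclideanSpace ℝ (Fin d))) (_ : E ⊆ G.Θ), G.alpha E :=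
        Finset.sum_le_sum fun t _ => le_iSup₂ (f := fun E (_ : E ⊆ G.Θ) => G.alpha E)
          (R.conf G p t ω) (conf_subset t ω)
    _ = _ := by simp [mul_comm]

/-- Ensures that `toReal` in the regret bounds does not collapse ∞ to 0. -/
theorem lintegral_alphaBar_ne_top (hG : G.LocallyObservable) :
    ∫⁻ ω, R.alphaBar G p n ω ∂P ≠ ∞ :=
  ne_top_of_le_ne_top hG.ne ((lintegral_mono fun ω => alphaBar_le_sup n ω).trans (by simp))

/-- A deterministic bound on the confidence coefficient. -/
def betaMax (p : Input d r) (n : ℕ) : ℝ :=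
  2 * p.ρ ^ 2 * (4 * Real.log n + r * Real.log (1 + n * (p.L ^ 2 / p.lam))) + 2 * p.lam * p.B ^ 2

theorem Admissible.lintegral_alphaBar_mul_beta_le (h : Admissible G p) (hn : 1 ≤ n) :
    ∫⁻ ω, R.alphaBar G p n ω * ENNReal.ofReal (R.beta G p n ω) ∂P ≤
      (∫⁻ ω, R.alphaBar G p n ω ∂P) * ENNReal.ofReal (betaMax p n) := by
  rw [← lintegral_mul_const' _ _ ENNReal.ofReal_ne_top]
  refine lintegral_mono fun ω => ?_
  exact mul_le_mul_right (ENNReal.ofReal_le_ofReal (h.beta_le hn ω)) _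

/-- The regret bound in terms of the expected information gain. -/
theorem IsIDS.regret_le [Nonempty A] (hR : IsIDS G p R P θ n) (h : Admissible G p)
    (hP : G.ParetoCovers) (hG : G.LocallyObservable) (hθ : θ ∈ G.Θ) :
    R.regret G P θ n ≤
      √(16 * max 1 (p.L ^ 2 / p.lam)
        * (∫⁻ ω, R.alphaBar G p n ω * ENNReal.ofReal (R.beta G p n ω) ∂P).toReal
        * (∫ ω, R.gamma G p n ω ∂P) * n) + 2 * G.deltaMax θ := by
  have hΔ := h.deltaMax_nonneg θ
  rcases Nat.eq_zero_or_pos n with hn0 | hn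
  · have h0 := hR.regret_le_sum h
    subst hn0
    simp only [Finset.Icc_eq_empty_of_lt zero_lt_one, Finset.sum_empty, ENNReal.toReal_zero] at h0
    have := Real.sqrt_nonneg (16 * max 1 (p.L ^ 2 / p.lam)
        * (∫⁻ ω, R.alphaBar G p 0 ω * ENNReal.ofReal (R.beta G p 0 ω) ∂P).toReal
        * (∫ ω, R.gamma G p 0 ω ∂P) * (0 : ℕ))
    linarith
  set a := ∫⁻ ω, R.alphaBar G p n ω * ENNReal.ofReal (R.beta G p n ω) ∂P with ha
  set Γ := ∫ ω, R.gamma G p n ω ∂P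
  have hX : (0 : ℝ) ≤ 16 * max 1 (p.L ^ 2 / p.lam) :=
    mul_nonneg (by norm_num) (zero_le_one.trans (le_max_left _ _))
  have ha_top : a ≠ ∞ := ne_top_of_le_ne_top
    (ENNReal.mul_ne_top (lintegral_alphaBar_ne_top hG) ENNReal.ofReal_ne_top)
    (h.lintegral_alphaBar_mul_beta_le hn)
  have hsum : ∑ t ∈ Finset.Icc 1 n, ∫⁻ ω, R.sampGap G θ t ω ∂P ≤
      ENNReal.ofReal (√(16 * max 1 (p.L ^ 2 / p.lam) * a.toReal * Γ * n) + 2 * G.deltaMax θ) := by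
    calc _ ≤ ∑ t ∈ Finset.Icc 1 n,
          (∫⁻ ω, R.trueRatio G p θ t ω ^ (1 / 2 : ℝ) * R.sampInfo G p t ω ^ (1 / 2 : ℝ) ∂P +
          ENNReal.ofReal (G.deltaMax θ) * ENNReal.ofReal (1 / (t : ℝ) ^ 2)) :=
          Finset.sum_le_sum fun t ht => hR.lintegral_sampGap_le h hP hG hθ ht
      _ ≤ (ENNReal.ofReal (16 * max 1 (p.L ^ 2 / p.lam)) * n * a) ^ (1 / 2 : ℝ) *
          (ENNReal.ofReal Γ) ^ (1 / 2 : ℝ) + ENNReal.ofReal (2 * G.deltaMax θ) := by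
          rw [Finset.sum_add_distrib, ← Finset.mul_sum]
          refine add_le_add ?_ ?_
          · refine (sum_lintegral_sqrt_mul_le _ (fun t ht => hR.measurable_trueRatio h ht)
              fun t ht => hR.measurable_sampInfo h ht).trans ?_
            rw [hR.sum_lintegral_sampInfo h]
            gcongr
            exact hR.sum_lintegral_trueRatio_le h hP hG hθ hn.ne'
          · rw [← ENNReal.ofReal_sum_of_nonneg fun t _ => by positivity, mul_comm 2,
              ENNReal.ofReal_mul hΔ]
            gcongr
            exact sum_inv_sq_le n
      _ = _ := by
          rw [ENNReal.ofReal_add (Real.sqrt_nonneg _) (by positivity),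
            ← ENNReal.mul_rpow_of_nonneg _ _ (by norm_num), Real.sqrt_eq_rpow]
          congr 1
          have hΓ : 0 ≤ Γ := integral_nonneg fun ω =>
            Finset.sum_nonneg fun t _ => h.info_nonneg t ω _
          rw [← ENNReal.ofReal_rpow_of_nonneg (by positivity) (by norm_num)]
          congr 1
          generalize 16 * max 1 (p.L ^ 2 / p.lam) = y at hX ⊢
          rw [ENNReal.ofReal_mul (by positivity), ENNReal.ofReal_mul (by positivity),
            ENNReal.ofReal_mul hX, ENNReal.ofReal_toReal ha_top, ENNReal.ofReal_natCast]
          ring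
  exact (hR.regret_le_sum h).trans (ENNReal.toReal_le_of_le_ofReal (by positivity) hsum)

/-- 1 + nY ≤ max{1, Y}(1 + n), and the constant log max{1, Y} is absorbed because log(1 + n) ≥ log
2. -/
theorem log_one_add_mul_le {Y : ℝ} (hY : 0 ≤ Y) {n : ℕ} (hn : 1 ≤ n) :
    Real.log (1 + n * Y) ≤
      (1 + Real.log (max 1 Y) / Real.log 2) * Real.log (1 + n) := by
  have hX : 1 ≤ max 1 Y := le_max_left _ _
  have hYX : Y ≤ max 1 Y := le_max_right _ _
  have hn' : (1 : ℝ) ≤ n := by exact_mod_cast hn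
  have hl2 : 0 < Real.log 2 := Real.log_pos one_lt_two
  have hln : Real.log 2 ≤ Real.log (1 + n) := Real.log_le_log (by norm_num) (by linarith)
  have hlX : 0 ≤ Real.log (max 1 Y) := Real.log_nonneg hX
  calc _ ≤ Real.log (max 1 Y * (1 + n)) := Real.log_le_log (by positivity) (by nlinarith)
    _ = Real.log (max 1 Y) + Real.log (1 + n) := Real.log_mul (by positivity) (by positivity)
    _ ≤ Real.log (max 1 Y) / Real.log 2 * Real.log (1 + n) + Real.log (1 + n) := by
        gcongr
        rw [div_mul_eq_mul_div, le_div_iff₀ hl2]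
        gcongr
    _ = _ := by ring

/-- The constant of the worst-case rate. -/
def rateConst (B L lam ρ : ℝ) : ℝ :=
  √(16 * max 1 (L ^ 2 / lam) *
    (2 * ρ ^ 2 * (4 + (1 + Real.log (max 1 (L ^ 2 / lam)) / Real.log 2)) +
      2 * lam * B ^ 2 / Real.log 2) *
    (1 + Real.log (max 1 (L ^ 2 / lam)) / Real.log 2))

/-- Both β_n and γ_n contribute a factor r log(1+n) under the root, whence r log(1+n) outside it. -/
theorem IsIDS.regret_le_rate [Nonempty A] (hR : IsIDS G p R P θ n) (h : Admissible G p)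
    (hP : G.ParetoCovers) (hG : G.LocallyObservable) (hθ : θ ∈ G.Θ) :
    R.regret G P θ n ≤
      rateConst p.B p.L p.lam p.ρ *
        (r * √(n * (∫⁻ ω, R.alphaBar G p n ω ∂P).toReal) * Real.log (1 + n))
        + 2 * G.deltaMax θ := by
  refine (hR.regret_le h hP hG hθ).trans (add_le_add_left ?_ _)
  have hlam := h.lam_pos
  set Y := p.L ^ 2 / p.lam with hY
  have hY0 : 0 ≤ Y := by positivity
  set X := max 1 Y
  have hX : 1 ≤ X := le_max_left _ _
  set κ := 1 + Real.log X / Real.log 2 with hκ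
  have hl2 : 0 < Real.log 2 := Real.log_pos one_lt_two
  have hκ1 : 0 ≤ κ := by have := Real.log_nonneg hX; positivity
  set b := 2 * p.ρ ^ 2 * (4 + κ) + 2 * p.lam * p.B ^ 2 / Real.log 2 with hb
  have hb0 : 0 ≤ b := by positivity
  set ℓ := Real.log (1 + n)
  have hℓ : 0 ≤ ℓ := Real.log_nonneg (by simp)
  set α := (∫⁻ ω, R.alphaBar G p n ω ∂P).toReal
  have hα : 0 ≤ α := ENNReal.toReal_nonneg
  have hK0 : 0 ≤ rateConst p.B p.L p.lam p.ρ := Real.sqrt_nonneg _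
  rcases Nat.eq_zero_or_pos n with hn0 | hn
  · have : (n : ℝ) = 0 := by exact_mod_cast hn0
    rw [this]
    simp only [mul_zero, Real.sqrt_zero]
    positivity
  have hΓ0 : 0 ≤ ∫ ω, R.gamma G p n ω ∂P := integral_nonneg fun ω =>
    Finset.sum_nonneg fun t _ => h.info_nonneg t ω _
  have hlog : Real.log (1 + n * Y) ≤ κ * ℓ := log_one_add_mul_le hY0 hn
  have hΓ : ∫ ω, R.gamma G p n ω ∂P ≤ r * (κ * ℓ) := by
    have h1 : ∀ ω, R.gamma G p n ω ≤ r * (κ * ℓ) := fun ω => by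
      have h2 := h.gamma_le hn ω (R := R)
      have h3 : (r : ℝ) * Real.log (1 + n * Y) ≤ r * (κ * ℓ) := by gcongr
      have h4 : 0 ≤ R.gamma G p n ω := Finset.sum_nonneg fun t _ => h.info_nonneg t ω _
      linarith
    calc _ ≤ ∫ _, (r * (κ * ℓ) : ℝ) ∂P := by
          refine integral_mono ?_ (integrable_const _) h1
          exact integrable_finsetSum _ fun t ht => hR.integrable_info h ht
      _ = _ := by simp
  -- For r = 0 the information gain vanishes; absorbing the constant part of β_n below needs r ≥ 1.
  rcases Nat.eq_zero_or_pos r with hr0 | hr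
  · have hr : (r : ℝ) = 0 := by exact_mod_cast hr0
    rw [hr, zero_mul] at hΓ
    rw [le_antisymm hΓ hΓ0, mul_zero, zero_mul, Real.sqrt_zero, hr]
    simp
  have hr1 : (1 : ℝ) ≤ r := by exact_mod_cast hr
  have hn1 : (1 : ℝ) ≤ n := by exact_mod_cast hn
  have hℓ2 : Real.log 2 ≤ ℓ := Real.log_le_log (by norm_num) (by linarith)
  have hβ : betaMax p n ≤ b * (r * ℓ) := by
    have h1 : Real.log n ≤ ℓ := Real.log_le_log (by positivity) (by linarith)
    have h2 : ℓ ≤ r * ℓ := by nlinarith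
    have h3 : 1 ≤ r * ℓ / Real.log 2 := by rw [one_le_div hl2]; linarith
    have h4 : 2 * p.lam * p.B ^ 2 ≤ 2 * p.lam * p.B ^ 2 * (r * ℓ / Real.log 2) :=
      le_mul_of_one_le_right (by positivity) h3
    have h5 : 4 * Real.log n + r * Real.log (1 + n * Y) ≤ (4 + κ) * (r * ℓ) := by
      have : (r : ℝ) * Real.log (1 + n * Y) ≤ r * (κ * ℓ) := by gcongr
      nlinarith
    have h6 := mul_le_mul_of_nonneg_left h5 (by positivity : 0 ≤ 2 * p.ρ ^ 2)
    rw [betaMax, hb]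
    calc _ ≤ 2 * p.ρ ^ 2 * ((4 + κ) * (r * ℓ)) + 2 * p.lam * p.B ^ 2 * (r * ℓ / Real.log 2) :=
          add_le_add h6 h4
      _ = _ := by ring
  have hβ0 : 0 ≤ betaMax p n := by
    have := Real.log_nonneg hn1
    have h7 : 0 ≤ Real.log (1 + n * Y) := Real.log_nonneg (by
      have : 0 ≤ n * Y := by positivity
      linarith)
    unfold betaMax
    positivity
  have ha : (∫⁻ ω, R.alphaBar G p n ω * ENNReal.ofReal (R.beta G p n ω) ∂P).toReal ≤
      α * (b * (r * ℓ)) := by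
    have h1 := ENNReal.toReal_mono (ENNReal.mul_ne_top (lintegral_alphaBar_ne_top hG)
      ENNReal.ofReal_ne_top) (h.lintegral_alphaBar_mul_beta_le hn (R := R) (P := P))
    rw [ENNReal.toReal_mul, ENNReal.toReal_ofReal hβ0] at h1
    exact h1.trans (mul_le_mul_of_nonneg_left hβ hα)
  calc _ ≤ √(16 * X * (α * (b * (r * ℓ))) * (r * (κ * ℓ)) * n) := by gcongr
    _ = √((16 * X * b * κ) * (n * α) * (r * ℓ) ^ 2) := by congr 1; ring
    _ = √(16 * X * b * κ) * √(n * α) * (r * ℓ) := by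
        rw [Real.sqrt_mul (by positivity), Real.sqrt_mul (by positivity),
          Real.sqrt_sq (by positivity)]
    _ = _ := by rw [rateConst, ← hY, hb, hκ]; ring

/-- If one action is optimal for every parameter, then information-directed sampling has no
regret. -/
theorem IsIDS.regret_nonpos [Nonempty A] (hR : IsIDS G p R P θ n) (h : Admissible G p)
    (hθ : θ ∈ G.Θ) {c : A} (hc : ∀ θ ∈ G.Θ, G.gap c θ = 0) : R.regret G P θ n ≤ 0 := by
  refine (hR.regret_le_sum h).trans ?_
  have hzero : ∀ t ∈ Finset.Icc 1 n, ∫⁻ ω, R.sampGap G θ t ω ∂P = 0 := by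
    intro t ht
    have ht1 := (Finset.mem_Icc.1 ht).1
    suffices hs : ∀ ω, R.sampGap G θ t ω = 0 by simp [hs]
    intro ω
    have hprob := hR.samp_prob t ht ω
    have hcE : R.gapEst G p t ω c = 0 :=
      le_antisymm (Real.sSup_le (by rintro _ ⟨θ', hθ', rfl⟩; exact (hc θ' hθ'.1).le) le_rfl)
        (h.maxGap_nonneg c)
    -- The Dirac measure at c has ratio 0, so the sampler has ratio 0 and almost surely picks
    -- actions of zero estimated gap.
    have hratio := hR.samp_min t ht ω (Measure.dirac c) inferInstance
    rw [h.ratio_dirac, hcE, zero_pow two_ne_zero, ENNReal.ofReal_zero, ENNReal.zero_div,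
      ratio_eq h ht1, nonpos_iff_eq_zero, ENNReal.div_eq_zero_iff] at hratio
    have hint : ∫⁻ a, ENNReal.ofReal (R.gapEst G p t ω a) ∂(R.samp t ω) = 0 := by
      rcases hratio with h1 | h1
      · exact pow_eq_zero_iff two_ne_zero |>.1 h1
      · exact absurd h1 (sampInfo_lt_top hR h ht ω)
    have hmeas : Measurable fun a => ENNReal.ofReal (R.gapEst G p t ω a) :=
      ENNReal.measurable_ofReal.comp (h.measurable_gapEst t ω)
    rw [lintegral_eq_zero_iff hmeas] at hint
    rw [Run.sampGap, lintegral_eq_zero_iff (h.measurable_gap θ)]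
    filter_upwards [hint] with a ha
    have ha0 : R.gapEst G p t ω a ≤ 0 := by simpa using ha
    simp only [Pi.zero_apply, ENNReal.ofReal_eq_zero]
    have hest := hR.est_mem t ht ω
    set e := θ - R.est t ω with he
    set Q := e.ofLp ⬝ᵥ R.V G p t ω *ᵥ e.ofLp with hQ
    have hβ := h.beta_ge t ω (R := R)
    -- The true θ may lie outside E_t, but a short step from the estimate towards θ stays inside; if
    -- B = 0, Θ is a single point.
    obtain ⟨s, hs0, hs1, hsQ⟩ : ∃ s : ℝ, 0 < s ∧ s ≤ 1 ∧ s ^ 2 * Q ≤ R.beta G p t ω := by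
      rcases h.B_nonneg.eq_or_lt with hB | hB
      · refine ⟨1, one_pos, le_rfl, ?_⟩
        have h1 : ∀ ν ∈ G.Θ, ν = p.θ₀ := fun ν hν => by
          have := h.norm_Θ_le ν hν
          rw [← hB] at this
          exact sub_eq_zero.1 (norm_le_zero_iff.1 this)
        have h2 : e = 0 := by rw [he, h1 θ hθ, h1 _ hest, sub_self]
        rw [hQ, h2]
        simp only [WithLp.ofLp_zero, zero_dotProduct, mul_zero]
        exact sq_nonneg _
      · have hβ0 : 0 < R.beta G p t ω :=
          lt_of_lt_of_le (mul_pos h.lam_pos (by positivity)) hβ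
        have hlim : Filter.Tendsto (fun s : ℝ => s ^ 2 * Q) (nhdsWithin 0 (Set.Ioi 0)) (nhds 0) := by
          have hcont : Continuous fun s : ℝ => s ^ 2 * Q := by fun_prop
          have := hcont.tendsto 0
          simp only [ne_eq, OfNat.ofNat_ne_zero, not_false_eq_true, zero_pow, zero_mul] at this
          exact this.mono_left nhdsWithin_le_nhds
        obtain ⟨s, hs, hs'⟩ := ((hlim.eventually_lt_const hβ0).and
          (Ioo_mem_nhdsGT (zero_lt_one (α := ℝ)))).exists
        exact ⟨s, hs'.1, hs'.2.le, hs.le⟩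
    set θs := R.est t ω + s • e with hθs
    have hmem : θs ∈ R.conf G p t ω := by
      refine ⟨h.convex_Θ.add_smul_sub_mem hest hθ ⟨hs0.le, hs1⟩, ?_⟩
      have : (θs - R.est t ω).ofLp = s • e.ofLp := by rw [hθs, add_sub_cancel_left]; rfl
      rw [this, Matrix.mulVec_smul, dotProduct_smul, smul_dotProduct, smul_eq_mul, smul_eq_mul,
        ← mul_assoc, ← sq]
      exact hsQ
    have h1 : ⟪G.φ c - G.φ a, θs⟫ ≤ 0 :=
      (h.inner_le_gap a c θs).trans ((h.gap_le_maxGap (conf_subset t ω) a hmem).trans ha0)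
    have h2 : 0 ≤ ⟪G.φ c - G.φ a, R.est t ω⟫ := by
      have := h.inner_le_gap c a (R.est t ω)
      rw [hc _ hest, ← neg_sub, inner_neg_left] at this
      linarith
    -- The advantage of c over a is affine along the segment, nonnegative at the estimate and
    -- nonpositive at θs, hence nonpositive at the far end θ.
    have h3 : ⟪G.φ c - G.φ a, θ⟫ ≤ 0 := by
      rw [hθs, he, inner_add_right, inner_smul_right, inner_sub_right] at h1
      by_contra hpos
      push Not at hpos
      nlinarith [mul_nonneg (sub_nonneg.2 hs1) h2, mul_pos hs0 hpos]
    rw [h.gap_eq_add a c, hc θ hθ, zero_add]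
    exact h3
  rw [Finset.sum_eq_zero hzero, ENNReal.toReal_zero]

/-- Without data the estimate is θ₀ and V_1 = λI, so β_1 ≥ λB² covers every parameter. -/
theorem IsIDS.conf_one (hR : IsIDS G p R P θ n) (h : Admissible G p) (hn : 1 ≤ n) (ω : Ω) :
    R.conf G p 1 ω = G.Θ := by
  have h1n : 1 ∈ Finset.Icc 1 n := Finset.mem_Icc.2 ⟨le_rfl, hn⟩
  have hest : R.est 1 ω = p.θ₀ := by
    have h1 : R.lsLoss G p 1 ω (R.est 1 ω) ≤ R.lsLoss G p 1 ω p.θ₀ :=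
      hR.est_min 1 h1n ω h.prior_mem
    simp only [Run.lsLoss, Finset.Ico_self, Finset.sum_empty, sub_self, norm_zero, zero_add] at h1
    have h2 : ‖R.est 1 ω - p.θ₀‖ ^ 2 ≤ 0 := by
      have hlam := h.lam_pos
      by_contra hpos
      push Not at hpos
      have := mul_pos hlam hpos
      simp at h1
      linarith
    have h3 : ‖R.est 1 ω - p.θ₀‖ = 0 := by
      exact pow_eq_zero_iff two_ne_zero |>.1 (le_antisymm h2 (sq_nonneg _))
    exact sub_eq_zero.1 (norm_eq_zero.1 h3)
  refine Set.Subset.antisymm (conf_subset 1 ω) fun ν hν => ⟨hν, ?_⟩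
  refine le_trans ?_ (h.beta_ge 1 ω)
  rw [hest, dotProduct_V_mulVec, Finset.Ico_self, Finset.sum_empty, zero_add,
    ← norm_sq_eq_dotProduct]
  have := h.lam_pos
  gcongr
  exact h.norm_Θ_le ν hν

/-- The first round alone contributes α(Θ) to n·ᾱ_n. -/
theorem IsIDS.alpha_le (hR : IsIDS G p R P θ n) (h : Admissible G p)
    (hG : G.LocallyObservable) (hn : 1 ≤ n) :
    (G.alpha G.Θ).toReal ≤ n * (∫⁻ ω, R.alphaBar G p n ω ∂P).toReal := by
  have hn0 : (n : ℝ≥0∞) ≠ 0 := by exact_mod_cast (by omega : n ≠ 0)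
  have h1 : G.alpha G.Θ ≤ n * ∫⁻ ω, R.alphaBar G p n ω ∂P := by
    rw [← lintegral_const_mul' _ _ (ENNReal.natCast_ne_top n)]
    calc G.alpha G.Θ = ∫⁻ _, G.alpha G.Θ ∂P := by simp
      _ ≤ _ := lintegral_mono fun ω => by
        rw [Run.alphaBar, ENNReal.mul_div_cancel hn0 (ENNReal.natCast_ne_top n)]
        rw [← hR.conf_one h hn ω]
        exact Finset.single_le_sum (f := fun t => G.alpha (R.conf G p t ω))
          (fun _ _ => zero_le) (Finset.mem_Icc.2 ⟨le_rfl, hn⟩)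
  have h2 := ENNReal.toReal_mono (ENNReal.mul_ne_top (ENNReal.natCast_ne_top n)
    (lintegral_alphaBar_ne_top hG)) h1
  simpa using h2

/-- The rate is at least √α(Θ)·log 2 for n ≥ 1, and 2Δ_max ≤ 4·`radius`; their quotient is the extra
constant. -/
theorem IsIDS.regret_le_rate_of_alpha_pos [Nonempty A] (hR : IsIDS G p R P θ n)
    (h : Admissible G p) (hP : G.ParetoCovers) (hG : G.LocallyObservable) (hθ : θ ∈ G.Θ)
    (hr : 1 ≤ r) (hα : 0 < (G.alpha G.Θ).toReal) :
    R.regret G P θ n ≤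
      (rateConst p.B p.L p.lam p.ρ + 4 * p.radius / (√(G.alpha G.Θ).toReal * Real.log 2)) *
        (r * √(n * (∫⁻ ω, R.alphaBar G p n ω ∂P).toReal) * Real.log (1 + n)) := by
  have hl2 : 0 < Real.log 2 := Real.log_pos one_lt_two
  have hT := h.radius_nonneg
  rcases Nat.eq_zero_or_pos n with hn0 | hn
  · have h0 := hR.regret_le_sum h
    subst hn0
    simpa using h0
  refine (hR.regret_le_rate h hP hG hθ).trans ?_
  rw [add_mul]
  refine add_le_add_right ?_ _
  have hn1 : (1 : ℝ) ≤ n := by exact_mod_cast hn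
  have hr1 : (1 : ℝ) ≤ r := by exact_mod_cast hr
  have h1 : √(G.alpha G.Θ).toReal ≤ √(n * (∫⁻ ω, R.alphaBar G p n ω ∂P).toReal) :=
    Real.sqrt_le_sqrt (hR.alpha_le h hG hn)
  have h2 : Real.log 2 ≤ Real.log (1 + n) := Real.log_le_log (by norm_num) (by linarith)
  have h3 : 0 < √(G.alpha G.Θ).toReal := Real.sqrt_pos.2 hα
  have h4 : √(G.alpha G.Θ).toReal * Real.log 2 ≤
      r * √(n * (∫⁻ ω, R.alphaBar G p n ω ∂P).toReal) * Real.log (1 + n) := by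
    refine mul_le_mul (h1.trans ?_) h2 hl2.le (by positivity)
    exact le_mul_of_one_le_left (Real.sqrt_nonneg _) hr1
  have h5 : 2 * G.deltaMax θ ≤ 4 * p.radius := by
    linarith [h.deltaMax_le θ, h.norm_le_radius hθ]
  refine h5.trans ?_
  rw [div_mul_eq_mul_div, le_div_iff₀ (by positivity)]
  gcongr

end Regret

end LinPM

end

/-! ### The main theorem -/

theorem mainTheorem1 :
    ∃ C : ℝ, 0 ≤ C ∧
      -- bounds whose constants do not depend on the game
      (∀ B L lam ρ : ℝ, ∃ K : ℝ, 0 ≤ K ∧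
        ∀ (A : Type u) [TopologicalSpace A] [CompactSpace A] [MeasurableSpace A] [BorelSpace A]
          (d m r : ℕ) (G : LinPM.Game A d m) (p : LinPM.Input d r),
          p.B = B → p.L = L → p.lam = lam → p.ρ = ρ →
          LinPM.Admissible G p → G.ParetoCovers → G.LocallyObservable →
          ∀ (n : ℕ) (θ : EuclideanSpace ℝ (Fin d)), θ ∈ G.Θ →
          ∀ (Ω : Type v) [MeasurableSpace Ω] (P : Measure Ω) [IsProbabilityMeasure P]
            (R : LinPM.Run A d m Ω), LinPM.IsIDS G p R P θ n →
            R.regret G P θ n ≤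
              √(16 * max 1 (L ^ 2 / lam)
                * (∫⁻ ω, R.alphaBar G p n ω * ENNReal.ofReal (R.beta G p n ω) ∂P).toReal
                * (∫ ω, R.gamma G p n ω ∂P) * n)
                + C * G.deltaMax θ ∧
            R.regret G P θ n ≤
              K * (r * √(n * (∫⁻ ω, R.alphaBar G p n ω ∂P).toReal) * Real.log (1 + n))
                + C * G.deltaMax θ) ∧
      -- the rate without an additive term, with a constant that may depend on the game
      (∀ (A : Type u) [TopologicalSpace A] [CompactSpace A] [MeasurableSpace A] [BorelSpace A]
          (d m r : ℕ) (G : LinPM.Game A d m) (p : LinPM.Input d r),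
          LinPM.Admissible G p → G.ParetoCovers → G.LocallyObservable →
          ∃ K : ℝ, 0 ≤ K ∧
          ∀ (n : ℕ) (θ : EuclideanSpace ℝ (Fin d)), θ ∈ G.Θ →
          ∀ (Ω : Type v) [MeasurableSpace Ω] (P : Measure Ω) [IsProbabilityMeasure P]
            (R : LinPM.Run A d m Ω), LinPM.IsIDS G p R P θ n →
            R.regret G P θ n ≤
              K * (r * √(n * (∫⁻ ω, R.alphaBar G p n ω ∂P).toReal) * Real.log (1 + n))) := by
  refine ⟨2, zero_le_two, fun B L lam ρ => ⟨LinPM.rateConst B L lam ρ, Real.sqrt_nonneg _, ?_⟩, ?_⟩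
  · intro A _ _ _ _ d m r G p hB hL hlam hρ h hP hG n θ hθ Ω _ P _ R hR
    obtain ⟨a, -⟩ := hP p.θ₀ h.prior_mem
    have : Nonempty A := ⟨a⟩
    subst hB hL hlam hρ
    exact ⟨hR.regret_le h hP hG hθ, hR.regret_le_rate h hP hG hθ⟩
  · intro A _ _ _ _ d m r G p h hP hG
    obtain ⟨a, -⟩ := hP p.θ₀ h.prior_mem
    have : Nonempty A := ⟨a⟩
    -- Without a universally optimal action both r ≥ 1 and α(Θ) > 0 hold, which is what absorbing
    -- the additive term requires.
    by_cases hopt : ∃ c, ∀ θ ∈ G.Θ, G.gap c θ = 0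
    · obtain ⟨c, hc⟩ := hopt
      refine ⟨0, le_rfl, fun n θ hθ Ω _ P _ R hR => ?_⟩
      rw [zero_mul]
      exact hR.regret_nonpos h hθ hc
    · have hr : 1 ≤ r := Nat.one_le_iff_ne_zero.2 fun hr =>
        hopt (h.exists_optimal_of_rank_zero hP hG hr)
      have hα : 0 < (G.alpha G.Θ).toReal := ENNReal.toReal_pos
        (fun hα => hopt (h.exists_optimal_of_alpha_eq_zero hP hα))
        (LinPM.Game.alpha_lt_top hG subset_rfl).ne
      refine ⟨LinPM.rateConst p.B p.L p.lam p.ρ +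
        4 * p.radius / (√(G.alpha G.Θ).toReal * Real.log 2), ?_,
        fun n θ hθ Ω _ P _ R hR => hR.regret_le_rate_of_alpha_pos h hP hG hθ hr hα⟩
      have h1 := h.radius_nonneg
      have h2 := Real.log_nonneg (one_le_two (α := ℝ))
      have h3 : 0 ≤ LinPM.rateConst p.B p.L p.lam p.ρ := Real.sqrt_nonneg _
      positivity
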